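/- Conventions. A real superalgebra is a unital associative $\mathbb R$-algebra $A=A^0\oplus A^1$ graded by $\mathbb Z/2$; isomorphisms of superalgebras are grading-preserving $\mathbb R$-algebra isomorphisms. A real division superalgebra is a nonzero finite-dimensional real superalgebra in which every nonzero homogeneous element is invertible. $C\ell_{n}$ (resp. $C\ell_{-n}$) is the real Clifford algebra on $n$ anticommuting odd generators with square $+1$ (resp. $-1$); $\mathbb C\ell_1$ is the complex Clifford algebra on one odd generator of square $1$, regarded as a real superalgebra; $\mathbb R,\mathbb C,\mathbb H$ are purely even. For a real algebra $K$, $K(n)=K\otimes_{\mathbb R}\mathrm{Mat}_n(\mathbb R)$ is the algebra of $n\times n$ matrices over $K$. Let $G$ be a group (for instance a compact group) with a surjective homomorphism $\phi:G\to\{\pm1\}$. A (finite-dimensional) $\phi$-representation of $(G,\phi)$ is a finite-dimensional real vector space $V$ with a complex structure $I$ ($I^2=-1$) and a homomorphism $\rho:G\to \mathrm{End}_{\mathbb R}(V)$ with $\rho(1)=1$ and $\rho(g)I=\phi(g)I\rho(g)$ for all $g\in G$. It is irreducible (a $\phi$-irrep) if $V\neq0$ and the only real subspaces stable under $I$ and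 all $\rho(g)$ are $0$ and $V$. Let $\mathcal A\subseteq\mathcal B\subseteq\mathcal D\subseteq\mathrm{End}_{\mathbb R}(V)$ be the real unital subalgebras generated respectively by $\{\rho(g):\phi(g)=1\}$, by $\mathcal A$ and $I$, and by $\{\rho(g):g\in G\}$ and $I$. The $\phi$-irrep has a given Dyson type (a row of the table) if there is $n\ge1$ such that $\mathcal D\cong D(n)$, $\mathcal B\cong B(n)$, $\mathcal A\cong A(n)$ as real algebras, where $(D,B,A)$ is the triple in that row: $$ \begin{array}{c|c|c|c|c} \text{Dyson type} & D & B & A & \mathbb D\\\hline \mathbb{RR} & \mathbb R(2) & \mathbb C & \mathbb R & C\ell_{1}\\ \mathbb{RC} & \mathbb R(2) & \mathbb C & \mathbb C & \mathbb R\\ \mathbb{RH} & \mathbb R(4) & \mathbb C(2) & \mathbb H & C\ell_{-1}\\ \mathbb{CR} & \mathbb C(2) & \mathbb C\oplus\mathbb C & \mathbb R\oplus\mathbb R & C\ell_{2}\\ \mathbb{CC}_1 & \mathbb C(2) & \mathbb C\oplus\mathbb C & \mathbb C\oplus\mathbb C & \mathbb C\\ \mathbb{CC}_2 & \mathbb C(2)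 & \mathbb C\oplus\mathbb C & \mathbb C & \mathbb C\ell_{1}\\ \mathbb{CH} & \mathbb C(4) & \mathbb C(2)\oplus\mathbb C(2) & \mathbb H\oplus\mathbb H & C\ell_{-2}\\ \mathbb{HR} & \mathbb H & \mathbb C & \mathbb R & C\ell_{3}\\ \mathbb{HC} & \mathbb H & \mathbb C & \mathbb C & \mathbb H\\ \mathbb{HH} & \mathbb H(2) & \mathbb C(2) & \mathbb H & C\ell_{-3} \end{array} $$ The endomorphism superalgebra of a $\phi$-representation is $\mathcal W=\mathcal W^0\oplus\mathcal W^1\subseteq\mathrm{End}_{\mathbb R}(V)$, where $$\mathcal W^0=\{f: fI=If,\ f\rho(g)=\rho(g)f\ \forall g\in G\},\qquad \mathcal W^1=\{f: fI=-If,\ f\rho(g)=\phi(g)\rho(g)f\ \forall g\in G\}.$$ Theorem. The assignment of $\mathbb D$ to the Dyson type, given by the table, is a bijection between the ten Dyson types and the isomorphism classes of real division superalgebras: the ten types are distinct (triples $(D(m),B(m),A(m))$ and $(D'(n),B'(n),A'(n))$, $m,n\ge1$, from two different rows are never componentwise isomorphic), every $\mathbb D$ in the table is a real division superalgebra, and every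 real division superalgebra is isomorphic to exactly one of them. Moreover, for every $(G,\phi)$ as above and every finite-dimensional $\phi$-irrep of $(G,\phi)$, the irrep has exactly one Dyson type, $\mathcal W$ is a real division superalgebra, and $\mathcal W$ is isomorphic to the superalgebra $\mathbb D$ assigned to that Dyson type. -/

import Mathlib

universe u v w

open scoped Quaternion

noncomputable section

/-! ### Real superalgebras -/

/-- A real superalgebra: a unital associative `ℝ`-algebra `A = A⁰ ⊕ A¹` graded by `ℤ/2`. -/
structure RealSuperalgebra : Type (u + 1) where
  carrier : Type u
  [ring : Ring carrier]
  [algebra : Algebra ℝ carrier]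
  /-- `grade 0` is the even part and `grade 1` the odd part. -/
  grade : ZMod 2 → Submodule ℝ carrier
  gradedMonoid : SetLike.GradedMonoid grade
  isCompl : IsCompl (grade 0) (grade 1)

attribute [instance] RealSuperalgebra.ring RealSuperalgebra.algebra

namespace RealSuperalgebra

/-- Two real superalgebras are isomorphic if there is a grading-preserving isomorphism of real
algebras between them. -/
def Iso (X : RealSuperalgebra.{u}) (Y : RealSuperalgebra.{v}) : Prop :=
  ∃ e : X.carrier ≃ₐ[ℝ] Y.carrier, ∀ (i : ZMod 2) (x : X.carrier),
    x ∈ X.grade i ↔ e x ∈ Y.grade i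

/-- A finite-dimensional real division superalgebra: nonzero, of finite dimension, and every
nonzero homogeneous element is invertible. -/
structure IsDivision (X : RealSuperalgebra.{u}) : Prop where
  finite : Module.Finite ℝ X.carrier
  nontrivial : Nontrivial X.carrier
  isUnit : ∀ (i : ZMod 2) (x : X.carrier), x ∈ X.grade i → x ≠ 0 → IsUnit x

/-- A real algebra, regarded as a purely even superalgebra. -/
def purelyEven (A : Type u) [Ring A] [Algebra ℝ A] : RealSuperalgebra.{u} where
  carrier := A
  grade i := if i = 0 then ⊤ else ⊥
  gradedMonoid :=
    { one_mem := by simp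
      mul_mem := by
        intro i j x y hx hy
        have key : ∀ i : ZMod 2, i = 0 ∨ i = 1 := by decide
        rcases key i with rfl | rfl <;> rcases key j with rfl | rfl <;> simp_all }
  isCompl := by simpa using isCompl_top_bot

/-- The real Clifford algebra on generators `e i`, `i : Fin n`, that anticommute pairwise and
satisfy `e i ^ 2 = c`; the generators are odd. -/
def clifford (n : ℕ) (c : ℝ) : RealSuperalgebra.{0} where
  carrier := CliffordAlgebra (QuadraticMap.weightedSumSquares ℝ (fun _ : Fin n => c))
  grade := CliffordAlgebra.evenOdd _
  gradedMonoid := inferInstance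
  isCompl := CliffordAlgebra.evenOdd_isCompl _

/-- The complex Clifford algebra on `n` anticommuting odd generators of square `1`, regarded as
a real superalgebra. -/
def complexClifford (n : ℕ) : RealSuperalgebra.{0} where
  carrier := CliffordAlgebra (QuadraticMap.weightedSumSquares ℂ (fun _ : Fin n => (1 : ℂ)))
  algebra := Algebra.complexToReal
  grade i := (CliffordAlgebra.evenOdd
    (QuadraticMap.weightedSumSquares ℂ (fun _ : Fin n => (1 : ℂ))) i).restrictScalars ℝ
  gradedMonoid :=
    { one_mem := SetLike.GradedOne.one_mem (A := CliffordAlgebra.evenOdd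
        (QuadraticMap.weightedSumSquares ℂ (fun _ : Fin n => (1 : ℂ))))
      mul_mem := fun _ _ _ _ hx hy => SetLike.GradedMul.mul_mem (A := CliffordAlgebra.evenOdd
        (QuadraticMap.weightedSumSquares ℂ (fun _ : Fin n => (1 : ℂ)))) hx hy }
  isCompl := by
    have h := CliffordAlgebra.evenOdd_isCompl
      (QuadraticMap.weightedSumSquares ℂ (fun _ : Fin n => (1 : ℂ)))
    constructor
    · rw [Submodule.disjoint_def]
      exact fun x hx hy => Submodule.disjoint_def.mp h.disjoint x hx hy
    · rw [codisjoint_iff, eq_top_iff]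
      intro x _
      obtain ⟨y, hy, z, hz, rfl⟩ := Submodule.mem_sup.mp
        (h.sup_eq_top.symm ▸ Submodule.mem_top : x ∈ _ ⊔ _)
      exact Submodule.mem_sup.mpr ⟨y, hy, z, hz, rfl⟩

end RealSuperalgebra

/-! ### Dyson triples and Dyson types -/

/-- A triple of real algebras `(D, B, A)`. -/
structure AlgTriple : Type (u + 1) where
  D : Type u
  B : Type u
  A : Type u
  [ringD : Ring D]
  [ringB : Ring B]
  [ringA : Ring A]
  [algD : Algebra ℝ D]
  [algB : Algebra ℝ B]
  [algA : Algebra ℝ A]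

attribute [instance] AlgTriple.ringD AlgTriple.ringB AlgTriple.ringA
  AlgTriple.algD AlgTriple.algB AlgTriple.algA

namespace AlgTriple

/-- Componentwise isomorphism of triples of real algebras. -/
def Iso (T : AlgTriple.{u}) (T' : AlgTriple.{v}) : Prop :=
  Nonempty (T.D ≃ₐ[ℝ] T'.D) ∧ Nonempty (T.B ≃ₐ[ℝ] T'.B) ∧ Nonempty (T.A ≃ₐ[ℝ] T'.A)

/-- The triple in which each algebra is tensored with the common factor `ℝ(n)`, that is,
replaced by the algebra of `n × n` matrices over it. -/
def matrix (T : AlgTriple.{u}) (n : ℕ) : AlgTriple.{u} where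
  D := Matrix (Fin n) (Fin n) T.D
  B := Matrix (Fin n) (Fin n) T.B
  A := Matrix (Fin n) (Fin n) T.A

end AlgTriple

/-- The ten Dyson types `[D][A]`. -/
inductive DysonType : Type
  | RR | RC | RH | CR | CC₁ | CC₂ | CH | HR | HC | HH

namespace DysonType

/-- The minimal Dyson triple `(D, B, A)` of each type; the Dyson triples of the type are
its tensor products with `ℝ(n)`, `n ≥ 1`. -/
def minimalTriple : DysonType → AlgTriple.{0}
  | RR => ⟨Matrix (Fin 2) (Fin 2) ℝ, ℂ, ℝ⟩
  | RC => ⟨Matrix (Fin 2) (Fin 2) ℝ, ℂ, ℂ⟩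
  | RH => ⟨Matrix (Fin 4) (Fin 4) ℝ, Matrix (Fin 2) (Fin 2) ℂ, ℍ[ℝ]⟩
  | CR => ⟨Matrix (Fin 2) (Fin 2) ℂ, ℂ × ℂ, ℝ × ℝ⟩
  | CC₁ => ⟨Matrix (Fin 2) (Fin 2) ℂ, ℂ × ℂ, ℂ × ℂ⟩
  | CC₂ => ⟨Matrix (Fin 2) (Fin 2) ℂ, ℂ × ℂ, ℂ⟩
  | CH => ⟨Matrix (Fin 4) (Fin 4) ℂ,
      Matrix (Fin 2) (Fin 2) ℂ × Matrix (Fin 2) (Fin 2) ℂ, ℍ[ℝ] × ℍ[ℝ]⟩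
  | HR => ⟨ℍ[ℝ], ℂ, ℝ⟩
  | HC => ⟨ℍ[ℝ], ℂ, ℂ⟩
  | HH => ⟨Matrix (Fin 2) (Fin 2) ℍ[ℝ], Matrix (Fin 2) (Fin 2) ℂ, ℍ[ℝ]⟩

/-- The real division superalgebra matched with each Dyson type. -/
def superalgebra : DysonType → RealSuperalgebra.{0}
  | RR => .clifford 1 1
  | RC => .purelyEven ℝ
  | RH => .clifford 1 (-1)
  | CR => .clifford 2 1
  | CC₁ => .purelyEven ℂ
  | CC₂ => .complexClifford 1
  | CH => .clifford 2 (-1)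
  | HR => .clifford 3 1
  | HC => .purelyEven ℍ[ℝ]
  | HH => .clifford 3 (-1)

end DysonType

/-! ### φ-representations -/

/-- A `φ`-representation of a `ℤ/2`-graded group `(G, φ)` on a real vector space `V`: a complex
structure `I` and a homomorphism `ρ` such that `ρ g` is `ℂ`-linear if `φ g = 1` and
`ℂ`-antilinear if `φ g = -1`. -/
structure PhiRep {G : Type u} [Group G] (φ : G →* ℤˣ)
    (V : Type v) [AddCommGroup V] [Module ℝ V] where
  I : Module.End ℝ V
  I_mul_I : I * I = -1
  ρ : G →* Module.End ℝ V
  map_mul_I : ∀ g, ρ g * I = ((φ g : ℤ) : ℝ) • (I * ρ g)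

namespace PhiRep

variable {G : Type u} [Group G] {φ : G →* ℤˣ} {V : Type v} [AddCommGroup V] [Module ℝ V]

/-- Irreducibility: `V ≠ 0`, and the only real subspaces stable under `I` and `G` are
`0` and `V`. -/
def IsIrreducible (R : PhiRep φ V) : Prop :=
  Nontrivial V ∧ ∀ W : Submodule ℝ V, (∀ x ∈ W, R.I x ∈ W) → (∀ g, ∀ x ∈ W, R.ρ g x ∈ W) →
    W = ⊥ ∨ W = ⊤

/-- The real algebra generated by the `ρ g` with `φ g = 1`. -/
def algA (R : PhiRep φ V) : Subalgebra ℝ (Module.End ℝ V) :=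
  Algebra.adjoin ℝ (R.ρ '' {g | φ g = 1})

/-- The real algebra obtained by joining `I` to `algA`. -/
def algB (R : PhiRep φ V) : Subalgebra ℝ (Module.End ℝ V) :=
  Algebra.adjoin ℝ (R.ρ '' {g | φ g = 1} ∪ {R.I})

/-- The real algebra generated by all `ρ g` and `I`. -/
def algD (R : PhiRep φ V) : Subalgebra ℝ (Module.End ℝ V) :=
  Algebra.adjoin ℝ (Set.range R.ρ ∪ {R.I})

/-- Dyson's triple of algebras of a `φ`-representation. -/
def dysonTriple (R : PhiRep φ V) : AlgTriple.{v} where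
  D := R.algD
  B := R.algB
  A := R.algA

/-- The `φ`-representation has Dyson type `t`: its triple `(D, B, A)` is, for some `n ≥ 1`, the
minimal triple of `t` tensored with `ℝ(n)`. -/
def HasDysonType (R : PhiRep φ V) (t : DysonType) : Prop :=
  ∃ n : ℕ, 0 < n ∧ R.dysonTriple.Iso (t.minimalTriple.matrix n)

/-- Even endomorphisms: `ℂ`-linear maps commuting with the `G`-action. -/
def evenEnd (R : PhiRep φ V) : Submodule ℝ (Module.End ℝ V) where
  carrier := {f | f * R.I = R.I * f ∧ ∀ g, f * R.ρ g = R.ρ g * f}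
  zero_mem' := by simp
  add_mem' := by
    rintro a b ⟨ha, ha'⟩ ⟨hb, hb'⟩
    exact ⟨by rw [add_mul, mul_add, ha, hb], fun g => by rw [add_mul, mul_add, ha', hb']⟩
  smul_mem' := by
    rintro c a ⟨ha, ha'⟩
    exact ⟨by rw [smul_mul_assoc, mul_smul_comm, ha],
      fun g => by rw [smul_mul_assoc, mul_smul_comm, ha']⟩

/-- Odd endomorphisms: `ℂ`-antilinear maps `f` with `f ρ(g) = φ(g) ρ(g) f`. -/
def oddEnd (R : PhiRep φ V) : Submodule ℝ (Module.End ℝ V) where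
  carrier := {f | f * R.I = -(R.I * f) ∧ ∀ g, f * R.ρ g = ((φ g : ℤ) : ℝ) • (R.ρ g * f)}
  zero_mem' := by simp
  add_mem' := by
    rintro a b ⟨ha, ha'⟩ ⟨hb, hb'⟩
    exact ⟨by rw [add_mul, mul_add, ha, hb, neg_add],
      fun g => by rw [add_mul, mul_add, ha', hb', smul_add]⟩
  smul_mem' := by
    rintro c a ⟨ha, ha'⟩
    exact ⟨by rw [smul_mul_assoc, mul_smul_comm, ha, smul_neg],
      fun g => by rw [smul_mul_assoc, mul_smul_comm, ha', smul_comm]⟩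

/-- The homogeneous components of the endomorphism superalgebra. -/
def gradedEnd (R : PhiRep φ V) (i : ZMod 2) : Submodule ℝ (Module.End ℝ V) :=
  if i = 0 then R.evenEnd else R.oddEnd

theorem sign_mul_self (φ : G →* ℤˣ) (g : G) : ((φ g : ℤ) : ℝ) * ((φ g : ℤ) : ℝ) = 1 := by
  have h : ((φ g : ℤ)) * (φ g : ℤ) = 1 := by
    rw [← Units.val_mul, Int.units_mul_self, Units.val_one]
  exact_mod_cast h

theorem mul_mem_gradedEnd (R : PhiRep φ V) {i j : ZMod 2} {a b : Module.End ℝ V}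
    (ha : a ∈ R.gradedEnd i) (hb : b ∈ R.gradedEnd j) : a * b ∈ R.gradedEnd (i + j) := by
  have h01 : (1 : ZMod 2) ≠ 0 := by decide
  have h11 : (1 : ZMod 2) + 1 = 0 := by decide
  have key : ∀ i : ZMod 2, i = 0 ∨ i = 1 := by decide
  rcases key i with rfl | rfl <;> rcases key j with rfl | rfl <;>
    simp only [gradedEnd, if_true, if_neg h01, add_zero, zero_add, h11] at ha hb ⊢ <;>
    obtain ⟨ha, ha'⟩ := ha <;> obtain ⟨hb, hb'⟩ := hb <;> refine ⟨?_, fun g => ?_⟩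
  · rw [mul_assoc, hb, ← mul_assoc, ha, mul_assoc]
  · rw [mul_assoc, hb', ← mul_assoc, ha', mul_assoc]
  · rw [mul_assoc, hb, mul_neg, ← mul_assoc, ha, mul_assoc]
  · rw [mul_assoc, hb', mul_smul_comm, ← mul_assoc, ha', mul_assoc]
  · rw [mul_assoc, hb, ← mul_assoc, ha, neg_mul, mul_assoc]
  · rw [mul_assoc, hb', ← mul_assoc, ha', smul_mul_assoc, mul_assoc]
  · rw [mul_assoc, hb, mul_neg, ← mul_assoc, ha, neg_mul, neg_neg, mul_assoc]
  · rw [mul_assoc, hb', mul_smul_comm, ← mul_assoc, ha', smul_mul_assoc, smul_smul,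
      sign_mul_self, one_smul, mul_assoc]

/-- The algebra of real-linear super `G`-equivariant endomorphisms: sums `f⁰ + f¹` of an even and
an odd endomorphism. -/
def endAlgebra (R : PhiRep φ V) : Subalgebra ℝ (Module.End ℝ V) where
  carrier := {f | ∃ f₀ ∈ R.evenEnd, ∃ f₁ ∈ R.oddEnd, f₀ + f₁ = f}
  mul_mem' := by
    rintro _ _ ⟨a₀, ha₀, a₁, ha₁, rfl⟩ ⟨b₀, hb₀, b₁, hb₁, rfl⟩
    refine ⟨a₀ * b₀ + a₁ * b₁, R.evenEnd.add_mem ?_ ?_, a₀ * b₁ + a₁ * b₀,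
      R.oddEnd.add_mem ?_ ?_, by noncomm_ring⟩
    · exact R.mul_mem_gradedEnd (i := 0) (j := 0) ha₀ hb₀
    · exact R.mul_mem_gradedEnd (i := 1) (j := 1) ha₁ hb₁
    · exact R.mul_mem_gradedEnd (i := 0) (j := 1) ha₀ hb₁
    · exact R.mul_mem_gradedEnd (i := 1) (j := 0) ha₁ hb₀
  add_mem' := by
    rintro _ _ ⟨a₀, ha₀, a₁, ha₁, rfl⟩ ⟨b₀, hb₀, b₁, hb₁, rfl⟩
    exact ⟨a₀ + b₀, R.evenEnd.add_mem ha₀ hb₀, a₁ + b₁, R.oddEnd.add_mem ha₁ hb₁, by abel⟩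
  algebraMap_mem' c := by
    refine ⟨algebraMap ℝ _ c, ⟨?_, fun g => ?_⟩, 0, R.oddEnd.zero_mem, add_zero _⟩ <;>
      exact Algebra.commutes _ _

/-- The endomorphism superalgebra of a `φ`-representation. -/
def endSuperalgebra (R : PhiRep φ V) : RealSuperalgebra.{v} where
  carrier := R.endAlgebra
  grade i := (R.gradedEnd i).comap R.endAlgebra.val.toLinearMap
  gradedMonoid :=
    { one_mem := by
        change (1 : Module.End ℝ V) ∈ R.evenEnd
        exact ⟨by simp, by simp⟩
      mul_mem := fun _ _ _ _ hx hy => R.mul_mem_gradedEnd hx hy }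
  isCompl := by
    constructor
    · rw [Submodule.disjoint_def]
      rintro ⟨f, hf⟩ h₀ h₁
      have h₀ : f ∈ R.evenEnd := h₀
      have h₁ : f ∈ R.oddEnd := h₁
      have e : R.I * f = -(R.I * f) := h₀.1.symm.trans h₁.1
      have e0 : R.I * f = 0 := by
        have h2 : (2 : ℝ) • (R.I * f) = 0 := by
          rw [two_smul]; nth_rewrite 2 [e]; exact add_neg_cancel _
        exact (smul_eq_zero.mp h2).resolve_left two_ne_zero
      have : f = 0 := by
        have h := congrArg (R.I * ·) e0
        simpa [← mul_assoc, R.I_mul_I] using h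
      exact Subtype.ext this
    · rw [codisjoint_iff, eq_top_iff]
      rintro ⟨_, f₀, h₀, f₁, h₁, rfl⟩ _
      exact Submodule.mem_sup.mpr
        ⟨⟨f₀, f₀, h₀, 0, R.oddEnd.zero_mem, add_zero _⟩, h₀,
          ⟨f₁, 0, R.evenEnd.zero_mem, f₁, h₁, zero_add _⟩, h₁, rfl⟩

end PhiRep

end

/-!
Everything is reduced to generators and relations. The even part of a real division superalgebra is
a division algebra, hence `ℝ`, `ℂ` or `ℍ` by Frobenius' theorem (`exists_isSpan_top`). A nonzero odd
part is a free module of rank one over the even part, and a generator can be normalised: averaged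
over the group generated by the imaginary units, it commutes or anticommutes with them, and rescaled
it has square `±1`. This leaves ten presentations, one for each Dyson type
(`RealSuperalgebra.IsDivision.exists_presents`). A superalgebra satisfies at most one of them
(`Presents.eq`), the superalgebra in the table satisfies the one of its type
(`DysonType.presents_superalgebra`), a superalgebra with such a presentation is a division
superalgebra (`RealSuperalgebra.isDivision_of_presents`), and the presentation determines it up to
isomorphism (`RealSuperalgebra.iso_of_presents`). This is the classification of real division
superalgebras.

For an irreducible `φ`-representation, kernels of homogeneous super-endomorphisms are invariant
subspaces, so `W = W⁰ ⊕ W¹` is a division superalgebra (`PhiRep.IsIrreducible.isDivision`) and has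
one of the ten presentations. To find Dyson's triple, note that `A`, `B` and `D` are normalised by
`I` and all `ρ g`. Hence `V` is semisimple over each of them by Clifford's theorem, and each equals
its double centralizer by Jacobson's density theorem. The commutants are generated by `W⁰` for `D`,
by `W⁰` and `I` for `B`, and by `W⁰`, `W¹` and `I` for `A`, so `D`, `B` and `A` are the centralizers
of these sets (`PhiRep.IsIrreducible.algD_eq`, `algB_eq`, `algA_eq`). In each of the ten cases these
centralizers are computed from the presentation by two moves. The centralizer of a division algebra
`K` isomorphic to its opposite is a matrix algebra over `K`. An involution `e` splits `V` into
eigenspaces: if some other generator anticommutes with `e` the centralizer lives on one eigenspace,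
and otherwise it is a product over both (`centralizer_corner_algEquiv`,
`centralizer_corner_prod_algEquiv`). The involutions that occur are `i I`, `f` and `f j`. The result
is the triple in the table (`PhiRep.IsIrreducible.hasDysonType_of_presents`).

The ten families of triples are told apart by the ratio between the square of the least dimension of
a nonzero principal right ideal and the total dimension. It does not change on passing from `K` to
`M_n(K)`, and its values on `D` and `A` separate all types but `CC₂` and `CH`; for these, `A` is a
prime ring in one case and a product in the other (`DysonType.eq_of_matrix_iso`).
-/

/-! ### Real division algebras -/

section Spans

variable {A : Type*} [Ring A] [Algebra ℝ A]

/-- The subspace `E` consists of real scalars. -/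
def IsRealSpan (E : Submodule ℝ A) : Prop :=
  ∀ x ∈ E, ∃ a : ℝ, x = a • (1 : A)

/-- The subspace `E` is a copy of `ℂ` with imaginary unit `i`. -/
structure IsComplexSpan (E : Submodule ℝ A) (i : A) : Prop where
  mem : i ∈ E
  sq : i * i = -1
  span : ∀ x ∈ E, ∃ a b : ℝ, x = a • (1 : A) + b • i

/-- The subspace `E` is a copy of `ℍ` with imaginary units `i`, `j`, `i * j`. -/
structure IsQuaternionSpan (E : Submodule ℝ A) (i j : A) : Prop where
  mem_i : i ∈ E
  mem_j : j ∈ E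
  sq_i : i * i = -1
  sq_j : j * j = -1
  anti : j * i = -(i * j)
  span : ∀ x ∈ E, ∃ a b c d : ℝ, x = a • (1 : A) + b • i + c • j + d • (i * j)

theorem smul_one_mul_smul_one (a b : ℝ) : (a • (1 : A)) * (b • (1 : A)) = (a * b) • (1 : A) := by
  rw [smul_mul_smul_comm, one_mul]

theorem eq_zero_of_eq_neg_self {x : A} (h : x = -x) : x = 0 := by
  have h2 : (2 : ℝ) • x = 0 := by
    rw [two_smul]; nth_rewrite 2 [h]; exact add_neg_cancel _
  exact (smul_eq_zero.mp h2).resolve_left two_ne_zero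

theorem smul_one_eq_zero [Nontrivial A] {a : ℝ} (h : a • (1 : A) = 0) : a = 0 :=
  (smul_eq_zero.mp h).resolve_right one_ne_zero

/-- An imaginary element that is not zero can be rescaled to an imaginary unit. -/
theorem smul_inv_mul_self {y : A} {s : ℝ} (hs : s ≠ 0) (hy : y * y = -((s * s) • (1 : A))) :
    (s⁻¹ • y) * (s⁻¹ • y) = -1 := by
  rw [smul_mul_smul_comm, hy, smul_neg, smul_smul, show s⁻¹ * s⁻¹ * (s * s) = 1 by field_simp,
    one_smul]

end Spans

section Frobenius

variable {K : Type*} [Ring K] [Algebra ℝ K] [IsDomain K]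

/-- In a real algebra without zero divisors an element whose square is a nonnegative scalar is
itself a scalar. -/
theorem eq_smul_one_of_sq_eq {y : K} {c : ℝ} (hc : 0 ≤ c) (hy : y * y = c • (1 : K)) :
    ∃ a : ℝ, y = a • (1 : K) := by
  have h : (y - √c • 1) * (y + √c • 1) = 0 := by
    have h1 : (y - √c • (1 : K)) * (y + √c • 1) = y * y - (√c * √c) • 1 := by
      simp only [sub_mul, mul_add, mul_smul_comm, smul_mul_assoc, mul_one, one_mul]
      module
    rw [h1, hy, Real.mul_self_sqrt hc, sub_self]
  rcases mul_eq_zero.mp h with h | h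
  · exact ⟨√c, sub_eq_zero.mp h⟩
  · exact ⟨-√c, by rw [neg_smul]; exact eq_neg_of_add_eq_zero_left h⟩

/-- Every element is a scalar plus an element whose square is a nonpositive scalar, since its
minimal polynomial has degree at most two. -/
theorem exists_scalar_add_imaginary [Module.Finite ℝ K] (x : K) :
    ∃ (r s : ℝ) (y : K), x = r • (1 : K) + y ∧ y * y = -((s * s) • (1 : K)) := by
  have hirr := minpoly.irreducible (Algebra.IsIntegral.isIntegral (R := ℝ) x)
  have h0 := minpoly.aeval ℝ x
  have hne := hirr.ne_zero
  obtain ⟨a, b, c, hp⟩ : ∃ a b c : ℝ, minpoly ℝ x =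
      Polynomial.C a * Polynomial.X ^ 2 + Polynomial.C b * Polynomial.X + Polynomial.C c :=
    ⟨_, _, _, Polynomial.eq_quadratic_of_degree_le_two hirr.degree_le_two⟩
  rw [hp] at h0 hne
  simp only [map_add, map_mul, Polynomial.aeval_C, Polynomial.aeval_X,
    Algebra.algebraMap_eq_smul_one, smul_mul_assoc, one_mul, pow_two] at h0
  by_cases ha : a = 0
  · subst ha
    by_cases hb : b = 0
    · subst hb
      have hc : c = 0 := smul_one_eq_zero (A := K) (by simpa using h0)
      simp [hc] at hne
    · refine ⟨-c / b, 0, 0, ?_, by simp⟩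
      have h1 : b • x = -(c • (1 : K)) := eq_neg_of_add_eq_zero_left (by simpa using h0)
      have h2 : x = b⁻¹ • (b • x) := by rw [smul_smul, inv_mul_cancel₀ hb, one_smul]
      rw [h2, h1, add_zero, ← neg_smul, smul_smul]
      congr 1
      ring
  · have hx : x * x = (-(b / a)) • x + (-(c / a)) • (1 : K) := by
      have h2 : x * x = a⁻¹ • (a • (x * x)) := by rw [smul_smul, inv_mul_cancel₀ ha, one_smul]
      have h1 : a • (x * x) = -(b • x + c • (1 : K)) :=
        eq_neg_of_add_eq_zero_left (by rw [← add_assoc]; exact h0)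
      rw [h2, h1, smul_neg, smul_add, smul_smul, smul_smul, neg_add, ← neg_smul, ← neg_smul]
      congr 2 <;> ring
    generalize -(b / a) = p at hx
    generalize -(c / a) = q at hx
    have hy : (x - (p / 2) • (1 : K)) * (x - (p / 2) • 1) = (q + p ^ 2 / 4) • (1 : K) := by
      simp only [sub_mul, mul_sub, mul_smul_comm, smul_mul_assoc, mul_one, one_mul, hx]
      module
    rcases le_total 0 (q + p ^ 2 / 4) with h | h
    · obtain ⟨t, ht⟩ := eq_smul_one_of_sq_eq h hy
      exact ⟨p / 2 + t, 0, 0, by rw [add_zero, add_smul, ← ht, add_sub_cancel], by simp⟩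
    · refine ⟨p / 2, √(-(q + p ^ 2 / 4)), _, (add_sub_cancel _ _).symm, ?_⟩
      rw [Real.mul_self_sqrt (neg_nonneg.mpr h), hy, neg_smul, neg_neg]

/-- **Frobenius' theorem**: a finite-dimensional real division algebra is `ℝ`, `ℂ` or `ℍ`. -/
theorem exists_isSpan_top (K : Type*) [Ring K] [Algebra ℝ K] [IsDomain K] [Module.Finite ℝ K] :
    IsRealSpan (⊤ : Submodule ℝ K) ∨ (∃ i : K, IsComplexSpan ⊤ i) ∨
      ∃ i j : K, IsQuaternionSpan ⊤ i j := by
  have imag : ∀ y : K, ∀ s : ℝ, y * y = -((s * s) • (1 : K)) → s = 0 → y = 0 := by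
    rintro y s hy rfl
    simpa using hy
  by_cases hR : IsRealSpan (⊤ : Submodule ℝ K)
  · exact Or.inl hR
  right
  obtain ⟨i, hi⟩ : ∃ i : K, i * i = -1 := by
    unfold IsRealSpan at hR
    push Not at hR
    obtain ⟨x, -, hx⟩ := hR
    obtain ⟨r, s, y, rfl, hy⟩ := exists_scalar_add_imaginary x
    refine ⟨s⁻¹ • y, smul_inv_mul_self (fun hs => hx r ?_) hy⟩
    rw [imag y s hy hs, add_zero]
  -- The centralizer of `i` is `ℝ + ℝ i`.
  have hcomm : ∀ z : K, z * i = i * z → ∃ a b : ℝ, z = a • (1 : K) + b • i := by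
    intro z hz
    obtain ⟨r, s, y, rfl, hy⟩ := exists_scalar_add_imaginary z
    have hyi : y * i = i * y := by
      simpa [add_mul, mul_add, mul_smul_comm, smul_mul_assoc] using hz
    have h : (y - s • i) * (y + s • i) = 0 := by
      simp only [sub_mul, mul_add, mul_smul_comm, smul_mul_assoc, hy, hyi, hi]
      module
    rcases mul_eq_zero.mp h with h | h
    · exact ⟨r, s, by rw [sub_eq_zero.mp h]⟩
    · exact ⟨r, -s, by rw [eq_neg_of_add_eq_zero_left h, neg_smul]⟩
  have hdec : ∀ x : K, ∃ a b : ℝ, ∃ z, z * i = -(i * z) ∧ x = a • (1 : K) + b • i + z := by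
    intro x
    obtain ⟨a, b, hab⟩ := hcomm ((1 / 2 : ℝ) • (x - i * x * i)) (by
      simp only [smul_mul_assoc, mul_smul_comm, sub_mul, mul_sub, mul_assoc, hi]
      simp only [← mul_assoc, hi]
      simp [add_comm])
    refine ⟨a, b, (1 / 2 : ℝ) • (x + i * x * i), ?_, ?_⟩
    · simp only [smul_mul_assoc, mul_smul_comm, add_mul, mul_add, mul_assoc, hi]
      simp only [← mul_assoc, hi]
      rw [← smul_neg]
      simp
    · rw [← hab]
      module
  by_cases hC : ∀ z : K, z * i = -(i * z) → z = 0
  · refine Or.inl ⟨i, Submodule.mem_top, hi, fun x _ => ?_⟩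
    obtain ⟨a, b, z, hz, rfl⟩ := hdec x
    exact ⟨a, b, by rw [hC z hz, add_zero]⟩
  right
  push Not at hC
  obtain ⟨w, hw, hw0⟩ := hC
  obtain ⟨j, hji, hj⟩ : ∃ j : K, j * i = -(i * j) ∧ j * j = -1 := by
    obtain ⟨a, b, hab⟩ := hcomm (w * w) (by
      rw [mul_assoc, hw, mul_neg, ← mul_assoc, hw, neg_mul, neg_neg, mul_assoc])
    have hb : b • (i * w) = 0 := by
      have h1 : w * (w * w) = w * w * w := (mul_assoc _ _ _).symm
      rw [hab, mul_add, add_mul, mul_smul_comm, mul_smul_comm, smul_mul_assoc, smul_mul_assoc,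
        mul_one, one_mul, hw, smul_neg] at h1
      exact eq_zero_of_eq_neg_self (add_left_cancel h1).symm
    have hi0 : i ≠ 0 := by
      rintro rfl
      simp at hi
    have hb0 : b = 0 := (smul_eq_zero.mp hb).resolve_right (mul_ne_zero hi0 hw0)
    rw [hb0, zero_smul, add_zero] at hab
    have ha : a < 0 := by
      by_contra! ha
      obtain ⟨t, ht⟩ := eq_smul_one_of_sq_eq ha hab
      rw [ht, smul_mul_assoc, mul_smul_comm, one_mul, mul_one] at hw
      have := (smul_eq_zero.mp (eq_zero_of_eq_neg_self hw)).resolve_right hi0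
      rw [this, zero_smul] at ht
      exact hw0 ht
    have hs : √(-a) ≠ 0 := (Real.sqrt_pos.mpr (neg_pos.mpr ha)).ne'
    refine ⟨(√(-a))⁻¹ • w, ?_, smul_inv_mul_self hs ?_⟩
    · rw [smul_mul_assoc, hw, mul_smul_comm, smul_neg]
    · rw [Real.mul_self_sqrt (neg_nonneg.mpr ha.le), hab, neg_smul, neg_neg]
  refine ⟨i, j, Submodule.mem_top, Submodule.mem_top, hi, hj, hji, fun x _ => ?_⟩
  obtain ⟨a, b, z, hz, rfl⟩ := hdec x
  obtain ⟨c, d, hcd⟩ := hcomm (j * z) (by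
    rw [mul_assoc, hz, mul_neg, ← mul_assoc, hji, neg_mul, neg_neg, mul_assoc])
  refine ⟨a, b, -c, d, ?_⟩
  have hz' : z = -(j * (j * z)) := by rw [← mul_assoc, hj, neg_mul, one_mul, neg_neg]
  rw [hz', hcd, mul_add, mul_smul_comm, mul_smul_comm, mul_one, hji]
  module

end Frobenius

/-! ### Presentations of real division superalgebras -/

section Presentations

variable {A : Type*} [Ring A] [Algebra ℝ A] {B : Type*} [Ring B] [Algebra ℝ B]
  {E O : Submodule ℝ A}

/-- The odd part `O` is `f E` for an odd element `f` with `f ^ 2 = s`. -/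
structure IsOddGenerator (E O : Submodule ℝ A) (f : A) (s : ℝ) : Prop where
  mem : f ∈ O
  sq : f * f = s • (1 : A)
  span : ∀ x ∈ O, ∃ y ∈ E, x = f * y

/-- Generators and relations for the division superalgebra `E ⊕ O` attached to each Dyson type:
the even part is `ℝ`, `ℂ` or `ℍ`, and the odd part vanishes or is generated over it by an element
of square `±1` that commutes or anticommutes with the imaginary units. -/
def Presents (E O : Submodule ℝ A) : DysonType → Prop
  | .RR => IsRealSpan E ∧ ∃ f, IsOddGenerator E O f 1
  | .RC => IsRealSpan E ∧ O = ⊥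
  | .RH => IsRealSpan E ∧ ∃ f, IsOddGenerator E O f (-1)
  | .CR => ∃ i, IsComplexSpan E i ∧ ∃ f, IsOddGenerator E O f 1 ∧ f * i = -(i * f)
  | .CC₁ => ∃ i, IsComplexSpan E i ∧ O = ⊥
  | .CC₂ => ∃ i, IsComplexSpan E i ∧ ∃ f, IsOddGenerator E O f 1 ∧ f * i = i * f
  | .CH => ∃ i, IsComplexSpan E i ∧ ∃ f, IsOddGenerator E O f (-1) ∧ f * i = -(i * f)
  | .HR => ∃ i j, IsQuaternionSpan E i j ∧
      ∃ f, IsOddGenerator E O f (-1) ∧ f * i = i * f ∧ f * j = j * f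
  | .HC => ∃ i j, IsQuaternionSpan E i j ∧ O = ⊥
  | .HH => ∃ i j, IsQuaternionSpan E i j ∧
      ∃ f, IsOddGenerator E O f 1 ∧ f * i = i * f ∧ f * j = j * f

theorem IsRealSpan.map (F : A →ₐ[ℝ] B) (h : IsRealSpan E) : IsRealSpan (E.map F.toLinearMap) := by
  rintro _ ⟨x, hx, rfl⟩
  obtain ⟨a, rfl⟩ := h x hx
  exact ⟨a, by simp⟩

theorem IsComplexSpan.map (F : A →ₐ[ℝ] B) {i : A} (h : IsComplexSpan E i) :
    IsComplexSpan (E.map F.toLinearMap) (F i) where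
  mem := ⟨i, h.mem, rfl⟩
  sq := by rw [← map_mul, h.sq, map_neg, map_one]
  span := by
    rintro _ ⟨x, hx, rfl⟩
    obtain ⟨a, b, rfl⟩ := h.span x hx
    exact ⟨a, b, by simp⟩

theorem IsQuaternionSpan.map (F : A →ₐ[ℝ] B) {i j : A} (h : IsQuaternionSpan E i j) :
    IsQuaternionSpan (E.map F.toLinearMap) (F i) (F j) where
  mem_i := ⟨i, h.mem_i, rfl⟩
  mem_j := ⟨j, h.mem_j, rfl⟩
  sq_i := by rw [← map_mul, h.sq_i, map_neg, map_one]
  sq_j := by rw [← map_mul, h.sq_j, map_neg, map_one]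
  anti := by rw [← map_mul, h.anti, map_neg, map_mul]
  span := by
    rintro _ ⟨x, hx, rfl⟩
    obtain ⟨a, b, c, d, rfl⟩ := h.span x hx
    exact ⟨a, b, c, d, by simp⟩

theorem IsOddGenerator.map (F : A →ₐ[ℝ] B) {f : A} {s : ℝ} (h : IsOddGenerator E O f s) :
    IsOddGenerator (E.map F.toLinearMap) (O.map F.toLinearMap) (F f) s where
  mem := ⟨f, h.mem, rfl⟩
  sq := by rw [← map_mul, h.sq, map_smul, map_one]
  span := by
    rintro _ ⟨x, hx, rfl⟩
    obtain ⟨y, hy, rfl⟩ := h.span x hx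
    exact ⟨F y, ⟨y, hy, rfl⟩, by simp⟩

theorem Presents.map (F : A →ₐ[ℝ] B) {t : DysonType} (h : Presents E O t) :
    Presents (E.map F.toLinearMap) (O.map F.toLinearMap) t := by
  have hbot : O = ⊥ → O.map F.toLinearMap = ⊥ := by
    rintro rfl
    exact Submodule.map_bot _
  have hcomm : ∀ x y : A, x * y = y * x → F x * F y = F y * F x := fun x y hxy => by
    rw [← map_mul, hxy, map_mul]
  have hanti : ∀ x y : A, x * y = -(y * x) → F x * F y = -(F y * F x) := fun x y hxy => by
    rw [← map_mul, hxy, map_neg, map_mul]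
  cases t with
  | RC => exact ⟨h.1.map F, hbot h.2⟩
  | RR | RH =>
    obtain ⟨hE, f, hf⟩ := h
    exact ⟨hE.map F, F f, hf.map F⟩
  | CC₁ =>
    obtain ⟨i, hE, hO⟩ := h
    exact ⟨F i, hE.map F, hbot hO⟩
  | CR | CH =>
    obtain ⟨i, hE, f, hf, hfi⟩ := h
    exact ⟨F i, hE.map F, F f, hf.map F, hanti _ _ hfi⟩
  | CC₂ =>
    obtain ⟨i, hE, f, hf, hfi⟩ := h
    exact ⟨F i, hE.map F, F f, hf.map F, hcomm _ _ hfi⟩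
  | HC =>
    obtain ⟨i, j, hE, hO⟩ := h
    exact ⟨F i, F j, hE.map F, hbot hO⟩
  | HR | HH =>
    obtain ⟨i, j, hE, f, hf, hfi, hfj⟩ := h
    exact ⟨F i, F j, hE.map F, F f, hf.map F, hcomm _ _ hfi, hcomm _ _ hfj⟩

theorem IsComplexSpan.commute {i : A} (h : IsComplexSpan E i) {z : A} (hz : z * i = i * z)
    {x : A} (hx : x ∈ E) : z * x = x * z := by
  obtain ⟨a, b, rfl⟩ := h.span x hx
  simp only [mul_add, add_mul, mul_smul_comm, smul_mul_assoc, mul_one, one_mul, hz]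

theorem IsQuaternionSpan.commute {i j : A} (h : IsQuaternionSpan E i j) {z : A}
    (hi : z * i = i * z) (hj : z * j = j * z) {x : A} (hx : x ∈ E) : z * x = x * z := by
  obtain ⟨a, b, c, d, rfl⟩ := h.span x hx
  have hk : z * (i * j) = i * j * z := by rw [← mul_assoc, hi, mul_assoc, hj, mul_assoc]
  simp only [mul_add, add_mul, mul_smul_comm, smul_mul_assoc, mul_one, one_mul, hi, hj, hk]

/-- The sum of the conjugates of `u` under the quaternion group generated by `i` and `j`. -/
def quaternionAverage {A : Type*} [Ring A] (i j u : A) : A :=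
  u - i * u * i - j * u * j - i * j * u * (i * j)

section QuaternionRelations

variable {A : Type*} [Ring A] {i j : A} (hi : i * i = -1) (hj : j * j = -1) (hji : j * i = -(i * j))
include hi hj hji

theorem quaternionAverage_commutes (u : A) :
    quaternionAverage i j u * i = i * quaternionAverage i j u ∧
      quaternionAverage i j u * j = j * quaternionAverage i j u := by
  have hi' (x : A) : i * (i * x) = -x := by rw [← mul_assoc, hi, neg_one_mul]
  have hj' (x : A) : j * (j * x) = -x := by rw [← mul_assoc, hj, neg_one_mul]
  have hji' (x : A) : j * (i * x) = -(i * (j * x)) := by rw [← mul_assoc, hji, neg_mul, mul_assoc]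
  constructor <;>
  · simp only [quaternionAverage, sub_mul, mul_sub, mul_assoc, hi, hj, hji, hi', hj', hji', mul_neg,
      mul_one, neg_neg]
    abel

/-- A `ℍ`-bimodule is generated by the vectors commuting with `i` and `j`. -/
theorem sum_mul_quaternionAverage [Algebra ℝ A] (u : A) :
    quaternionAverage i j u - i * quaternionAverage i j (i * u) -
      j * quaternionAverage i j (j * u) - i * j * quaternionAverage i j (i * j * u) =
        (4 : ℝ) • u := by
  have hi' (x : A) : i * (i * x) = -x := by rw [← mul_assoc, hi, neg_one_mul]
  have hj' (x : A) : j * (j * x) = -x := by rw [← mul_assoc, hj, neg_one_mul]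
  have hji' (x : A) : j * (i * x) = -(i * (j * x)) := by rw [← mul_assoc, hji, neg_mul, mul_assoc]
  simp only [quaternionAverage, mul_sub, mul_assoc, hi', hj', hji', mul_neg, neg_mul, neg_neg]
  module

end QuaternionRelations

theorem IsQuaternionSpan.eq_smul_one {i j : A} (h : IsQuaternionSpan E i j) {x : A} (hx : x ∈ E)
    (hi : x * i = i * x) (hj : x * j = j * x) : ∃ a : ℝ, x = a • (1 : A) := by
  have hi' (x : A) : i * (i * x) = -x := by rw [← mul_assoc, h.sq_i, neg_one_mul]
  have hj' (x : A) : j * (j * x) = -x := by rw [← mul_assoc, h.sq_j, neg_one_mul]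
  have hji' (x : A) : j * (i * x) = -(i * (j * x)) := by
    rw [← mul_assoc, h.anti, neg_mul, mul_assoc]
  have h4 : quaternionAverage i j x = (4 : ℝ) • x := by
    have hk : x * (i * j) = i * j * x := by rw [← mul_assoc, hi, mul_assoc, hj, mul_assoc]
    simp only [quaternionAverage, mul_assoc, hi, hj, hk, hi', hj', hji', mul_neg, neg_neg]
    module
  obtain ⟨a, b, c, d, hab⟩ := h.span x hx
  refine ⟨a, ?_⟩
  have h4' : quaternionAverage i j x = (4 : ℝ) • (a • (1 : A)) := by
    rw [hab]
    simp only [quaternionAverage, mul_add, add_mul, mul_smul_comm, smul_mul_assoc, mul_assoc,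
      h.sq_i, h.sq_j, h.anti, hi', hji', mul_neg, neg_mul, mul_one, one_mul, neg_neg]
    module
  exact smul_right_injective A (four_ne_zero (α := ℝ)) (h4.symm.trans h4')

end Presentations

/-! ### Generators of a division superalgebra -/

namespace RealSuperalgebra

variable {X : RealSuperalgebra.{u}}

theorem mul_mem_grade {i j k : ZMod 2} (hk : i + j = k) {x y : X.carrier} (hx : x ∈ X.grade i)
    (hy : y ∈ X.grade j) : x * y ∈ X.grade k :=
  hk ▸ X.gradedMonoid.mul_mem hx hy

theorem one_mem_grade : (1 : X.carrier) ∈ X.grade 0 := X.gradedMonoid.one_mem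

theorem mul_mem_even {x y : X.carrier} (hx : x ∈ X.grade 0) (hy : y ∈ X.grade 0) :
    x * y ∈ X.grade 0 := mul_mem_grade (by decide) hx hy

theorem odd_mul_odd_mem {x y : X.carrier} (hx : x ∈ X.grade 1) (hy : y ∈ X.grade 1) :
    x * y ∈ X.grade 0 := mul_mem_grade (by decide) hx hy

theorem odd_mul_even_mem {x y : X.carrier} (hx : x ∈ X.grade 1) (hy : y ∈ X.grade 0) :
    x * y ∈ X.grade 1 := mul_mem_grade (by decide) hx hy

theorem even_mul_odd_mem {x y : X.carrier} (hx : x ∈ X.grade 0) (hy : y ∈ X.grade 1) :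
    x * y ∈ X.grade 1 := mul_mem_grade (by decide) hx hy

/-- The even part, as a subalgebra. -/
def evenSubalgebra (X : RealSuperalgebra.{u}) : Subalgebra ℝ X.carrier where
  carrier := X.grade 0
  mul_mem' := mul_mem_even
  add_mem' := (X.grade 0).add_mem
  algebraMap_mem' r := by
    rw [Algebra.algebraMap_eq_smul_one]
    exact (X.grade 0).smul_mem r one_mem_grade

theorem map_val_evenSubalgebra (X : RealSuperalgebra.{u}) :
    (⊤ : Submodule ℝ X.evenSubalgebra).map X.evenSubalgebra.val.toLinearMap = X.grade 0 := by
  ext x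
  constructor
  · rintro ⟨y, -, rfl⟩
    exact y.2
  · exact fun hx => ⟨⟨x, hx⟩, trivial, rfl⟩

namespace IsDivision

variable (hX : X.IsDivision)
include hX

theorem mul_ne_zero {i : ZMod 2} {x y : X.carrier} (hx : x ∈ X.grade i) (hx0 : x ≠ 0)
    (hy0 : y ≠ 0) : x * y ≠ 0 := fun h =>
  hy0 ((hX.isUnit i x hx hx0).mul_right_eq_zero.mp h)

theorem isDomain_evenSubalgebra : IsDomain X.evenSubalgebra := by
  have := hX.nontrivial
  have : NoZeroDivisors X.evenSubalgebra := ⟨by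
    rintro ⟨x, hx⟩ ⟨y, hy⟩ hxy
    by_contra! h
    exact hX.mul_ne_zero hx (fun h0 => h.1 (Subtype.ext h0)) (fun h0 => h.2 (Subtype.ext h0))
      (congrArg Subtype.val hxy)⟩
  exact NoZeroDivisors.to_isDomain _

/-- The even part is `ℝ`, `ℂ` or `ℍ`, by Frobenius' theorem. -/
theorem exists_isSpan : IsRealSpan (X.grade 0) ∨ (∃ i, IsComplexSpan (X.grade 0) i) ∨
    ∃ i j, IsQuaternionSpan (X.grade 0) i j := by
  have := hX.isDomain_evenSubalgebra
  have := hX.finite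
  have : Module.Finite ℝ X.evenSubalgebra :=
    inferInstanceAs (Module.Finite ℝ (Subalgebra.toSubmodule X.evenSubalgebra))
  rw [← X.map_val_evenSubalgebra]
  rcases exists_isSpan_top X.evenSubalgebra with h | ⟨i, h⟩ | ⟨i, j, h⟩
  · exact Or.inl (h.map _)
  · exact Or.inr (Or.inl ⟨_, h.map _⟩)
  · exact Or.inr (Or.inr ⟨_, _, h.map _⟩)

/-- Multiplication by a nonzero odd element maps the even part onto the odd part. -/
theorem exists_eq_odd_mul {f : X.carrier} (hf : f ∈ X.grade 1) (hf0 : f ≠ 0) :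
    ∀ x ∈ X.grade 1, ∃ y ∈ X.grade 0, x = f * y := by
  have := hX.finite
  intro x hx
  have hmul : ∀ {i j : ZMod 2}, 1 + i = j → ∀ y ∈ X.grade i, LinearMap.mulLeft ℝ f y ∈ X.grade j :=
    fun hij y hy => mul_mem_grade hij hf hy
  have hinj : Function.Injective (LinearMap.mulLeft ℝ f) := fun a b hab =>
    (hX.isUnit 1 f hf hf0).mul_left_cancel hab
  -- Multiplication by `f` embeds the two parts into each other, so their dimensions agree.
  let L₀ : X.grade 0 →ₗ[ℝ] X.grade 1 := (LinearMap.mulLeft ℝ f).restrict (hmul (by decide))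
  let L₁ : X.grade 1 →ₗ[ℝ] X.grade 0 := (LinearMap.mulLeft ℝ f).restrict (hmul (by decide))
  have h₀ : Function.Injective L₀ := fun a b hab => Subtype.ext (hinj (congrArg Subtype.val hab))
  have h₁ : Function.Injective L₁ := fun a b hab => Subtype.ext (hinj (congrArg Subtype.val hab))
  have hsurj : Function.Surjective L₀ :=
    (LinearMap.injective_iff_surjective_of_finrank_eq_finrank
      (le_antisymm (LinearMap.finrank_le_finrank_of_injective h₀)
        (LinearMap.finrank_le_finrank_of_injective h₁))).mp h₀
  obtain ⟨y, hy⟩ := hsurj ⟨x, hx⟩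
  exact ⟨y, y.2, (congrArg Subtype.val hy).symm⟩

/-- A nonzero odd element whose square is real can be rescaled to have square `±1`. -/
theorem exists_isOddGenerator {f : X.carrier} (hf : f ∈ X.grade 1) (hf0 : f ≠ 0) {r : ℝ}
    (hr : f * f = r • (1 : X.carrier)) : ∃ c : ℝ,
      IsOddGenerator (X.grade 0) (X.grade 1) (c • f) 1 ∨
      IsOddGenerator (X.grade 0) (X.grade 1) (c • f) (-1) := by
  have hr0 : r ≠ 0 := by
    rintro rfl
    exact hX.mul_ne_zero hf hf0 hf0 (by rw [hr, zero_smul])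
  have habs : 0 < √|r| := Real.sqrt_pos.mpr (abs_pos.mpr hr0)
  have hsq : √|r| * √|r| = |r| := Real.mul_self_sqrt (abs_nonneg r)
  have hmem := (X.grade 1).smul_mem (√|r|)⁻¹ hf
  have hgen : ∀ s : ℝ, (√|r|)⁻¹ * (√|r|)⁻¹ * r = s →
      IsOddGenerator (X.grade 0) (X.grade 1) ((√|r|)⁻¹ • f) s := fun s hs =>
    ⟨hmem, by rw [smul_mul_smul_comm, hr, smul_smul, hs],
      hX.exists_eq_odd_mul hmem (smul_ne_zero (inv_ne_zero habs.ne') hf0)⟩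
  refine ⟨(√|r|)⁻¹, ?_⟩
  rw [← mul_inv, hsq] at hgen
  rcases lt_or_gt_of_ne hr0 with h | h
  · exact Or.inr (hgen _ (by rw [abs_of_neg h]; field_simp))
  · exact Or.inl (hgen _ (by rw [abs_of_pos h]; field_simp))

/-- If the even part is `ℂ`, the odd part is generated by an element that commutes with `i` and
has square `1`, or by one that anticommutes with `i` and has square `±1`. -/
theorem presents_of_isComplexSpan {i : X.carrier} (hE : IsComplexSpan (X.grade 0) i)
    {f : X.carrier} (hf : f ∈ X.grade 1) (hf0 : f ≠ 0) :
    ∃ t, Presents (X.grade 0) (X.grade 1) t := by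
  have := hX.nontrivial
  have hmem : f - i * f * i ∈ X.grade 1 := sub_mem hf
    (odd_mul_even_mem (even_mul_odd_mem hE.mem hf) hE.mem)
  have hcomm : (f - i * f * i) * i = i * (f - i * f * i) := by
    simp only [sub_mul, mul_sub, mul_assoc, hE.sq]
    simp only [← mul_assoc, hE.sq]
    simp [add_comm]
  -- The element `f - i f i` is twice the part of `f` commuting with `i`.
  by_cases h0 : f - i * f * i = 0
  · have hanti : f * i = -(i * f) := by
      nth_rewrite 1 [sub_eq_zero.mp h0]
      rw [mul_assoc, hE.sq, mul_neg, mul_one]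
    obtain ⟨a, b, hab⟩ := hE.span _ (odd_mul_odd_mem hf hf)
    have hb : b • (i * f) = 0 := by
      have h1 : f * (f * f) = f * f * f := (mul_assoc _ _ _).symm
      rw [hab, mul_add, add_mul, mul_smul_comm, mul_smul_comm, smul_mul_assoc, smul_mul_assoc,
        mul_one, one_mul, hanti, smul_neg] at h1
      exact eq_zero_of_eq_neg_self (add_left_cancel h1).symm
    have hi0 : i ≠ 0 := by
      rintro rfl
      simpa using hE.sq
    rw [(smul_eq_zero.mp hb).resolve_right (hX.mul_ne_zero hE.mem hi0 hf0), zero_smul,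
      add_zero] at hab
    obtain ⟨c, hc | hc⟩ := hX.exists_isOddGenerator hf hf0 hab
    · exact ⟨.CR, i, hE, _, hc, by rw [smul_mul_assoc, mul_smul_comm, hanti, smul_neg]⟩
    · exact ⟨.CH, i, hE, _, hc, by rw [smul_mul_assoc, mul_smul_comm, hanti, smul_neg]⟩
  · generalize f - i * f * i = g at hmem hcomm h0
    -- The square of `g` is a complex number; divide `g` by one of its square roots.
    let φ : ℂ →ₐ[ℝ] X.carrier := Complex.lift ⟨i, hE.sq⟩
    have hφ : ∀ z : ℂ, φ z = z.re • (1 : X.carrier) + z.im • i := fun z => by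
      simp [φ, Complex.liftAux_apply, Algebra.algebraMap_eq_smul_one]
    obtain ⟨a, b, hab⟩ := hE.span _ (odd_mul_odd_mem hmem hmem)
    have hz : g * g = φ ⟨a, b⟩ := by rw [hab, hφ]
    have hz0 : (⟨a, b⟩ : ℂ) ≠ 0 := fun h => hX.mul_ne_zero hmem h0 h0 (by rw [hz, h, map_zero])
    obtain ⟨w, hw⟩ := IsAlgClosed.exists_pow_nat_eq (⟨a, b⟩ : ℂ) two_pos
    have hw0 : w ≠ 0 := by
      rintro rfl
      exact hz0 (by rw [← hw]; simp)
    have hgw : φ w⁻¹ * g = g * φ w⁻¹ := by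
      rw [hφ]
      simp only [mul_add, add_mul, mul_smul_comm, smul_mul_assoc, mul_one, one_mul, hcomm]
    have hgi : g * φ w⁻¹ ∈ X.grade 1 := by
      rw [hφ]
      exact odd_mul_even_mem hmem (add_mem ((X.grade 0).smul_mem _ one_mem_grade)
        ((X.grade 0).smul_mem _ hE.mem))
    have hsq : g * φ w⁻¹ * (g * φ w⁻¹) = (1 : ℝ) • 1 := by
      rw [mul_assoc, ← mul_assoc (φ w⁻¹), hgw, mul_assoc g (φ w⁻¹), ← mul_assoc, hz, ← hw,
        ← map_mul, ← map_mul, one_smul, ← map_one φ]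
      congr 1
      field_simp
    refine ⟨.CC₂, i, hE, g * φ w⁻¹, ⟨hgi, hsq, hX.exists_eq_odd_mul hgi fun h => ?_⟩, ?_⟩
    · rw [h, mul_zero, one_smul] at hsq
      exact zero_ne_one hsq
    · rw [hφ]
      simp only [mul_add, add_mul, mul_smul_comm, smul_mul_assoc, mul_one, hcomm, mul_assoc]

/-- If the even part is `ℍ`, the odd part is generated by an element that commutes with it and has
square `±1`. -/
theorem presents_of_isQuaternionSpan {i j : X.carrier} (hE : IsQuaternionSpan (X.grade 0) i j)
    {f : X.carrier} (hf : f ∈ X.grade 1) (hf0 : f ≠ 0) :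
    ∃ t, Presents (X.grade 0) (X.grade 1) t := by
  have hk : i * j ∈ X.grade 0 := mul_mem_even hE.mem_i hE.mem_j
  have hconj : ∀ x ∈ X.grade 0, ∀ u ∈ X.grade 1, x * u * x ∈ X.grade 1 := fun x hx u hu =>
    odd_mul_even_mem (even_mul_odd_mem hx hu) hx
  have hmem : ∀ u ∈ X.grade 1, quaternionAverage i j u ∈ X.grade 1 := fun u hu =>
    sub_mem (sub_mem (sub_mem hu (hconj i hE.mem_i u hu)) (hconj j hE.mem_j u hu))
      (hconj _ hk u hu)
  -- If all averages vanished, so would `f`, which is a combination of averages.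
  obtain ⟨u, hu, hu0⟩ : ∃ u ∈ X.grade 1, quaternionAverage i j u ≠ 0 := by
    by_contra! h
    have h4 := sum_mul_quaternionAverage hE.sq_i hE.sq_j hE.anti f
    rw [h _ hf, h _ (even_mul_odd_mem hE.mem_i hf), h _ (even_mul_odd_mem hE.mem_j hf),
      h _ (even_mul_odd_mem hk hf)] at h4
    simp only [mul_zero, sub_zero] at h4
    exact hf0 ((smul_eq_zero.mp h4.symm).resolve_left four_ne_zero)
  have hg := hmem u hu
  obtain ⟨hgi, hgj⟩ := quaternionAverage_commutes hE.sq_i hE.sq_j hE.anti u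
  generalize quaternionAverage i j u = g at hu0 hg hgi hgj
  obtain ⟨r, hr⟩ := hE.eq_smul_one (odd_mul_odd_mem hg hg)
    (by rw [mul_assoc, hgi, ← mul_assoc, hgi, mul_assoc])
    (by rw [mul_assoc, hgj, ← mul_assoc, hgj, mul_assoc])
  obtain ⟨c, hc | hc⟩ := hX.exists_isOddGenerator hg hu0 hr
  · exact ⟨.HH, i, j, hE, _, hc, by rw [smul_mul_assoc, mul_smul_comm, hgi],
      by rw [smul_mul_assoc, mul_smul_comm, hgj]⟩
  · exact ⟨.HR, i, j, hE, _, hc, by rw [smul_mul_assoc, mul_smul_comm, hgi],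
      by rw [smul_mul_assoc, mul_smul_comm, hgj]⟩

/-- Every real division superalgebra has one of the ten presentations. -/
theorem exists_presents : ∃ t, Presents (X.grade 0) (X.grade 1) t := by
  by_cases hO : X.grade 1 = ⊥
  · rcases hX.exists_isSpan with hE | ⟨i, hE⟩ | ⟨i, j, hE⟩
    · exact ⟨.RC, hE, hO⟩
    · exact ⟨.CC₁, i, hE, hO⟩
    · exact ⟨.HC, i, j, hE, hO⟩
  · obtain ⟨f, hf, hf0⟩ := Submodule.exists_mem_ne_zero_of_ne_bot hO
    rcases hX.exists_isSpan with hE | ⟨i, hE⟩ | ⟨i, j, hE⟩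
    · obtain ⟨r, hr⟩ := hE _ (odd_mul_odd_mem hf hf)
      obtain ⟨c, hc | hc⟩ := hX.exists_isOddGenerator hf hf0 hr
      · exact ⟨.RR, hE, _, hc⟩
      · exact ⟨.RH, hE, _, hc⟩
    · exact hX.presents_of_isComplexSpan hE hf hf0
    · exact hX.presents_of_isQuaternionSpan hE hf hf0

end IsDivision

end RealSuperalgebra

/-! ### Distinctness of the ten presentations -/

theorem IsRealSpan.mul_self_ne_neg_one {A : Type*} [Ring A] [Algebra ℝ A] [Nontrivial A]
    {E : Submodule ℝ A} (hR : IsRealSpan E) {i : A} (hi : i ∈ E) (hsq : i * i = -1) : False := by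
  obtain ⟨a, rfl⟩ := hR i hi
  rw [smul_one_mul_smul_one] at hsq
  have h : (a * a + 1) • (1 : A) = 0 := by rw [add_smul, hsq, one_smul, neg_add_cancel]
  have := smul_one_eq_zero h
  nlinarith [mul_self_nonneg a]

theorem IsComplexSpan.not_isQuaternionSpan {A : Type*} [Ring A] [Algebra ℝ A] [Nontrivial A]
    {E : Submodule ℝ A} {k i j : A} (hC : IsComplexSpan E k) (hH : IsQuaternionSpan E i j) :
    False := by
  have hij : i * j = j * i := hC.commute (hC.commute rfl hH.mem_i).symm hH.mem_j
  have h0 : i * j = 0 := eq_zero_of_eq_neg_self (hij.trans hH.anti)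
  have h1 : i * (i * j) * j = 1 := by
    rw [← mul_assoc, hH.sq_i, neg_one_mul, neg_mul, hH.sq_j, neg_neg]
  rw [h0, mul_zero, zero_mul] at h1
  exact zero_ne_one h1

/-- Which of `ℝ`, `ℂ`, `ℍ` is the even part of the division superalgebra of a given type. -/
def DysonType.evenKind : DysonType → Fin 3
  | .RR | .RC | .RH => 0
  | .CR | .CC₁ | .CC₂ | .CH => 1
  | .HR | .HC | .HH => 2

theorem Presents.isSpan {A : Type*} [Ring A] [Algebra ℝ A] {E O : Submodule ℝ A}
    {t : DysonType} (h : Presents E O t) :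
    (t.evenKind = 0 ∧ IsRealSpan E) ∨ (t.evenKind = 1 ∧ ∃ i, IsComplexSpan E i) ∨
      (t.evenKind = 2 ∧ ∃ i j, IsQuaternionSpan E i j) := by
  cases t with
  | RR | RC | RH => exact Or.inl ⟨rfl, h.1⟩
  | CR | CC₁ | CC₂ | CH => exact Or.inr (Or.inl ⟨rfl, h.imp fun _ h => h.1⟩)
  | HR | HC | HH =>
    obtain ⟨i, j, hE, -⟩ := h
    exact Or.inr (Or.inr ⟨rfl, i, j, hE⟩)

/-- Whether the division superalgebra of a given type has a nonzero odd part. -/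
def DysonType.hasOdd : DysonType → Bool
  | .RC | .CC₁ | .HC => false
  | _ => true

/-- The odd part of a presented superalgebra is zero or has an odd generator. -/
theorem Presents.odd {A : Type*} [Ring A] [Algebra ℝ A] {E O : Submodule ℝ A} {t : DysonType}
    (h : Presents E O t) : (t.hasOdd = false ∧ O = ⊥) ∨
      (t.hasOdd = true ∧ ∃ f s, s ≠ 0 ∧ IsOddGenerator E O f s) := by
  cases t with
  | RR | RH => obtain ⟨-, f, hf⟩ := h; exact Or.inr ⟨rfl, f, _, by norm_num, hf⟩
  | RC => exact Or.inl ⟨rfl, h.2⟩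
  | CC₁ => obtain ⟨i, -, hO⟩ := h; exact Or.inl ⟨rfl, hO⟩
  | HC => obtain ⟨i, j, -, hO⟩ := h; exact Or.inl ⟨rfl, hO⟩
  | CR | CC₂ | CH => obtain ⟨i, -, f, hf, -⟩ := h; exact Or.inr ⟨rfl, f, _, by norm_num, hf⟩
  | HR | HH => obtain ⟨i, j, -, f, hf, -⟩ := h; exact Or.inr ⟨rfl, f, _, by norm_num, hf⟩

section Distinct

variable {A : Type*} [Ring A] [Algebra ℝ A] [Nontrivial A] {E O : Submodule ℝ A}

theorem Presents.evenKind_eq {s t : DysonType} (hs : Presents E O s) (ht : Presents E O t) :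
    s.evenKind = t.evenKind := by
  rcases hs.isSpan with ⟨h, hE⟩ | ⟨h, i, hE⟩ | ⟨h, i, j, hE⟩ <;>
    rcases ht.isSpan with ⟨h', hE'⟩ | ⟨h', i', hE'⟩ | ⟨h', i', j', hE'⟩ <;>
    rw [h, h']
  · exact (IsRealSpan.mul_self_ne_neg_one hE hE'.mem hE'.sq).elim
  · exact (IsRealSpan.mul_self_ne_neg_one hE hE'.mem_i hE'.sq_i).elim
  · exact (IsRealSpan.mul_self_ne_neg_one hE' hE.mem hE.sq).elim
  · exact (hE.not_isQuaternionSpan hE').elim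
  · exact (IsRealSpan.mul_self_ne_neg_one hE' hE.mem_i hE.sq_i).elim
  · exact (hE'.not_isQuaternionSpan hE).elim

theorem IsOddGenerator.ne_bot {f : A} {s : ℝ} (h : IsOddGenerator E O f s) (hs : s ≠ 0)
    (hO : O = ⊥) : False := by
  have hf : f = 0 := by simpa [hO] using h.mem
  have := h.sq
  rw [hf, zero_mul] at this
  exact hs (smul_one_eq_zero this.symm)

/-- Odd generators of square `1` and of square `-1` cannot have squares that differ by a nonnegative
factor. -/
theorem IsOddGenerator.sq_ne {f g : A} (hf : IsOddGenerator E O f 1)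
    (hg : IsOddGenerator E O g (-1)) {a : ℝ} (ha : 0 ≤ a)
    (hgf : g * g = a • (f * f)) : False := by
  have h : (a + 1) • (1 : A) = 0 := by
    have h1 : a • (1 : A) = (-1 : ℝ) • 1 := by rw [← hg.sq, hgf, hf.sq, one_smul]
    rw [add_smul, h1, neg_smul, neg_add_cancel]
  linarith [smul_one_eq_zero h]

theorem IsOddGenerator.cancel_left {f : A} {s : ℝ} (hf : IsOddGenerator E O f s) (hs : s ≠ 0)
    {x y : A} (h : f * x = f * y) : x = y := by
  have h1 := congrArg (f * ·) h
  simp only [← mul_assoc, hf.sq, smul_mul_assoc, one_mul] at h1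
  exact smul_right_injective A hs h1

/-- For an odd generator `f` over `ℝ`, all odd elements `a f` have squares `a ^ 2 f ^ 2`. -/
theorem IsRealSpan.sq_ne (hE : IsRealSpan E) {f g : A} (hf : IsOddGenerator E O f 1)
    (hg : IsOddGenerator E O g (-1)) : False := by
  obtain ⟨y, hy, hgy⟩ := hf.span g hg.mem
  obtain ⟨a, rfl⟩ := hE y hy
  refine hf.sq_ne hg (mul_self_nonneg a) ?_
  rw [hgy, mul_smul_comm, mul_one, smul_mul_smul_comm]

/-- For an odd generator `f` anticommuting with `i`, all odd elements `f (a + b i)` have squares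
`(a ^ 2 + b ^ 2) f ^ 2`. -/
theorem IsComplexSpan.sq_ne {i : A} (hE : IsComplexSpan E i) {f g : A}
    (hf : IsOddGenerator E O f 1) (hg : IsOddGenerator E O g (-1)) (hfi : f * i = -(i * f)) :
    False := by
  obtain ⟨y, hy, hgy⟩ := hf.span g hg.mem
  obtain ⟨a, b, rfl⟩ := hE.span y hy
  refine hf.sq_ne hg (add_nonneg (mul_self_nonneg a) (mul_self_nonneg b)) ?_
  have hyf : (a • (1 : A) + b • i) * f = f * (a • (1 : A) - b • i) := by
    simp only [mul_sub, add_mul, mul_smul_comm, smul_mul_assoc, mul_one, one_mul, hfi]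
    module
  have hnorm : (a • (1 : A) - b • i) * (a • (1 : A) + b • i) = (a * a + b * b) • (1 : A) := by
    simp only [mul_add, sub_mul, mul_smul_comm, smul_mul_assoc, mul_one, one_mul, hE.sq]
    module
  rw [hgy, mul_assoc, ← mul_assoc (_ + _), hyf, mul_assoc f, hnorm, mul_smul_comm, mul_smul_comm,
    mul_one]

/-- If one odd generator commutes with the even part `ℂ`, all odd elements do. -/
theorem IsComplexSpan.not_commutes {i k : A} (hE : IsComplexSpan E i) (hk : k ∈ E)
    (hk2 : k * k = -1) {f g : A} {s r : ℝ} (hf : IsOddGenerator E O f s)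
    (hg : IsOddGenerator E O g r) (hr : r ≠ 0) (hfi : f * i = i * f) (hgk : g * k = -(k * g)) :
    False := by
  obtain ⟨y, hy, hgy⟩ := hf.span g hg.mem
  have hcomm : g * k = k * g := by
    rw [hgy, mul_assoc, hE.commute (hE.commute rfl hy).symm hk, ← mul_assoc, hE.commute hfi hk,
      mul_assoc]
  have h0 : k * g = 0 := eq_zero_of_eq_neg_self (hcomm.symm.trans hgk)
  have hg0 : g = 0 := by
    have h1 : k * (k * g) = -g := by rw [← mul_assoc, hk2, neg_one_mul]
    rw [h0, mul_zero] at h1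
    exact neg_eq_zero.mp h1.symm
  have := hg.sq
  rw [hg0, zero_mul] at this
  exact hr (smul_one_eq_zero this.symm)

/-- Two odd generators commuting with the even part `ℍ` differ by an element of its centre `ℝ`. -/
theorem IsQuaternionSpan.sq_ne {i j k l : A} (hE : IsQuaternionSpan E i j)
    (hE' : IsQuaternionSpan E k l) {f g : A} (hf : IsOddGenerator E O f 1)
    (hg : IsOddGenerator E O g (-1)) (hfi : f * i = i * f) (hfj : f * j = j * f)
    (hgk : g * k = k * g) (hgl : g * l = l * g) : False := by
  obtain ⟨y, hy, hgy⟩ := hf.span g hg.mem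
  have hcomm : ∀ x ∈ E, y * x = x * y := fun x hx => by
    refine hf.cancel_left one_ne_zero ?_
    rw [← mul_assoc, ← hgy, hE'.commute hgk hgl hx, ← mul_assoc, hE.commute hfi hfj hx, hgy,
      mul_assoc]
  obtain ⟨a, rfl⟩ := hE.eq_smul_one hy (hcomm i hE.mem_i) (hcomm j hE.mem_j)
  refine hf.sq_ne hg (mul_self_nonneg a) ?_
  rw [hgy, mul_smul_comm, mul_one, smul_mul_smul_comm]

theorem Presents.hasOdd_eq {s t : DysonType} (hs : Presents E O s) (ht : Presents E O t) :
    s.hasOdd = t.hasOdd := by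
  rcases hs.odd with ⟨h, hO⟩ | ⟨h, f, r, hr, hf⟩ <;>
    rcases ht.odd with ⟨h', hO'⟩ | ⟨h', f', r', hr', hf'⟩ <;> rw [h, h']
  · exact (hf'.ne_bot hr' hO).elim
  · exact (hf.ne_bot hr hO').elim

/-- The ten presentations exclude one another. -/
theorem Presents.eq {s t : DysonType} (hs : Presents E O s) (ht : Presents E O t) : s = t := by
  have hk := hs.evenKind_eq ht
  have ho := hs.hasOdd_eq ht
  have h1 : (1 : ℝ) ≠ 0 := one_ne_zero
  have h1' : (-1 : ℝ) ≠ 0 := by norm_num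
  cases s <;> cases t <;> first
    | rfl
    | exact absurd hk (by decide)
    | exact absurd ho (by decide)
    | exfalso
  case RR.RH =>
    obtain ⟨⟨hE, f, hf⟩, -, g, hg⟩ := hs, ht
    exact hE.sq_ne hf hg
  case RH.RR =>
    obtain ⟨⟨hE, f, hf⟩, -, g, hg⟩ := ht, hs
    exact hE.sq_ne hf hg
  case CR.CH =>
    obtain ⟨⟨i, hE, f, hf, hfi⟩, -, -, g, hg, -⟩ := hs, ht
    exact hE.sq_ne hf hg hfi
  case CH.CR =>
    obtain ⟨⟨i, hE, f, hf, hfi⟩, -, -, g, hg, -⟩ := ht, hs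
    exact hE.sq_ne hf hg hfi
  case CC₂.CR | CC₂.CH =>
    obtain ⟨⟨i, hE, f, hf, hfi⟩, k, hE', g, hg, hgk⟩ := hs, ht
    exact hE.not_commutes hE'.mem hE'.sq hf hg ‹_› hfi hgk
  case CR.CC₂ | CH.CC₂ =>
    obtain ⟨⟨i, hE, f, hf, hfi⟩, k, hE', g, hg, hgk⟩ := ht, hs
    exact hE.not_commutes hE'.mem hE'.sq hf hg ‹_› hfi hgk
  case HH.HR =>
    obtain ⟨⟨i, j, hE, f, hf, hfi, hfj⟩, k, l, hE', g, hg, hgk, hgl⟩ := hs, ht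
    exact hE.sq_ne hE' hf hg hfi hfj hgk hgl
  case HR.HH =>
    obtain ⟨⟨i, j, hE, f, hf, hfi, hfj⟩, k, l, hE', g, hg, hgk, hgl⟩ := ht, hs
    exact hE.sq_ne hE' hf hg hfi hfj hgk hgl

end Distinct

/-! ### The presented superalgebras are division superalgebras -/

theorem isUnit_of_mul_eq_smul_one {A : Type*} [Ring A] [Algebra ℝ A] {x y : A} {c : ℝ}
    (hc : c ≠ 0) (h : x * y = c • (1 : A)) (h' : y * x = c • (1 : A)) : IsUnit x :=
  ⟨⟨x, c⁻¹ • y, by rw [mul_smul_comm, h, smul_smul, inv_mul_cancel₀ hc, one_smul],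
    by rw [smul_mul_assoc, h', smul_smul, inv_mul_cancel₀ hc, one_smul]⟩, rfl⟩

section Units

variable {A : Type*} [Ring A] [Algebra ℝ A] {E O : Submodule ℝ A}

theorem IsRealSpan.isUnit (hE : IsRealSpan E) {x : A} (hx : x ∈ E) (hx0 : x ≠ 0) : IsUnit x := by
  obtain ⟨a, rfl⟩ := hE x hx
  have ha : a ≠ 0 := by
    rintro rfl
    simp at hx0
  exact isUnit_of_mul_eq_smul_one (y := a • 1) (mul_ne_zero ha ha) (smul_one_mul_smul_one a a)
    (smul_one_mul_smul_one a a)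

theorem IsComplexSpan.isUnit {i : A} (hE : IsComplexSpan E i) {x : A} (hx : x ∈ E)
    (hx0 : x ≠ 0) : IsUnit x := by
  obtain ⟨a, b, rfl⟩ := hE.span x hx
  have hab : a * a + b * b ≠ 0 := fun h => by
    have ha : a = 0 := by nlinarith [mul_self_nonneg a, mul_self_nonneg b]
    have hb : b = 0 := by nlinarith [mul_self_nonneg a, mul_self_nonneg b]
    simp [ha, hb] at hx0
  refine isUnit_of_mul_eq_smul_one (y := a • 1 - b • i) hab ?_ ?_ <;>
  · simp only [mul_add, mul_sub, add_mul, sub_mul, mul_smul_comm, smul_mul_assoc, mul_one, one_mul,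
      hE.sq]
    module

theorem IsQuaternionSpan.isUnit {i j : A} (hE : IsQuaternionSpan E i j) {x : A} (hx : x ∈ E)
    (hx0 : x ≠ 0) : IsUnit x := by
  have hi' (x : A) : i * (i * x) = -x := by rw [← mul_assoc, hE.sq_i, neg_one_mul]
  have hj' (x : A) : j * (j * x) = -x := by rw [← mul_assoc, hE.sq_j, neg_one_mul]
  have hji' (x : A) : j * (i * x) = -(i * (j * x)) := by
    rw [← mul_assoc, hE.anti, neg_mul, mul_assoc]
  obtain ⟨a, b, c, d, rfl⟩ := hE.span x hx
  have hab : a * a + b * b + c * c + d * d ≠ 0 := fun h => by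
    have ha := mul_self_nonneg a
    have hb := mul_self_nonneg b
    have hc := mul_self_nonneg c
    have hd := mul_self_nonneg d
    have ha : a = 0 := mul_self_eq_zero.mp (by linarith)
    have hb : b = 0 := mul_self_eq_zero.mp (by linarith)
    have hc : c = 0 := mul_self_eq_zero.mp (by linarith)
    have hd : d = 0 := mul_self_eq_zero.mp (by linarith)
    simp [ha, hb, hc, hd] at hx0
  refine isUnit_of_mul_eq_smul_one (y := a • 1 - b • i - c • j - d • (i * j)) hab ?_ ?_ <;>
  · simp only [mul_add, mul_sub, add_mul, sub_mul, mul_smul_comm, smul_mul_assoc, mul_one, one_mul,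
      mul_assoc, hE.sq_i, hE.sq_j, hE.anti, hi', hji', mul_neg, neg_neg]
    module

theorem IsOddGenerator.isUnit {f : A} {s : ℝ} (hf : IsOddGenerator E O f s) (hs : s ≠ 0)
    (hE : ∀ x ∈ E, x ≠ 0 → IsUnit x) {x : A} (hx : x ∈ O) (hx0 : x ≠ 0) : IsUnit x := by
  obtain ⟨y, hy, rfl⟩ := hf.span x hx
  refine (isUnit_of_mul_eq_smul_one hs hf.sq hf.sq).mul (hE y hy ?_)
  rintro rfl
  simp at hx0

theorem Presents.isUnit_even {t : DysonType} (h : Presents E O t) {x : A} (hx : x ∈ E)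
    (hx0 : x ≠ 0) : IsUnit x := by
  cases t with
  | RR | RC | RH => exact h.1.isUnit hx hx0
  | CR | CC₁ | CC₂ | CH =>
    obtain ⟨i, hE, -⟩ := h
    exact hE.isUnit hx hx0
  | HR | HC | HH =>
    obtain ⟨i, j, hE, -⟩ := h
    exact hE.isUnit hx hx0

theorem Presents.isUnit_odd {t : DysonType} (h : Presents E O t) {x : A} (hx : x ∈ O)
    (hx0 : x ≠ 0) : IsUnit x := by
  rcases h.odd with ⟨-, rfl⟩ | ⟨-, f, s, hs, hf⟩
  · exact (hx0 (by simpa using hx)).elim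
  · exact hf.isUnit hs (fun _ => h.isUnit_even) hx hx0

theorem Presents.finite_even {t : DysonType} (h : Presents E O t) : FiniteDimensional ℝ E := by
  have key : ∀ s : Finset A, (∀ x ∈ E, x ∈ Submodule.span ℝ (s : Set A)) →
      FiniteDimensional ℝ E := fun s hs =>
    have : FiniteDimensional ℝ (Submodule.span ℝ (s : Set A)) :=
      FiniteDimensional.span_finset ℝ s
    Submodule.finiteDimensional_of_le hs
  classical
  rcases h.isSpan with ⟨-, hE⟩ | ⟨-, i, hE⟩ | ⟨-, i, j, hE⟩
  · refine key {1} fun x hx => ?_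
    obtain ⟨a, rfl⟩ := hE x hx
    exact Submodule.smul_mem _ _ (Submodule.subset_span (by simp))
  · refine key {1, i} fun x hx => ?_
    obtain ⟨a, b, rfl⟩ := hE.span x hx
    exact add_mem (Submodule.smul_mem _ _ (Submodule.subset_span (by simp)))
      (Submodule.smul_mem _ _ (Submodule.subset_span (by simp)))
  · refine key {1, i, j, i * j} fun x hx => ?_
    obtain ⟨a, b, c, d, rfl⟩ := hE.span x hx
    refine add_mem (add_mem (add_mem ?_ ?_) ?_) ?_ <;>
    exact Submodule.smul_mem _ _ (Submodule.subset_span (by simp))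

theorem Presents.finite_odd {t : DysonType} (h : Presents E O t) : FiniteDimensional ℝ O := by
  have := h.finite_even
  rcases h.odd with ⟨-, rfl⟩ | ⟨-, f, s, -, hf⟩
  · infer_instance
  · refine Submodule.finiteDimensional_of_le (S₂ := E.map (LinearMap.mulLeft ℝ f)) fun x hx => ?_
    obtain ⟨y, hy, rfl⟩ := hf.span x hx
    exact ⟨y, hy, rfl⟩

end Units

theorem RealSuperalgebra.isDivision_of_presents {X : RealSuperalgebra.{u}} [Nontrivial X.carrier]
    {t : DysonType} (h : Presents (X.grade 0) (X.grade 1) t) : X.IsDivision where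
  finite := by
    have := h.finite_even
    have := h.finite_odd
    have : FiniteDimensional ℝ ↥(X.grade 0 ⊔ X.grade 1) := inferInstance
    rw [X.isCompl.sup_eq_top] at this
    exact Module.Finite.equiv Submodule.topEquiv
  nontrivial := inferInstance
  isUnit i x hx hx0 := by
    have key : ∀ i : ZMod 2, i = 0 ∨ i = 1 := by decide
    rcases key i with rfl | rfl
    · exact h.isUnit_even hx hx0
    · exact h.isUnit_odd hx hx0

/-! ### Presentations of the ten standard superalgebras -/

theorem isRealSpan_bot {A : Type*} [Ring A] [Algebra ℝ A] :
    IsRealSpan (Subalgebra.toSubmodule (⊥ : Subalgebra ℝ A)) := by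
  intro x hx
  obtain ⟨a, rfl⟩ := Algebra.mem_bot.mp hx
  exact ⟨a, Algebra.algebraMap_eq_smul_one a⟩

theorem Complex.isComplexSpan_top : IsComplexSpan (⊤ : Submodule ℝ ℂ) Complex.I where
  mem := trivial
  sq := Complex.I_mul_I
  span z _ := ⟨z.re, z.im, by apply Complex.ext <;> simp⟩

/-- The imaginary unit `i` of `ℍ`. -/
def quaternionI : ℍ[ℝ] := ⟨0, 1, 0, 0⟩

/-- The imaginary unit `j` of `ℍ`. -/
def quaternionJ : ℍ[ℝ] := ⟨0, 0, 1, 0⟩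

@[simp] theorem quaternionI_re : quaternionI.re = 0 := rfl
@[simp] theorem quaternionI_imI : quaternionI.imI = 1 := rfl
@[simp] theorem quaternionI_imJ : quaternionI.imJ = 0 := rfl
@[simp] theorem quaternionI_imK : quaternionI.imK = 0 := rfl
@[simp] theorem quaternionJ_re : quaternionJ.re = 0 := rfl
@[simp] theorem quaternionJ_imI : quaternionJ.imI = 0 := rfl
@[simp] theorem quaternionJ_imJ : quaternionJ.imJ = 1 := rfl
@[simp] theorem quaternionJ_imK : quaternionJ.imK = 0 := rfl

theorem Quaternion.isQuaternionSpan_top :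
    IsQuaternionSpan (⊤ : Submodule ℝ ℍ[ℝ]) quaternionI quaternionJ where
  mem_i := trivial
  mem_j := trivial
  sq_i := by apply Quaternion.ext <;> simp
  sq_j := by apply Quaternion.ext <;> simp
  anti := by apply Quaternion.ext <;> simp
  span q _ := ⟨q.re, q.imI, q.imJ, q.imK, by apply Quaternion.ext <;> simp⟩

section Lifts

variable {A : Type*} [Ring A] [Algebra ℝ A]

/-- The homomorphism from `ℍ` determined by images of the imaginary units. -/
def quaternionHom {i j : A} (hi : i * i = -1) (hj : j * j = -1) (hji : j * i = -(i * j)) :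
    ℍ[ℝ] →ₐ[ℝ] A :=
  QuaternionAlgebra.lift (R := ℝ) (c₁ := -1) (c₂ := 0) (c₃ := -1)
    { i := i, j := j, k := i * j
      i_mul_i := by simp [hi]
      j_mul_j := by simp [hj]
      i_mul_j := rfl
      j_mul_i := by simp [hji] }

theorem quaternionHom_apply {i j : A} (hi : i * i = -1) (hj : j * j = -1)
    (hji : j * i = -(i * j)) (q : ℍ[ℝ]) : quaternionHom hi hj hji q =
      q.re • (1 : A) + q.imI • i + q.imJ • j + q.imK • (i * j) := by
  rw [← Algebra.algebraMap_eq_smul_one]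
  rfl

/-- The homomorphism from `ℂ` determined by the image of the imaginary unit. -/
def complexHom {i : A} (hi : i * i = -1) : ℂ →ₐ[ℝ] A := Complex.lift ⟨i, hi⟩

theorem complexHom_apply {i : A} (hi : i * i = -1) (z : ℂ) :
    complexHom hi z = z.re • (1 : A) + z.im • i := by
  simp [complexHom, Complex.liftAux_apply, Algebra.algebraMap_eq_smul_one]

theorem isComplexSpan_range {i : A} (hi : i * i = -1) :
    IsComplexSpan (Subalgebra.toSubmodule (complexHom hi).range) i := by
  have h := Complex.isComplexSpan_top.map (complexHom hi)
  rw [complexHom_apply] at h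
  convert h using 1
  · ext x
    simp
  · simp

theorem isQuaternionSpan_range {i j : A} (hi : i * i = -1) (hj : j * j = -1)
    (hji : j * i = -(i * j)) :
    IsQuaternionSpan (Subalgebra.toSubmodule (quaternionHom hi hj hji).range) i j := by
  have h := Quaternion.isQuaternionSpan_top.map (quaternionHom hi hj hji)
  rw [quaternionHom_apply, quaternionHom_apply] at h
  convert h using 1
  · ext x
    simp
  · simp
  · simp

end Lifts

/-- An invertible odd element generates the odd part. -/
theorem RealSuperalgebra.isOddGenerator {X : RealSuperalgebra.{u}} {f : X.carrier} {s : ℝ}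
    (hs : s ≠ 0) (hf : f ∈ X.grade 1) (hsq : f * f = s • (1 : X.carrier)) :
    IsOddGenerator (X.grade 0) (X.grade 1) f s where
  mem := hf
  sq := hsq
  span x hx := ⟨s⁻¹ • (f * x), (X.grade 0).smul_mem _ (odd_mul_odd_mem hf hx), by
    rw [mul_smul_comm, ← mul_assoc, hsq, smul_mul_assoc, one_mul, smul_smul,
      inv_mul_cancel₀ hs, one_smul]⟩

theorem presents_purelyEven_real : Presents ((RealSuperalgebra.purelyEven ℝ).grade 0)
    ((RealSuperalgebra.purelyEven ℝ).grade 1) .RC :=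
  ⟨fun x _ => ⟨x, (mul_one x).symm⟩, rfl⟩

theorem presents_purelyEven_complex : Presents ((RealSuperalgebra.purelyEven ℂ).grade 0)
    ((RealSuperalgebra.purelyEven ℂ).grade 1) .CC₁ :=
  ⟨Complex.I, Complex.isComplexSpan_top, rfl⟩

theorem presents_purelyEven_quaternion : Presents ((RealSuperalgebra.purelyEven ℍ[ℝ]).grade 0)
    ((RealSuperalgebra.purelyEven ℍ[ℝ]).grade 1) .HC :=
  ⟨_, _, Quaternion.isQuaternionSpan_top, rfl⟩

section Clifford

open CliffordAlgebra

theorem CliffordAlgebra.evenOdd_zero_le {R M : Type*} [CommRing R] [AddCommGroup M] [Module R M]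
    {Q : QuadraticForm R M} (S : Subalgebra R (CliffordAlgebra Q))
    (hS : ∀ v w, ι Q v * ι Q w ∈ S) : evenOdd Q 0 ≤ Subalgebra.toSubmodule S := by
  intro x hx
  induction x, hx using even_induction with
  | algebraMap r => exact S.algebraMap_mem r
  | add x y hx hy ihx ihy => exact S.add_mem ihx ihy
  | ι_mul_ι_mul v w x hx ih => exact S.mul_mem (hS v w) ih

/-- The quadratic form `c (x₁ ^ 2 + ⋯ + xₙ ^ 2)`. -/
abbrev cliffordForm (n : ℕ) (c : ℝ) : QuadraticForm ℝ (Fin n → ℝ) :=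
  QuadraticMap.weightedSumSquares ℝ (fun _ : Fin n => c)

/-- The `k`-th generator of the real Clifford algebra. -/
def cliffordGen (n : ℕ) (c : ℝ) (k : Fin n) : CliffordAlgebra (cliffordForm n c) :=
  ι _ (Pi.single k 1)

variable {n : ℕ} {c : ℝ}

theorem cliffordGen_mem (k : Fin n) :
    cliffordGen n c k ∈ (RealSuperalgebra.clifford n c).grade 1 :=
  ι_mem_evenOdd_one _ _

theorem cliffordGen_mul_self (k : Fin n) : cliffordGen n c k * cliffordGen n c k =
    c • (1 : CliffordAlgebra (cliffordForm n c)) := by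
  rw [cliffordGen, ι_sq_scalar, Algebra.algebraMap_eq_smul_one,
    QuadraticMap.weightedSumSquares_apply,
    Finset.sum_eq_single k (fun l _ hl => by simp [hl]) (by simp)]
  simp

theorem cliffordGen_anti {k l : Fin n} (hkl : k ≠ l) : cliffordGen n c l * cliffordGen n c k =
    -(cliffordGen n c k * cliffordGen n c l) := by
  refine eq_neg_of_add_eq_zero_left (ι_mul_ι_add_swap_of_isOrtho ?_)
  rw [QuadraticMap.isOrtho_def]
  simp only [QuadraticMap.weightedSumSquares_apply, smul_eq_mul]
  rw [← Finset.sum_add_distrib]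
  refine Finset.sum_congr rfl fun m _ => ?_
  rcases eq_or_ne m l with rfl | hm
  · simp [hkl.symm]
  · simp [hm]

/-- The even part of a Clifford algebra lies in every subalgebra containing the products of two
distinct generators. -/
theorem clifford_even_le (S : Subalgebra ℝ (CliffordAlgebra (cliffordForm n c)))
    (hS : ∀ k l, k < l → cliffordGen n c k * cliffordGen n c l ∈ S) :
    evenOdd (cliffordForm n c) 0 ≤ Subalgebra.toSubmodule S := by
  have hS' : ∀ k l, cliffordGen n c k * cliffordGen n c l ∈ S := by
    intro k l
    rcases lt_trichotomy k l with h | rfl | h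
    · exact hS k l h
    · rw [cliffordGen_mul_self]
      exact S.smul_mem S.one_mem c
    · rw [cliffordGen_anti h.ne]
      exact S.neg_mem (hS l k h)
  have hsum : ∀ v : Fin n → ℝ, ι (cliffordForm n c) v = ∑ k, v k • cliffordGen n c k := fun v => by
    conv_lhs => rw [pi_eq_sum_univ' v]
    simp only [map_sum, map_smul]
    rfl
  refine CliffordAlgebra.evenOdd_zero_le S fun v w => ?_
  rw [hsum, hsum, Finset.sum_mul]
  refine S.sum_mem fun k _ => ?_
  rw [Finset.mul_sum]
  refine S.sum_mem fun l _ => ?_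
  rw [smul_mul_smul_comm]
  exact S.smul_mem (hS' k l) _

theorem IsComplexSpan.of_le {A : Type*} [Ring A] [Algebra ℝ A] {E E' : Submodule ℝ A} {i : A}
    (h : IsComplexSpan E i) (hE : E' ≤ E) (hi : i ∈ E') : IsComplexSpan E' i :=
  ⟨hi, h.sq, fun x hx => h.span x (hE hx)⟩

theorem IsQuaternionSpan.of_le {A : Type*} [Ring A] [Algebra ℝ A] {E E' : Submodule ℝ A} {i j : A}
    (h : IsQuaternionSpan E i j) (hE : E' ≤ E) (hi : i ∈ E') (hj : j ∈ E') :
    IsQuaternionSpan E' i j :=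
  ⟨hi, hj, h.sq_i, h.sq_j, h.anti, fun x hx => h.span x (hE hx)⟩

theorem cliffordGen_mul_mem (k l : Fin n) :
    cliffordGen n c k * cliffordGen n c l ∈ evenOdd (cliffordForm n c) 0 :=
  ι_mul_ι_mem_evenOdd_zero _ _ _

theorem isOddGenerator_clifford {f : CliffordAlgebra (cliffordForm n c)} {s : ℝ} (hs : s ≠ 0)
    (hf : f ∈ evenOdd (cliffordForm n c) 1)
    (hsq : f * f = s • (1 : CliffordAlgebra (cliffordForm n c))) :
    IsOddGenerator (evenOdd (cliffordForm n c) 0) (evenOdd (cliffordForm n c) 1) f s :=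
  RealSuperalgebra.isOddGenerator (X := .clifford n c) hs hf hsq

theorem clifford_one_isRealSpan : IsRealSpan (evenOdd (cliffordForm 1 c) 0) := fun x hx =>
  isRealSpan_bot x (clifford_even_le ⊥ (fun k l hkl => absurd hkl (by simp)) hx)

theorem clifford_two_isComplexSpan (hc : c * c = 1) :
    IsComplexSpan (evenOdd (cliffordForm 2 c) 0) (cliffordGen 2 c 0 * cliffordGen 2 c 1) := by
  have h10 : cliffordGen 2 c 1 * cliffordGen 2 c 0 = -(cliffordGen 2 c 0 * cliffordGen 2 c 1) :=
    cliffordGen_anti (by decide)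
  have hsq : cliffordGen 2 c 0 * cliffordGen 2 c 1 * (cliffordGen 2 c 0 * cliffordGen 2 c 1) =
      -1 := by
    rw [mul_assoc, ← mul_assoc (cliffordGen 2 c 1), h10, neg_mul, mul_assoc,
      cliffordGen_mul_self, mul_neg, ← mul_assoc, cliffordGen_mul_self, smul_one_mul_smul_one, hc,
      one_smul]
  refine (isComplexSpan_range hsq).of_le (clifford_even_le _ fun k l hkl => ?_)
    (cliffordGen_mul_mem _ _)
  obtain ⟨rfl, rfl⟩ : k = 0 ∧ l = 1 := by omega
  exact (isComplexSpan_range hsq).mem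

theorem presents_clifford_two (hc : c * c = 1) :
    ∃ i, IsComplexSpan (evenOdd (cliffordForm 2 c) 0) i ∧
      ∃ f, IsOddGenerator (evenOdd (cliffordForm 2 c) 0) (evenOdd (cliffordForm 2 c) 1) f c ∧
        f * i = -(i * f) := by
  refine ⟨_, clifford_two_isComplexSpan hc, cliffordGen 2 c 0,
    isOddGenerator_clifford (left_ne_zero_of_mul_eq_one hc) (cliffordGen_mem 0)
      (cliffordGen_mul_self 0), ?_⟩
  rw [mul_assoc (cliffordGen 2 c 0) (cliffordGen 2 c 1) (cliffordGen 2 c 0),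
    cliffordGen_anti (show (0 : Fin 2) ≠ 1 by decide), mul_neg, neg_neg]

/-- The even part of the Clifford algebra on three generators is `ℍ`, and the product of the
generators is central. -/
theorem presents_clifford_three (hc : c * c = 1) :
    ∃ i j, IsQuaternionSpan (evenOdd (cliffordForm 3 c) 0) i j ∧
      ∃ f, IsOddGenerator (evenOdd (cliffordForm 3 c) 0) (evenOdd (cliffordForm 3 c) 1) f (-c) ∧
        f * i = i * f ∧ f * j = j * f := by
  have hc0 : c ≠ 0 := left_ne_zero_of_mul_eq_one hc
  have ha := cliffordGen_mul_self (c := c) (0 : Fin 3)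
  have hb := cliffordGen_mul_self (c := c) (1 : Fin 3)
  have hd := cliffordGen_mul_self (c := c) (2 : Fin 3)
  have hba := cliffordGen_anti (c := c) (show (0 : Fin 3) ≠ 1 by decide)
  have hda := cliffordGen_anti (c := c) (show (0 : Fin 3) ≠ 2 by decide)
  have hdb := cliffordGen_anti (c := c) (show (1 : Fin 3) ≠ 2 by decide)
  have hab_mem := cliffordGen_mul_mem (c := c) (0 : Fin 3) 1
  have hbd_mem := cliffordGen_mul_mem (c := c) (1 : Fin 3) 2
  have hf_mem : cliffordGen 3 c 0 * cliffordGen 3 c 1 * cliffordGen 3 c 2 ∈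
      evenOdd (cliffordForm 3 c) 1 :=
    RealSuperalgebra.even_mul_odd_mem (X := .clifford 3 c) hab_mem (cliffordGen_mem 2)
  have hle := clifford_even_le (n := 3) (c := c)
  have hgen : ∀ f (s : ℝ), s ≠ 0 → f ∈ _ → _ → _ := fun f s hs hf hsq =>
    isOddGenerator_clifford (n := 3) (c := c) (f := f) (s := s) hs hf hsq
  have hlt : ∀ k l : Fin 3, k < l → (k = 0 ∧ l = 1) ∨ (k = 0 ∧ l = 2) ∨ (k = 1 ∧ l = 2) := by
    decide
  generalize hx : cliffordGen 3 c 0 = x at *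
  generalize hy : cliffordGen 3 c 1 = y at *
  generalize hz : cliffordGen 3 c 2 = z at *
  have ha' (u) : x * (x * u) = c • u := by rw [← mul_assoc, ha, smul_mul_assoc, one_mul]
  have hb' (u) : y * (y * u) = c • u := by rw [← mul_assoc, hb, smul_mul_assoc, one_mul]
  have hd' (u) : z * (z * u) = c • u := by rw [← mul_assoc, hd, smul_mul_assoc, one_mul]
  have hba' (u) : y * (x * u) = -(x * (y * u)) := by rw [← mul_assoc, hba, neg_mul, mul_assoc]
  have hda' (u) : z * (x * u) = -(x * (z * u)) := by rw [← mul_assoc, hda, neg_mul, mul_assoc]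
  have hdb' (u) : z * (y * u) = -(y * (z * u)) := by rw [← mul_assoc, hdb, neg_mul, mul_assoc]
  have h1 : x * y * (x * y) = -1 := by
    simp only [mul_assoc, ha, hb, hba', mul_neg, mul_smul_comm, smul_smul, hc, mul_one, one_smul]
  have h2 : y * z * (y * z) = -1 := by
    simp only [mul_assoc, hb, hd, hdb', mul_neg, mul_smul_comm, smul_smul, hc, mul_one, one_smul]
  have h3 : y * z * (x * y) = -(x * y * (y * z)) := by
    simp only [mul_assoc, hda', hdb, hba', hb', mul_neg, mul_smul_comm, neg_neg]
  have hS := isQuaternionSpan_range h1 h2 h3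
  refine ⟨x * y, y * z, hS.of_le (hle _ fun k l hkl => ?_) hab_mem hbd_mem, x * y * z,
    hgen _ _ (neg_ne_zero.mpr hc0) hf_mem ?_, ?_, ?_⟩
  · rcases hlt k l hkl with ⟨rfl, rfl⟩ | ⟨rfl, rfl⟩ | ⟨rfl, rfl⟩
    · rw [hx, hy]
      exact hS.mem_i
    · rw [hx, hz]
      have : x * z = c • ((x * y) * (y * z)) := by
        simp only [mul_assoc, hb', mul_smul_comm, smul_smul, hc, one_smul]
      rw [this]
      exact Subalgebra.smul_mem _ (Subalgebra.mul_mem _ hS.mem_i hS.mem_j) c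
    · rw [hy, hz]
      exact hS.mem_j
  · simp only [mul_assoc, ha, hb, hd, hdb', hda', hba', mul_neg, neg_neg, mul_smul_comm,
      smul_smul, hc, mul_one, one_smul, neg_smul, smul_neg]
  · simp only [mul_assoc, hdb, hda', hb', hba', ha', mul_neg, neg_neg, mul_smul_comm]
  · simp only [mul_assoc, hd, hdb', hda', hba', hb, mul_neg, neg_neg, mul_smul_comm, mul_one,
      smul_neg]

instance clifford_nontrivial : Nontrivial (RealSuperalgebra.clifford n c).carrier :=
  inferInstanceAs (Nontrivial (CliffordAlgebra _))

/-- The quadratic form `x₁ ^ 2 + ⋯ + xₙ ^ 2` over `ℂ`. -/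
abbrev complexCliffordForm (n : ℕ) : QuadraticForm ℂ (Fin n → ℂ) :=
  QuadraticMap.weightedSumSquares ℂ (fun _ : Fin n => (1 : ℂ))

instance complexClifford_nontrivial : Nontrivial (RealSuperalgebra.complexClifford n).carrier :=
  inferInstanceAs (Nontrivial (CliffordAlgebra (complexCliffordForm n)))

theorem presents_complexClifford_one :
    Presents ((RealSuperalgebra.complexClifford 1).grade 0)
      ((RealSuperalgebra.complexClifford 1).grade 1) .CC₂ := by
  -- The real structure is the restriction of the complex one.
  have hsmul : ∀ (r : ℝ) (x : CliffordAlgebra (complexCliffordForm 1)),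
      algebraMap ℂ _ (r : ℂ) * x = r • x := fun r x => by
    rw [← Algebra.smul_def]; rfl
  let i : CliffordAlgebra (complexCliffordForm 1) := algebraMap ℂ _ Complex.I
  have hii : i * i = -1 := by
    rw [← map_mul, Complex.I_mul_I, map_neg, map_one]
  let f : CliffordAlgebra (complexCliffordForm 1) := ι _ (Pi.single 0 1)
  have hff : f * f = 1 := by
    rw [ι_sq_scalar]
    simp
  have hfi : f * i = i * f := (Algebra.commutes _ _).symm
  refine ⟨i, ⟨?_, hii, ?_⟩, f, ?_, hfi⟩
  · exact SetLike.algebraMap_mem_graded (evenOdd (complexCliffordForm 1)) _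
  · intro (x : CliffordAlgebra (complexCliffordForm 1)) hx
    have hx' : x ∈ (⊥ : Subalgebra ℂ (CliffordAlgebra (complexCliffordForm 1))) := by
      refine CliffordAlgebra.evenOdd_zero_le ⊥ (fun v w => ?_) hx
      have hv : ∀ v : Fin 1 → ℂ, ι (complexCliffordForm 1) v = v 0 • f := fun v => by
        rw [← map_smul]
        congr 1
        ext k
        rw [Subsingleton.elim k 0]
        simp
      rw [hv, hv, smul_mul_smul_comm, hff]
      exact Subalgebra.smul_mem _ (Subalgebra.one_mem _) _
    obtain ⟨z, rfl⟩ := Algebra.mem_bot.mp hx'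
    refine ⟨z.re, z.im, ?_⟩
    have hz : algebraMap ℂ (CliffordAlgebra (complexCliffordForm 1)) z =
        algebraMap ℂ _ (z.re : ℂ) * 1 + algebraMap ℂ _ (z.im : ℂ) * i := by
      rw [mul_one, ← map_mul, ← map_add, Complex.re_add_im]
    exact hz.trans (congrArg₂ (· + ·) (hsmul _ _) (hsmul _ _))
  · exact RealSuperalgebra.isOddGenerator (X := .complexClifford 1) one_ne_zero
      (ι_mem_evenOdd_one _ _) (hff.trans (one_smul ℝ _).symm)

end Clifford

instance DysonType.superalgebra_nontrivial (t : DysonType) : Nontrivial t.superalgebra.carrier := by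
  cases t
  case RC => exact inferInstanceAs (Nontrivial ℝ)
  case CC₁ => exact inferInstanceAs (Nontrivial ℂ)
  case HC => exact inferInstanceAs (Nontrivial ℍ[ℝ])
  case CC₂ => exact complexClifford_nontrivial
  all_goals exact clifford_nontrivial

theorem DysonType.presents_superalgebra (t : DysonType) :
    Presents (t.superalgebra.grade 0) (t.superalgebra.grade 1) t := by
  cases t
  case RC => exact presents_purelyEven_real
  case CC₁ => exact presents_purelyEven_complex
  case HC => exact presents_purelyEven_quaternion
  case CC₂ => exact presents_complexClifford_one
  case RR => exact ⟨clifford_one_isRealSpan, _, isOddGenerator_clifford one_ne_zero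
    (cliffordGen_mem 0) (cliffordGen_mul_self 0)⟩
  case RH => exact ⟨clifford_one_isRealSpan, _, isOddGenerator_clifford (by norm_num)
    (cliffordGen_mem 0) (cliffordGen_mul_self 0)⟩
  case CR => exact presents_clifford_two (by norm_num)
  case CH => exact presents_clifford_two (by norm_num)
  case HR => exact presents_clifford_three (by norm_num)
  case HH =>
    have h := presents_clifford_three (c := -1) (by norm_num)
    rw [neg_neg] at h
    exact h

/-! ### Isomorphism with the standard superalgebras -/

namespace RealSuperalgebra

theorem exists_even_add_odd {X : RealSuperalgebra.{u}} (x : X.carrier) :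
    ∃ y ∈ X.grade 0, ∃ z ∈ X.grade 1, y + z = x :=
  Submodule.mem_sup.mp (X.isCompl.sup_eq_top.symm ▸ Submodule.mem_top)

theorem even_odd_unique {X : RealSuperalgebra.{u}} {y y' z z' : X.carrier} (hy : y ∈ X.grade 0)
    (hy' : y' ∈ X.grade 0) (hz : z ∈ X.grade 1) (hz' : z' ∈ X.grade 1) (h : y + z = y' + z') :
    y = y' ∧ z = z' := by
  have h1 : y - y' = z' - z := by rw [sub_eq_sub_iff_add_eq_add, h, add_comm]
  have h0 := Submodule.disjoint_def.mp X.isCompl.disjoint _ (sub_mem hy hy')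
    (h1 ▸ sub_mem hz' hz)
  exact ⟨sub_eq_zero.mp h0, (sub_eq_zero.mp (h1 ▸ h0)).symm⟩

/-- A surjective grading-preserving homomorphism from a division superalgebra to a nonzero
superalgebra is an isomorphism: a nonzero homogeneous element is a unit, so it is not mapped to
zero. -/
theorem IsDivision.iso_of_hom {X : RealSuperalgebra.{u}} {Y : RealSuperalgebra.{v}}
    (hY : Y.IsDivision) [Nontrivial X.carrier] (F : Y.carrier →ₐ[ℝ] X.carrier)
    (h0 : ∀ y ∈ Y.grade 0, F y ∈ X.grade 0) (h1 : ∀ y ∈ Y.grade 1, F y ∈ X.grade 1)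
    (hF : F.range = ⊤) : X.Iso Y := by
  have hzero : ∀ i, ∀ y ∈ Y.grade i, F y = 0 → y = 0 := fun i y hy hFy => by
    by_contra hne
    exact ((hY.isUnit i y hy hne).map F).ne_zero hFy
  have hinj : Function.Injective F := by
    rw [injective_iff_map_eq_zero]
    intro y hy
    obtain ⟨a, ha, b, hb, rfl⟩ := exists_even_add_odd y
    rw [map_add, ← add_zero 0] at hy
    obtain ⟨ha0, hb0⟩ := even_odd_unique (h0 a ha) (zero_mem _) (h1 b hb) (zero_mem _) hy
    rw [hzero 0 a ha ha0, hzero 1 b hb hb0, add_zero]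
  let e := AlgEquiv.ofBijective F ⟨hinj, AlgHom.range_eq_top F |>.mp hF⟩
  have he : ∀ (i : ZMod 2) (y : Y.carrier), y ∈ Y.grade i ↔ F y ∈ X.grade i := by
    intro i y
    obtain ⟨a, ha, b, hb, rfl⟩ := exists_even_add_odd y
    have key : ∀ i : ZMod 2, i = 0 ∨ i = 1 := by decide
    rcases key i with rfl | rfl
    · refine ⟨h0 _, fun h => ?_⟩
      have := (even_odd_unique h (h0 a ha) (zero_mem _) (h1 b hb)
        (by rw [map_add, add_zero])).2
      rw [hzero 1 b hb this.symm, add_zero]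
      exact ha
    · refine ⟨h1 _, fun h => ?_⟩
      have := (even_odd_unique (zero_mem _) (h0 a ha) h (h1 b hb)
        (by rw [map_add, zero_add])).1
      rw [hzero 0 a ha this.symm, zero_add]
      exact hb
  refine ⟨e.symm, fun i x => ?_⟩
  rw [he]
  exact Eq.to_iff (congrArg (· ∈ X.grade i) (e.apply_symm_apply x).symm)

theorem eq_top_of_grade_le {X : RealSuperalgebra.{u}} {S : Subalgebra ℝ X.carrier}
    (h0 : ∀ x ∈ X.grade 0, x ∈ S) (h1 : ∀ x ∈ X.grade 1, x ∈ S) : S = ⊤ := by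
  rw [eq_top_iff]
  intro x _
  obtain ⟨a, ha, b, hb, rfl⟩ := exists_even_add_odd x
  exact S.add_mem (h0 a ha) (h1 b hb)

theorem purelyEven_iso {A : Type v} [Ring A] [Algebra ℝ A] {X : RealSuperalgebra.{u}}
    [Nontrivial X.carrier] (hA : (purelyEven A).IsDivision) (hO : X.grade 1 = ⊥)
    (F : A →ₐ[ℝ] X.carrier) (hF : ∀ x ∈ X.grade 0, x ∈ F.range) : X.Iso (purelyEven A) := by
  have h0 : X.grade 0 = ⊤ := by simpa [hO] using X.isCompl.sup_eq_top
  refine hA.iso_of_hom F (fun y _ => by rw [h0]; trivial) (fun y hy => ?_)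
    (eq_top_of_grade_le hF fun x hx => ?_)
  · have hy0 : y = 0 := hy
    rw [hy0]
    exact (congrArg (· ∈ X.grade 1) (map_zero F)).mpr (zero_mem _)
  · rw [hO, Submodule.mem_bot] at hx
    rw [hx]
    exact F.range.zero_mem

open CliffordAlgebra in
/-- The homomorphism from a Clifford algebra to a superalgebra determined by images of the
generators preserves the grading. -/
theorem lift_mem_grade {R M : Type*} [CommRing R] [Algebra ℝ R] [AddCommGroup M] [Module R M]
    {Q : QuadraticForm R M} {X : RealSuperalgebra.{u}} [Algebra R X.carrier]
    [IsScalarTower ℝ R X.carrier] (F : CliffordAlgebra Q →ₐ[R] X.carrier)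
    (hR : ∀ r, algebraMap R X.carrier r ∈ X.grade 0) (hF : ∀ v, F (ι Q v) ∈ X.grade 1) :
    (∀ y ∈ evenOdd Q 0, F y ∈ X.grade 0) ∧ ∀ y ∈ evenOdd Q 1, F y ∈ X.grade 1 := by
  constructor
  · intro y hy
    induction y, hy using even_induction with
    | algebraMap r => rw [AlgHom.commutes]; exact hR r
    | add x y hx hy ihx ihy => rw [map_add]; exact add_mem ihx ihy
    | ι_mul_ι_mul v w x hx ih =>
      rw [map_mul, map_mul]
      exact mul_mem_even (odd_mul_odd_mem (hF v) (hF w)) ih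
  · intro y hy
    induction y, hy using odd_induction with
    | ι v => exact hF v
    | add x y hx hy ihx ihy => rw [map_add]; exact add_mem ihx ihy
    | ι_mul_ι_mul v w x hx ih =>
      rw [map_mul, map_mul]
      exact even_mul_odd_mem (odd_mul_odd_mem (hF v) (hF w)) ih

/-- A superalgebra generated by odd elements satisfying the Clifford relations is isomorphic to the
Clifford algebra. -/
theorem clifford_iso {X : RealSuperalgebra.{u}} [Nontrivial X.carrier] {n : ℕ} {c : ℝ}
    (hC : (clifford n c).IsDivision) (g : Fin n → X.carrier) (hg : ∀ k, g k ∈ X.grade 1)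
    (hsq : ∀ k, g k * g k = c • (1 : X.carrier))
    (hanti : ∀ k l, k < l → g l * g k = -(g k * g l))
    (hgen : ∀ S : Subalgebra ℝ X.carrier, (∀ k, g k ∈ S) →
      (∀ x ∈ X.grade 0, x ∈ S) ∧ ∀ x ∈ X.grade 1, x ∈ S) :
    X.Iso (clifford n c) := by
  have hrel : ∀ k l, g k * g l + g l * g k = if k = l then (2 * c) • (1 : X.carrier) else 0 := by
    intro k l
    rcases lt_trichotomy k l with h | rfl | h
    · rw [if_neg h.ne, hanti k l h, add_neg_cancel]
    · rw [if_pos rfl, hsq, two_mul, add_smul]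
    · rw [if_neg h.ne', hanti l k h, neg_add_cancel]
  have hcond : ∀ v : Fin n → ℝ, Fintype.linearCombination ℝ g v * Fintype.linearCombination ℝ g v =
      algebraMap ℝ X.carrier (cliffordForm n c v) := by
    intro v
    have h2 : ∑ k, ∑ l, (v k * v l) • (g k * g l + g l * g k) =
        (2 : ℝ) • (cliffordForm n c v) • (1 : X.carrier) := by
      simp only [hrel, smul_ite, smul_zero, Finset.sum_ite_eq, Finset.mem_univ, if_true,
        QuadraticMap.weightedSumSquares_apply, Finset.sum_smul, Finset.smul_sum, smul_smul,
        smul_eq_mul]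
      refine Finset.sum_congr rfl fun k _ => ?_
      congr 1
      ring
    have h3 : ∑ k, ∑ l, (v k * v l) • (g k * g l + g l * g k) =
        (2 : ℝ) • (Fintype.linearCombination ℝ g v * Fintype.linearCombination ℝ g v) := by
      simp only [smul_add, Finset.sum_add_distrib, two_smul]
      congr 1
      · simp only [Fintype.linearCombination_apply, Finset.sum_mul_sum, smul_mul_smul_comm]
      · rw [Finset.sum_comm]
        simp only [Fintype.linearCombination_apply, Finset.sum_mul_sum, smul_mul_smul_comm,
          mul_comm]
    rw [Algebra.algebraMap_eq_smul_one]
    exact smul_right_injective _ (two_ne_zero (α := ℝ)) (h3.symm.trans h2)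
  let F : CliffordAlgebra (cliffordForm n c) →ₐ[ℝ] X.carrier := CliffordAlgebra.lift _ ⟨_, hcond⟩
  have hF : ∀ v, F (CliffordAlgebra.ι _ v) = Fintype.linearCombination ℝ g v := fun v =>
    CliffordAlgebra.lift_ι_apply _ _ v
  have hmem := lift_mem_grade (X := X) F
    (fun r => by
      rw [Algebra.algebraMap_eq_smul_one]; exact Submodule.smul_mem _ _ one_mem_grade)
    (fun v => by
      rw [hF, Fintype.linearCombination_apply]
      exact Submodule.sum_mem _ fun k _ => Submodule.smul_mem _ _ (hg k))
  obtain ⟨hS0, hS1⟩ := hgen F.range fun k =>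
    ⟨CliffordAlgebra.ι _ (Pi.single k 1), (hF _).trans (by
      rw [Fintype.linearCombination_apply_single, one_smul])⟩
  exact hC.iso_of_hom F hmem.1 hmem.2 (eq_top_of_grade_le hS0 hS1)

theorem isDivision_superalgebra (t : DysonType) : t.superalgebra.IsDivision :=
  isDivision_of_presents t.presents_superalgebra

/-- The imaginary unit is central, so the superalgebra is a complex algebra and the universal
property of the complex Clifford algebra applies. -/
theorem iso_complexClifford_one {X : RealSuperalgebra.{u}} [Nontrivial X.carrier] {i f : X.carrier}
    (hE : IsComplexSpan (X.grade 0) i) (hf : IsOddGenerator (X.grade 0) (X.grade 1) f 1)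
    (hfi : f * i = i * f) : X.Iso (complexClifford 1) := by
  have hff : f * f = 1 := by rw [hf.sq, one_smul]
  have hcentral : ∀ x, i * x = x * i := by
    intro x
    obtain ⟨y, hy, z, hz, rfl⟩ := exists_even_add_odd x
    obtain ⟨w, hw, rfl⟩ := hf.span z hz
    rw [mul_add, add_mul, hE.commute rfl hy, ← mul_assoc, ← hfi, mul_assoc, mul_assoc,
      hE.commute rfl hw]
  let _ : Algebra ℂ X.carrier := RingHom.toAlgebra' (complexHom hE.sq).toRingHom fun z x => by
    change complexHom hE.sq z * x = x * complexHom hE.sq z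
    rw [complexHom_apply, add_mul, mul_add, smul_mul_assoc, smul_mul_assoc, mul_smul_comm,
      mul_smul_comm, hcentral, one_mul, mul_one]
  have hmap : ∀ z, algebraMap ℂ X.carrier z = z.re • (1 : X.carrier) + z.im • i :=
    complexHom_apply hE.sq
  have : IsScalarTower ℝ ℂ X.carrier := IsScalarTower.of_algebraMap_eq fun r =>
    ((complexHom hE.sq).commutes r).symm
  have hcond : ∀ v : Fin 1 → ℂ, Fintype.linearCombination ℂ (fun _ : Fin 1 => f) v *
      Fintype.linearCombination ℂ (fun _ : Fin 1 => f) v =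
        algebraMap ℂ X.carrier (complexCliffordForm 1 v) := by
    intro v
    rw [Algebra.algebraMap_eq_smul_one]
    simp only [Fintype.linearCombination_apply, Finset.univ_unique, Finset.sum_singleton,
      smul_mul_smul_comm, hff, one_smul, QuadraticMap.weightedSumSquares_apply]
  let F : CliffordAlgebra (complexCliffordForm 1) →ₐ[ℂ] X.carrier :=
    CliffordAlgebra.lift _ ⟨_, hcond⟩
  have hF : ∀ v, F (CliffordAlgebra.ι _ v) =
      Fintype.linearCombination ℂ (fun _ : Fin 1 => f) v := fun v =>
    CliffordAlgebra.lift_ι_apply _ _ v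
  have hE0 : ∀ z, algebraMap ℂ X.carrier z ∈ X.grade 0 := fun z => by
    rw [hmap]
    exact add_mem (Submodule.smul_mem _ _ one_mem_grade) (Submodule.smul_mem _ _ hE.mem)
  have hmem := lift_mem_grade (X := X) F hE0 (fun v => by
    rw [hF, Fintype.linearCombination_apply]
    refine Submodule.sum_mem _ fun k _ => ?_
    rw [Algebra.smul_def]
    exact even_mul_odd_mem (hE0 _) hf.mem)
  let F' : CliffordAlgebra (complexCliffordForm 1) →ₐ[ℝ] X.carrier := F.restrictScalars ℝ
  have hFf : f ∈ F'.range := ⟨CliffordAlgebra.ι _ (Pi.single 0 1), (hF _).trans (by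
    rw [Fintype.linearCombination_apply_single, one_smul])⟩
  have hFE : ∀ x ∈ X.grade 0, x ∈ F'.range := fun x hx => by
    obtain ⟨a, b, rfl⟩ := hE.span x hx
    refine ⟨algebraMap ℂ _ ⟨a, b⟩, (F.commutes _).trans (hmap _)⟩
  refine (isDivision_superalgebra .CC₂).iso_of_hom F' hmem.1 hmem.2
    (eq_top_of_grade_le hFE fun x hx => ?_)
  obtain ⟨y, hy, rfl⟩ := hf.span x hx
  exact F'.range.mul_mem hFf (hFE y hy)

theorem clifford_one_iso {X : RealSuperalgebra.{u}} [Nontrivial X.carrier] {c : ℝ}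
    (hC : (clifford 1 c).IsDivision) (hE : IsRealSpan (X.grade 0)) {f : X.carrier}
    (hf : IsOddGenerator (X.grade 0) (X.grade 1) f c) : X.Iso (clifford 1 c) := by
  refine clifford_iso hC (fun _ => f) (fun _ => hf.mem) (fun _ => hf.sq)
    (fun k l hkl => absurd hkl (by simp)) fun S hS => ?_
  have h0 : ∀ x ∈ X.grade 0, x ∈ S := fun x hx => by
    obtain ⟨a, rfl⟩ := hE x hx
    exact S.smul_mem S.one_mem a
  refine ⟨h0, fun x hx => ?_⟩
  obtain ⟨y, hy, rfl⟩ := hf.span x hx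
  exact S.mul_mem (hS 0) (h0 y hy)

theorem clifford_two_iso {X : RealSuperalgebra.{u}} [Nontrivial X.carrier] {c : ℝ}
    (hc : c * c = 1) (hC : (clifford 2 c).IsDivision) {i f : X.carrier}
    (hE : IsComplexSpan (X.grade 0) i) (hf : IsOddGenerator (X.grade 0) (X.grade 1) f c)
    (hfi : f * i = -(i * f)) : X.Iso (clifford 2 c) := by
  have hif : i * f * (i * f) = c • 1 := by
    rw [mul_assoc, ← mul_assoc f, hfi, neg_mul, mul_neg, mul_assoc, ← mul_assoc i, hE.sq, hf.sq,
      neg_one_mul, neg_neg]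
  have hiff : i * f * f = c • i := by rw [mul_assoc, hf.sq, mul_smul_comm, mul_one]
  refine clifford_iso hC ![f, i * f] ?_ ?_ ?_ fun S hS => ?_
  · rw [Fin.forall_fin_two]
    exact ⟨hf.mem, even_mul_odd_mem hE.mem hf.mem⟩
  · rw [Fin.forall_fin_two]
    exact ⟨hf.sq, hif⟩
  · intro k l hkl
    obtain ⟨rfl, rfl⟩ : k = 0 ∧ l = 1 := by omega
    change i * f * f = -(f * (i * f))
    rw [← mul_assoc f, hfi, neg_mul, neg_neg]
  · rw [Fin.forall_fin_two] at hS
    have hfS : f ∈ S := hS.1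
    have hifS : i * f ∈ S := hS.2
    have hiS : i ∈ S := by
      have h := S.smul_mem (S.mul_mem hifS hfS) c
      rwa [hiff, smul_smul, hc, one_smul] at h
    have h0 : ∀ x ∈ X.grade 0, x ∈ S := fun x hx => by
      obtain ⟨a, b, rfl⟩ := hE.span x hx
      exact S.add_mem (S.smul_mem S.one_mem a) (S.smul_mem hiS b)
    refine ⟨h0, fun x hx => ?_⟩
    obtain ⟨y, hy, rfl⟩ := hf.span x hx
    exact S.mul_mem hfS (h0 y hy)

/-- The products of the quaternion units with a central odd element of square `-c` satisfy the
Clifford relations with squares `c`. -/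
theorem clifford_three_iso {X : RealSuperalgebra.{u}} [Nontrivial X.carrier] {c : ℝ}
    (hc : c * c = 1) (hC : (clifford 3 c).IsDivision) {i j f : X.carrier}
    (hE : IsQuaternionSpan (X.grade 0) i j)
    (hf : IsOddGenerator (X.grade 0) (X.grade 1) f (-c))
    (hfi : f * i = i * f) (hfj : f * j = j * f) : X.Iso (clifford 3 c) := by
  have hk : i * j ∈ X.grade 0 := mul_mem_even hE.mem_i hE.mem_j
  have hi' (x) : i * (i * x) = -x := by rw [← mul_assoc, hE.sq_i, neg_one_mul]
  have hji' (x) : j * (i * x) = -(i * (j * x)) := by rw [← mul_assoc, hE.anti, neg_mul, mul_assoc]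
  have hprod : ∀ p q, p ∈ X.grade 0 → q ∈ X.grade 0 → p * f * (q * f) = (-c) • (p * q) := by
    intro p q hp hq
    rw [mul_assoc, ← mul_assoc f q, hE.commute hfi hfj hq, mul_assoc, hf.sq, mul_smul_comm,
      mul_smul_comm, mul_one]
  have hjk : j * (i * j) = i := by
    rw [← mul_assoc, hE.anti, neg_mul, mul_assoc, hE.sq_j, mul_neg, neg_neg, mul_one]
  have hkk : i * j * (i * j) = -1 := by rw [mul_assoc, hjk, hE.sq_i]
  have hki : i * j * i = j := by rw [mul_assoc, hE.anti, mul_neg, hi', neg_neg]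
  refine clifford_iso hC ![i * f, j * f, i * j * f] ?_ ?_ ?_ fun S hS => ?_
  · rw [Fin.forall_fin_succ, Fin.forall_fin_two]
    exact ⟨even_mul_odd_mem hE.mem_i hf.mem, even_mul_odd_mem hE.mem_j hf.mem,
      even_mul_odd_mem hk hf.mem⟩
  · rw [Fin.forall_fin_succ, Fin.forall_fin_two]
    refine ⟨(hprod _ _ hE.mem_i hE.mem_i).trans ?_, (hprod _ _ hE.mem_j hE.mem_j).trans ?_,
      (hprod _ _ hk hk).trans ?_⟩
    · rw [hE.sq_i, smul_neg, neg_smul, neg_neg]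
    · rw [hE.sq_j, smul_neg, neg_smul, neg_neg]
    · rw [hkk, smul_neg, neg_smul, neg_neg]
  · intro k l hkl
    have hlt : ∀ k l : Fin 3, k < l → (k = 0 ∧ l = 1) ∨ (k = 0 ∧ l = 2) ∨ (k = 1 ∧ l = 2) := by
      decide
    rcases hlt k l hkl with ⟨rfl, rfl⟩ | ⟨rfl, rfl⟩ | ⟨rfl, rfl⟩
    · change j * f * (i * f) = -(i * f * (j * f))
      rw [hprod _ _ hE.mem_j hE.mem_i, hprod _ _ hE.mem_i hE.mem_j, hE.anti, smul_neg]
    · change i * j * f * (i * f) = -(i * f * (i * j * f))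
      rw [hprod _ _ hk hE.mem_i, hprod _ _ hE.mem_i hk, hki, hi', smul_neg, neg_neg]
    · change i * j * f * (j * f) = -(j * f * (i * j * f))
      rw [hprod _ _ hk hE.mem_j, hprod _ _ hE.mem_j hk, hjk, mul_assoc, hE.sq_j, mul_neg, mul_one,
        smul_neg]
  · rw [Fin.forall_fin_succ, Fin.forall_fin_two] at hS
    have hifS : i * f ∈ S := hS.1
    have hjfS : j * f ∈ S := hS.2.1
    have hkfS : i * j * f ∈ S := hS.2.2
    have hfS : f ∈ S := by
      have h := S.smul_mem (S.mul_mem (S.mul_mem hifS hjfS) hkfS) c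
      rwa [hprod _ _ hE.mem_i hE.mem_j, smul_mul_assoc, ← mul_assoc, hkk, smul_smul, neg_one_mul,
        smul_neg, mul_neg, hc, neg_smul, neg_neg, one_smul] at h
    have hpS : ∀ p, p * f ∈ S → p ∈ S := fun p hp => by
      have h := S.smul_mem (S.mul_mem hp hfS) (-c)
      rwa [mul_assoc, hf.sq, mul_smul_comm, mul_one, smul_smul, neg_mul_neg, hc, one_smul] at h
    have h0 : ∀ x ∈ X.grade 0, x ∈ S := fun x hx => by
      obtain ⟨a, b, c, d, rfl⟩ := hE.span x hx
      exact S.add_mem (S.add_mem (S.add_mem (S.smul_mem S.one_mem a) (S.smul_mem (hpS i hifS) b))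
        (S.smul_mem (hpS j hjfS) c)) (S.smul_mem (hpS _ hkfS) d)
    refine ⟨h0, fun x hx => ?_⟩
    obtain ⟨y, hy, rfl⟩ := hf.span x hx
    exact S.mul_mem hfS (h0 y hy)

/-- A presentation determines the superalgebra up to isomorphism. -/
theorem iso_of_presents {X : RealSuperalgebra.{u}} [Nontrivial X.carrier] {t : DysonType}
    (h : Presents (X.grade 0) (X.grade 1) t) : X.Iso t.superalgebra := by
  have hD := isDivision_superalgebra t
  cases t with
  | RC =>
    refine purelyEven_iso hD h.2 (Algebra.ofId ℝ X.carrier) fun x hx => ?_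
    obtain ⟨a, rfl⟩ := h.1 x hx
    exact ⟨a, Algebra.algebraMap_eq_smul_one a⟩
  | CC₁ =>
    obtain ⟨i, hE, hO⟩ := h
    refine purelyEven_iso hD hO (complexHom hE.sq) fun x hx => ?_
    obtain ⟨a, b, rfl⟩ := hE.span x hx
    exact ⟨⟨a, b⟩, complexHom_apply hE.sq _⟩
  | HC =>
    obtain ⟨i, j, hE, hO⟩ := h
    refine purelyEven_iso hD hO (quaternionHom hE.sq_i hE.sq_j hE.anti) fun x hx => ?_
    obtain ⟨a, b, c, d, rfl⟩ := hE.span x hx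
    exact ⟨⟨a, b, c, d⟩, quaternionHom_apply hE.sq_i hE.sq_j hE.anti _⟩
  | RR | RH =>
    obtain ⟨hE, f, hf⟩ := h
    exact clifford_one_iso hD hE hf
  | CR | CH =>
    obtain ⟨i, hE, f, hf, hfi⟩ := h
    exact clifford_two_iso (by norm_num) hD hE hf hfi
  | CC₂ =>
    obtain ⟨i, hE, f, hf, hfi⟩ := h
    exact iso_complexClifford_one hE hf hfi
  | HR =>
    obtain ⟨i, j, hE, f, hf, hfi, hfj⟩ := h
    exact clifford_three_iso (by norm_num) hD hE hf hfi hfj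
  | HH =>
    obtain ⟨i, j, hE, f, hf, hfi, hfj⟩ := h
    refine clifford_three_iso (by norm_num) hD hE ?_ hfi hfj
    rwa [neg_neg]

theorem Iso.presents {X : RealSuperalgebra.{u}} {Y : RealSuperalgebra.{v}} (h : X.Iso Y)
    {t : DysonType} (hY : Presents (Y.grade 0) (Y.grade 1) t) :
    Presents (X.grade 0) (X.grade 1) t := by
  obtain ⟨e, he⟩ := h
  have hmap : ∀ i, (Y.grade i).map (e.symm : Y.carrier →ₐ[ℝ] X.carrier).toLinearMap =
      X.grade i := by
    intro i
    ext x
    constructor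
    · rintro ⟨y, hy, rfl⟩
      rw [he]
      exact (congrArg (· ∈ Y.grade i) (e.apply_symm_apply y)).mpr hy
    · intro hx
      exact ⟨e x, (he i x).mp hx, e.symm_apply_apply x⟩
  have := hY.map (e.symm : Y.carrier →ₐ[ℝ] X.carrier)
  rwa [hmap, hmap] at this

theorem IsDivision.existsUnique_iso {X : RealSuperalgebra.{u}} (hX : X.IsDivision) :
    ∃! t : DysonType, X.Iso t.superalgebra := by
  have := hX.nontrivial
  obtain ⟨t, ht⟩ := hX.exists_presents
  exact ⟨t, iso_of_presents ht, fun s hs => (hs.presents s.presents_superalgebra).eq ht⟩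

end RealSuperalgebra

/-! ### Double centralizers -/

section DoubleCentralizer

variable {V : Type v} [AddCommGroup V] [Module ℝ V]

/-- The double centralizer theorem for a semisimple action on a finite-dimensional space. -/
theorem Subalgebra.mem_of_isSemisimpleModule [FiniteDimensional ℝ V]
    (A : Subalgebra ℝ (Module.End ℝ V)) [IsSemisimpleModule A V] {f : Module.End ℝ V}
    (hf : ∀ g : Module.End ℝ V, (∀ a ∈ A, a * g = g * a) → f * g = g * f) : f ∈ A := by
  let f' : Module.End (Module.End A V) V :=
    { toFun := f
      map_add' := map_add f
      map_smul' := fun g v => by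
        have h := hf (g.restrictScalars ℝ) fun a ha => LinearMap.ext fun v =>
          (g.map_smul (⟨a, ha⟩ : A) v).symm
        exact congrArg (fun k : Module.End ℝ V => k v) h }
  obtain ⟨s, hs⟩ := Module.Finite.fg_top (R := ℝ) (M := V)
  obtain ⟨r, hr⟩ := jacobson_density (R := A) f' s
  have : f = r := LinearMap.ext_on hs fun m hm => hr m hm
  rw [this]
  exact r.2

/-- A unit normalizing a subalgebra permutes its submodules. -/
def Subalgebra.submoduleOrderIso (A : Subalgebra ℝ (Module.End ℝ V)) (u : (Module.End ℝ V)ˣ)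
    (hu : ∀ a ∈ A, (u : Module.End ℝ V) * a * (u⁻¹ : (Module.End ℝ V)ˣ) ∈ A)
    (hu' : ∀ a ∈ A, ((u⁻¹ : (Module.End ℝ V)ˣ) : Module.End ℝ V) * a * u ∈ A) :
    Submodule A V ≃o Submodule A V where
  toFun m :=
    { carrier := {x | ((u⁻¹ : (Module.End ℝ V)ˣ) : Module.End ℝ V) x ∈ m}
      add_mem' := fun hx hy => by
        simp only [Set.mem_ofPred_eq, map_add] at hx hy ⊢
        exact m.add_mem hx hy
      zero_mem' := by simp
      smul_mem' := fun a x hx => by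
        have h := m.smul_mem (⟨_, hu' a a.2⟩ : A) hx
        have h2 : (u : Module.End ℝ V) (((u⁻¹ : (Module.End ℝ V)ˣ) : Module.End ℝ V) x) = x := by
          rw [← Module.End.mul_apply, Units.mul_inv, Module.End.one_apply]
        change ((u⁻¹ : (Module.End ℝ V)ˣ) : Module.End ℝ V) ((a : Module.End ℝ V)
          ((u : Module.End ℝ V) (((u⁻¹ : (Module.End ℝ V)ˣ) : Module.End ℝ V) x))) ∈ m at h
        rwa [h2] at h }
  invFun m :=
    { carrier := {x | (u : Module.End ℝ V) x ∈ m}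
      add_mem' := fun hx hy => by
        simp only [Set.mem_ofPred_eq, map_add] at hx hy ⊢
        exact m.add_mem hx hy
      zero_mem' := by simp
      smul_mem' := fun a x hx => by
        have h := m.smul_mem (⟨_, hu a a.2⟩ : A) hx
        have h2 : ((u⁻¹ : (Module.End ℝ V)ˣ) : Module.End ℝ V) ((u : Module.End ℝ V) x) = x := by
          rw [← Module.End.mul_apply, Units.inv_mul, Module.End.one_apply]
        change (u : Module.End ℝ V) ((a : Module.End ℝ V)
          (((u⁻¹ : (Module.End ℝ V)ˣ) : Module.End ℝ V) ((u : Module.End ℝ V) x))) ∈ m at h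
        rwa [h2] at h }
  left_inv m := by
    ext x
    change ((u⁻¹ : (Module.End ℝ V)ˣ) : Module.End ℝ V) ((u : Module.End ℝ V) x) ∈ m ↔ x ∈ m
    rw [← Module.End.mul_apply, Units.inv_mul, Module.End.one_apply]
  right_inv m := by
    ext x
    change (u : Module.End ℝ V) (((u⁻¹ : (Module.End ℝ V)ˣ) : Module.End ℝ V) x) ∈ m ↔ x ∈ m
    rw [← Module.End.mul_apply, Units.mul_inv, Module.End.one_apply]
  map_rel_iff' {m m'} := by
    constructor
    · intro h x hx
      have h2 : ((u⁻¹ : (Module.End ℝ V)ˣ) : Module.End ℝ V) ((u : Module.End ℝ V) x) = x := by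
        rw [← Module.End.mul_apply, Units.inv_mul, Module.End.one_apply]
      have : (u : Module.End ℝ V) x ∈
          {x | ((u⁻¹ : (Module.End ℝ V)ˣ) : Module.End ℝ V) x ∈ m'} := h (by
        change ((u⁻¹ : (Module.End ℝ V)ˣ) : Module.End ℝ V) ((u : Module.End ℝ V) x) ∈ m
        rwa [h2])
      rwa [Set.mem_ofPred_eq, h2] at this
    · exact fun h x hx => h hx

/-- Clifford's theorem: if no proper nonzero subspace is stable under a subalgebra `A` and under the
units normalizing it, then `V` is semisimple over `A`, since these units permute the simple
submodules and so preserve their sum. -/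
theorem Subalgebra.isSemisimpleModule_of_normalizer [FiniteDimensional ℝ V] [Nontrivial V]
    (A : Subalgebra ℝ (Module.End ℝ V))
    (h : ∀ W : Submodule ℝ V, (∀ a ∈ A, ∀ x ∈ W, a x ∈ W) →
      (∀ u : (Module.End ℝ V)ˣ,
        (∀ a ∈ A, (u : Module.End ℝ V) * a * (u⁻¹ : (Module.End ℝ V)ˣ) ∈ A) →
        (∀ a ∈ A, ((u⁻¹ : (Module.End ℝ V)ˣ) : Module.End ℝ V) * a * u ∈ A) →
        ∀ x ∈ W, (u : Module.End ℝ V) x ∈ W) → W = ⊥ ∨ W = ⊤) :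
    IsSemisimpleModule A V := by
  have : IsArtinian A V := isArtinian_of_tower ℝ inferInstance
  refine IsSemisimpleModule.of_sSup_simples_eq_top ?_
  simp only [isSimpleModule_iff_isAtom]
  generalize hS : sSup {m : Submodule A V | IsAtom m} = S
  have hne : S ≠ ⊥ := by
    obtain ⟨m, hm⟩ := IsAtomic.exists_atom (Submodule A V)
    exact fun h0 => hm.1 (le_bot_iff.mp (h0 ▸ hS ▸ le_sSup hm))
  have hstable : ∀ u : (Module.End ℝ V)ˣ,
      (∀ a ∈ A, (u : Module.End ℝ V) * a * (u⁻¹ : (Module.End ℝ V)ˣ) ∈ A) →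
      (∀ a ∈ A, ((u⁻¹ : (Module.End ℝ V)ˣ) : Module.End ℝ V) * a * u ∈ A) →
      ∀ x ∈ S, (u : Module.End ℝ V) x ∈ S := by
    intro u hu hu' x hx
    let e := A.submoduleOrderIso u hu hu'
    have he : e S ≤ S := by
      rw [← hS, e.map_sSup]
      exact iSup₂_le fun m hm => le_sSup ((e.isAtom_iff m).mpr hm)
    refine he ?_
    change ((u⁻¹ : (Module.End ℝ V)ˣ) : Module.End ℝ V) ((u : Module.End ℝ V) x) ∈ S
    rwa [← Module.End.mul_apply, Units.inv_mul, Module.End.one_apply]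
  rcases h (S.restrictScalars ℝ) (fun a ha x hx => S.smul_mem (⟨a, ha⟩ : A) hx) hstable with
    h0 | h1
  · exact absurd ((Submodule.restrictScalars_eq_bot_iff ℝ A V).mp h0) hne
  · exact (Submodule.restrictScalars_eq_top_iff ℝ A V).mp h1

end DoubleCentralizer

/-! ### The endomorphism superalgebra of an irreducible `φ`-representation -/

namespace PhiRep

variable {G : Type u} [Group G] {φ : G →* ℤˣ} {V : Type v} [AddCommGroup V] [Module ℝ V]
  (R : PhiRep φ V)

theorem rho_mul_rho_inv (g : G) : R.ρ g * R.ρ g⁻¹ = 1 := by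
  rw [← map_mul, mul_inv_cancel, map_one]

theorem rho_inv_mul_rho (g : G) : R.ρ g⁻¹ * R.ρ g = 1 := by
  rw [← map_mul, inv_mul_cancel, map_one]

/-- A homogeneous endomorphism commutes with the complex structure and with the action of `G` up to
signs depending only on its degree. -/
theorem mem_gradedEnd_iff {i : ZMod 2} {f : Module.End ℝ V} : f ∈ R.gradedEnd i ↔
    f * R.I = (if i = 0 then (1 : ℝ) else -1) • (R.I * f) ∧
      ∀ g, f * R.ρ g = (if i = 0 then (1 : ℝ) else ((φ g : ℤ) : ℝ)) • (R.ρ g * f) := by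
  have key : ∀ i : ZMod 2, i = 0 ∨ i = 1 := by decide
  rcases key i with rfl | rfl
  · simp only [gradedEnd, if_true, one_smul]
    rfl
  · simp only [gradedEnd, if_neg (show (1 : ZMod 2) ≠ 0 by decide), neg_one_smul]
    rfl

theorem mem_gradedEnd_of_mul_eq_one {i : ZMod 2} {f f' : Module.End ℝ V} (hf : f ∈ R.gradedEnd i)
    (h : f * f' = 1) (h' : f' * f = 1) : f' ∈ R.gradedEnd i := by
  have key : ∀ (c : ℝ) (x : Module.End ℝ V), c * c = 1 → f * x = c • (x * f) →
      f' * x = c • (x * f') := by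
    intro c x hc hx
    have hx' : x * f = c • (f * x) := by rw [hx, smul_smul, hc, one_smul]
    calc f' * x = f' * (x * f) * f' := by rw [mul_assoc, mul_assoc, h, mul_one]
      _ = c • (x * f') := by
        rw [hx', mul_smul_comm, ← mul_assoc, h', one_mul, smul_mul_assoc]
  rw [mem_gradedEnd_iff] at hf ⊢
  refine ⟨key _ _ (by split_ifs <;> norm_num) hf.1, fun g => key _ _ ?_ (hf.2 g)⟩
  split_ifs
  · norm_num
  · exact sign_mul_self φ g

variable {R}

/-- **Schur's lemma**: nonzero homogeneous endomorphisms are bijective. -/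
theorem IsIrreducible.bijective [FiniteDimensional ℝ V] (hR : R.IsIrreducible) {i : ZMod 2}
    {f : Module.End ℝ V} (hf : f ∈ R.gradedEnd i) (hf0 : f ≠ 0) : Function.Bijective f := by
  rw [mem_gradedEnd_iff] at hf
  have hstable : ∀ (c : ℝ) (x : Module.End ℝ V), f * x = c • (x * f) →
      ∀ v ∈ LinearMap.ker f, x v ∈ LinearMap.ker f := by
    intro c x hx v hv
    have := congrArg (fun k : Module.End ℝ V => k v) hx
    simp only [Module.End.mul_apply, LinearMap.smul_apply, LinearMap.mem_ker.mp hv, map_zero,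
      smul_zero] at this
    exact this
  have hinj : Function.Injective f := by
    rw [← LinearMap.ker_eq_bot]
    rcases hR.2 (LinearMap.ker f) (hstable _ _ hf.1) (fun g => hstable _ _ (hf.2 g)) with h | h
    · exact h
    · exact absurd (LinearMap.ker_eq_top.mp h) hf0
  exact ⟨hinj, LinearMap.injective_iff_surjective.mp hinj⟩

theorem gradedEnd_le_endAlgebra (R : PhiRep φ V) (i : ZMod 2) :
    R.gradedEnd i ≤ Subalgebra.toSubmodule R.endAlgebra := by
  intro f hf
  have key : ∀ i : ZMod 2, i = 0 ∨ i = 1 := by decide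
  rcases key i with rfl | rfl
  · exact ⟨f, hf, 0, zero_mem _, add_zero f⟩
  · exact ⟨0, zero_mem _, f, hf, zero_add f⟩

theorem IsIrreducible.isDivision [FiniteDimensional ℝ V] (hR : R.IsIrreducible) :
    R.endSuperalgebra.IsDivision where
  finite := inferInstanceAs (Module.Finite ℝ (Subalgebra.toSubmodule R.endAlgebra))
  nontrivial := by
    have := hR.1
    exact inferInstanceAs (Nontrivial R.endAlgebra)
  isUnit i := by
    rintro ⟨f, hfm⟩ hf hf0
    have hf : f ∈ R.gradedEnd i := hf
    have hf0 : f ≠ 0 := fun h => hf0 (Subtype.ext h)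
    obtain ⟨u, rfl⟩ := (Module.End.isUnit_iff f).mpr (hR.bijective hf hf0)
    have hinv := R.mem_gradedEnd_of_mul_eq_one hf u.mul_inv u.inv_mul
    exact ⟨⟨⟨u, hfm⟩, ⟨_, R.gradedEnd_le_endAlgebra i hinv⟩, Subtype.ext u.mul_inv,
      Subtype.ext u.inv_mul⟩, rfl⟩

/-- A presentation of the endomorphism superalgebra, read inside the algebra of all operators. -/
theorem presents_evenEnd_oddEnd {t : DysonType}
    (h : Presents (R.endSuperalgebra.grade 0) (R.endSuperalgebra.grade 1) t) :
    Presents R.evenEnd R.oddEnd t := by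
  have hmap : ∀ i, (R.endSuperalgebra.grade i).map R.endAlgebra.val.toLinearMap =
      R.gradedEnd i := by
    intro i
    ext f
    constructor
    · rintro ⟨x, hx, rfl⟩
      exact hx
    · exact fun hf => ⟨⟨f, R.gradedEnd_le_endAlgebra i hf⟩, hf, rfl⟩
  have h1 := h.map R.endAlgebra.val
  rw [show Submodule.map _ _ = _ from hmap 0, show Submodule.map _ _ = _ from hmap 1] at h1
  exact h1

end PhiRep

/-! ### Dyson's algebras as centralizers -/

theorem conj_mem_adjoin {B : Type*} [Ring B] [Algebra ℝ B] {s : Set B} {u u' : B}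
    (h : u * u' = 1) (h' : u' * u = 1) (hs : ∀ x ∈ s, u * x * u' ∈ Algebra.adjoin ℝ s) :
    ∀ a ∈ Algebra.adjoin ℝ s, u * a * u' ∈ Algebra.adjoin ℝ s := by
  intro a ha
  induction ha using Algebra.adjoin_induction with
  | mem x hx => exact hs x hx
  | algebraMap r =>
    rw [← Algebra.commutes, mul_assoc, h, mul_one]
    exact Subalgebra.algebraMap_mem _ r
  | add x y hx hy ihx ihy =>
    rw [mul_add, add_mul]
    exact add_mem ihx ihy
  | mul x y hx hy ihx ihy =>
    have : u * (x * y) * u' = (u * x * u') * (u * y * u') := by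
      calc u * (x * y) * u' = u * x * 1 * y * u' := by simp only [mul_one, mul_assoc]
        _ = _ := by rw [← h']; simp only [mul_assoc]
    rw [this]
    exact mul_mem ihx ihy

namespace PhiRep

variable {G : Type u} [Group G] {φ : G →* ℤˣ} {V : Type v} [AddCommGroup V] [Module ℝ V]
  {R : PhiRep φ V}

theorem I_mul_neg_I (R : PhiRep φ V) : R.I * -R.I = 1 := by
  rw [mul_neg, R.I_mul_I, neg_neg]

theorem neg_I_mul_I (R : PhiRep φ V) : -R.I * R.I = 1 := by
  rw [neg_mul, R.I_mul_I, neg_neg]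

theorem rho_mul_I_of_eq_one (R : PhiRep φ V) {g : G} (hg : φ g = 1) :
    R.ρ g * R.I = R.I * R.ρ g := by
  simpa [hg] using R.map_mul_I g

/-- An algebra generated by elements permuted, up to the algebra itself, by conjugation with `I` and
with the `ρ g` is its own double centralizer. -/
theorem IsIrreducible.mem_adjoin [FiniteDimensional ℝ V] (hR : R.IsIrreducible)
    {s : Set (Module.End ℝ V)} (hI : ∀ x ∈ s, R.I * x * -R.I ∈ Algebra.adjoin ℝ s)
    (hρ : ∀ g, ∀ x ∈ s, R.ρ g * x * R.ρ g⁻¹ ∈ Algebra.adjoin ℝ s) {f : Module.End ℝ V}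
    (hf : ∀ g, (∀ x ∈ s, x * g = g * x) → f * g = g * f) : f ∈ Algebra.adjoin ℝ s := by
  have := hR.1
  have : IsSemisimpleModule (Algebra.adjoin ℝ s) V := by
    refine Subalgebra.isSemisimpleModule_of_normalizer _ fun W _ hW => hR.2 W ?_ fun g => ?_
    · have h := conj_mem_adjoin R.I_mul_neg_I R.neg_I_mul_I hI
      refine hW ⟨R.I, -R.I, R.I_mul_neg_I, R.neg_I_mul_I⟩ h fun a ha => ?_
      have h2 := h a ha
      rwa [mul_neg, ← neg_mul, ← neg_mul] at h2
    · refine hW ⟨R.ρ g, R.ρ g⁻¹, R.rho_mul_rho_inv g, R.rho_inv_mul_rho g⟩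
        (conj_mem_adjoin (R.rho_mul_rho_inv g) (R.rho_inv_mul_rho g) (hρ g)) fun a ha => ?_
      refine conj_mem_adjoin (R.rho_inv_mul_rho g) (R.rho_mul_rho_inv g) (fun x hx => ?_) a ha
      have h := hρ g⁻¹ x hx
      rwa [inv_inv] at h
  exact Subalgebra.mem_of_isSemisimpleModule _ fun g hg =>
    hf g fun x hx => hg x (Algebra.subset_adjoin hx)

theorem mem_evenEnd_iff {f : Module.End ℝ V} : f ∈ R.evenEnd ↔
    f * R.I = R.I * f ∧ ∀ g, f * R.ρ g = R.ρ g * f := Iff.rfl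

theorem mem_oddEnd_iff {f : Module.End ℝ V} : f ∈ R.oddEnd ↔
    f * R.I = -(R.I * f) ∧ ∀ g, f * R.ρ g = ((φ g : ℤ) : ℝ) • (R.ρ g * f) := Iff.rfl

theorem rho_conj (R : PhiRep φ V) (g h : G) : R.ρ h * R.ρ g * R.ρ h⁻¹ = R.ρ (h * g * h⁻¹) := by
  rw [map_mul, map_mul]

/-- `D` is the centralizer of `W⁰`. -/
theorem IsIrreducible.algD_eq [FiniteDimensional ℝ V] (hR : R.IsIrreducible) :
    R.algD = Subalgebra.centralizer ℝ (R.evenEnd : Set (Module.End ℝ V)) := by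
  apply le_antisymm
  · refine Algebra.adjoin_le ?_
    rintro _ (⟨g, rfl⟩ | rfl)
    · exact fun w hw => (mem_evenEnd_iff.mp hw).2 g
    · exact fun w hw => (mem_evenEnd_iff.mp hw).1
  · intro f hf
    rw [Subalgebra.mem_centralizer_iff] at hf
    have hImem : R.I ∈ Algebra.adjoin ℝ (Set.range R.ρ ∪ {R.I}) :=
      Algebra.subset_adjoin (Or.inr rfl)
    have hρmem : ∀ g, R.ρ g ∈ Algebra.adjoin ℝ (Set.range R.ρ ∪ {R.I}) := fun g =>
      Algebra.subset_adjoin (Or.inl ⟨g, rfl⟩)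
    refine hR.mem_adjoin
      (fun x hx => mul_mem (mul_mem hImem (Algebra.subset_adjoin hx)) (neg_mem hImem))
      (fun g x hx => mul_mem (mul_mem (hρmem g) (Algebra.subset_adjoin hx)) (hρmem _))
      fun g hg => (hf g ⟨(hg _ (Or.inr rfl)).symm, fun h => (hg _ (Or.inl ⟨h, rfl⟩)).symm⟩).symm

/-- If `f` commutes with the even subgroup and commutes up to the sign `ε` with one odd element,
it commutes up to that sign with all odd elements. -/
theorem mul_rho_of_odd {f : Module.End ℝ V} {g₀ : G} (hg₀ : φ g₀ = -1) {ε : ℝ}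
    (h1 : ∀ g, φ g = 1 → f * R.ρ g = R.ρ g * f) (h0 : f * R.ρ g₀ = ε • (R.ρ g₀ * f)) {g : G}
    (hg : φ g = -1) : f * R.ρ g = ε • (R.ρ g * f) := by
  have h2 : R.ρ g = R.ρ g₀ * R.ρ (g₀⁻¹ * g) := by rw [← map_mul, mul_inv_cancel_left]
  rw [h2, ← mul_assoc, h0, smul_mul_assoc, mul_assoc, h1 _ (by simp [hg, hg₀]), mul_assoc]

/-- An operator commuting with the even subgroup is the sum of one commuting with a given odd
element and one anticommuting with it. -/
theorem exists_add_of_odd {f : Module.End ℝ V} (g₀ : G) (hg₀ : φ g₀ = -1)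
    (h1 : ∀ g, φ g = 1 → f * R.ρ g = R.ρ g * f) {ε : ℝ} (hI : f * R.I = ε • (R.I * f)) :
    ∃ p q : Module.End ℝ V, f = p + q ∧
      (p * R.I = ε • (R.I * p) ∧ ∀ g, p * R.ρ g = R.ρ g * p) ∧
      (q * R.I = ε • (R.I * q) ∧ ∀ g, q * R.ρ g = ((φ g : ℤ) : ℝ) • (R.ρ g * q)) := by
  -- Conjugation by an odd element is an involution on the operators commuting with the even
  -- subgroup; `p` and `q` are its symmetric and antisymmetric parts.
  let c := R.ρ g₀ * f * R.ρ g₀⁻¹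
  have hinvI : R.ρ g₀⁻¹ * R.I = -(R.I * R.ρ g₀⁻¹) := by
    have := R.map_mul_I g₀⁻¹
    simpa [hg₀] using this
  have hρI : R.ρ g₀ * R.I = -(R.I * R.ρ g₀) := by
    have := R.map_mul_I g₀
    simpa [hg₀] using this
  have hcI : c * R.I = ε • (R.I * c) := by
    calc c * R.I = R.ρ g₀ * f * (R.ρ g₀⁻¹ * R.I) := by rw [mul_assoc]
      _ = -(R.ρ g₀ * (f * R.I) * R.ρ g₀⁻¹) := by rw [hinvI, mul_neg]; simp only [mul_assoc]
      _ = ε • -(R.ρ g₀ * R.I * f * R.ρ g₀⁻¹) := by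
        rw [hI, mul_smul_comm, smul_mul_assoc, smul_neg]; simp only [mul_assoc]
      _ = ε • (R.I * c) := by
        rw [hρI, neg_mul, neg_mul, neg_neg]; simp only [c, mul_assoc]
  have hc1 : ∀ g, φ g = 1 → c * R.ρ g = R.ρ g * c := by
    intro g hg
    have h := h1 (g₀⁻¹ * g * g₀) (by simp [hg])
    calc c * R.ρ g = R.ρ g₀ * (f * R.ρ (g₀⁻¹ * g * g₀)) * R.ρ g₀⁻¹ := by
          simp only [c, mul_assoc, ← map_mul, mul_inv_cancel, mul_one]
      _ = R.ρ g * c := by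
        rw [h]
        simp only [c, ← mul_assoc, ← map_mul, mul_inv_cancel, one_mul]
  have hcρ : c * R.ρ g₀ = R.ρ g₀ * f := by
    simp only [c, mul_assoc, rho_inv_mul_rho, mul_one]
  have hρc : R.ρ g₀ * c = f * R.ρ g₀ := by
    have h := h1 (g₀ * g₀) (by simp [hg₀])
    rw [map_mul] at h
    calc R.ρ g₀ * c = R.ρ g₀ * R.ρ g₀ * f * R.ρ g₀⁻¹ := by simp only [c, mul_assoc]
      _ = f * R.ρ g₀ := by rw [← h]; simp only [mul_assoc, rho_mul_rho_inv, mul_one]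
  refine ⟨(1 / 2 : ℝ) • (f + c), (1 / 2 : ℝ) • (f - c), by module, ⟨?_, fun g => ?_⟩, ?_,
    fun g => ?_⟩
  · rw [smul_mul_assoc, add_mul, hI, hcI, mul_smul_comm, mul_add]
    module
  · rcases Int.units_eq_one_or (φ g) with hg | hg
    · rw [smul_mul_assoc, add_mul, h1 g hg, hc1 g hg, mul_smul_comm, mul_add]
    · have := mul_rho_of_odd (f := f + c) (ε := 1) hg₀
        (fun g hg => by rw [add_mul, h1 g hg, hc1 g hg, mul_add])
        (by rw [add_mul, hcρ, mul_add, hρc, one_smul, add_comm]) hg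
      rw [smul_mul_assoc, this, one_smul, mul_smul_comm]
  · rw [smul_mul_assoc, sub_mul, hI, hcI, mul_smul_comm, mul_sub]
    module
  · rcases Int.units_eq_one_or (φ g) with hg | hg
    · rw [smul_mul_assoc, sub_mul, h1 g hg, hc1 g hg, mul_smul_comm, mul_sub, hg]
      simp
    · have := mul_rho_of_odd (f := f - c) (ε := -1) hg₀
        (fun g hg => by rw [sub_mul, h1 g hg, hc1 g hg, mul_sub])
        (by rw [sub_mul, hcρ, mul_sub, hρc, neg_one_smul, neg_sub]) hg
      rw [smul_mul_assoc, this, mul_smul_comm, hg]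
      simp

theorem I_mul_rho (R : PhiRep φ V) (g : G) :
    R.I * R.ρ g = ((φ g : ℤ) : ℝ) • (R.ρ g * R.I) := by
  rw [R.map_mul_I, smul_smul, sign_mul_self, one_smul]

theorem I_mul_I_mul (R : PhiRep φ V) (f : Module.End ℝ V) : R.I * (R.I * f) = -f := by
  rw [← mul_assoc, R.I_mul_I, neg_one_mul]

/-- An operator commuting with `I` and `I q` commutes with `q = -I (I q)`. -/
theorem commute_of_commute_I_mul {f q : Module.End ℝ V} (hI : f * R.I = R.I * f)
    (hq : f * (R.I * q) = R.I * q * f) : f * q = q * f := by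
  rw [← neg_inj, ← mul_neg, ← neg_mul, ← R.I_mul_I_mul q, ← mul_assoc, hI, mul_assoc, hq,
    ← mul_assoc, ← mul_assoc]

/-- The centralizer of `I` and the even subgroup is spanned by `W⁰` and `I W⁰`. -/
theorem commute_of_commute_evenEnd {g₀ : G} (hg₀ : φ g₀ = -1) {f g : Module.End ℝ V}
    (hf : ∀ w ∈ R.evenEnd, f * w = w * f) (hfI : f * R.I = R.I * f)
    (hg : ∀ h, φ h = 1 → g * R.ρ h = R.ρ h * g) (hgI : g * R.I = R.I * g) : f * g = g * f := by
  obtain ⟨p, q, rfl, ⟨hpI, hp⟩, hqI, hq⟩ := exists_add_of_odd (R := R) (ε := 1) g₀ hg₀ hg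
    (by rw [hgI, one_smul])
  rw [one_smul] at hpI hqI
  have hIq : R.I * q ∈ R.evenEnd := by
    refine ⟨by rw [mul_assoc, hqI], fun h => ?_⟩
    rw [mul_assoc, hq, mul_smul_comm, ← mul_assoc, I_mul_rho, smul_mul_assoc, smul_smul,
      sign_mul_self, one_smul, mul_assoc]
  rw [mul_add, add_mul, hf p ⟨hpI, hp⟩, commute_of_commute_I_mul hfI (hf _ hIq)]

/-- The centralizer of the even subgroup is spanned by `W` and `I W`. -/
theorem commute_of_commute_evenEnd_oddEnd {g₀ : G} (hg₀ : φ g₀ = -1) {f g : Module.End ℝ V}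
    (hf : ∀ w ∈ R.evenEnd, f * w = w * f) (hf' : ∀ w ∈ R.oddEnd, f * w = w * f)
    (hfI : f * R.I = R.I * f) (hg : ∀ h, φ h = 1 → g * R.ρ h = R.ρ h * g) : f * g = g * f := by
  have hIgI : ∀ h, φ h = 1 → R.I * g * R.I * R.ρ h = R.ρ h * (R.I * g * R.I) := by
    intro h hh
    have hIρ := R.rho_mul_I_of_eq_one hh
    calc R.I * g * R.I * R.ρ h = R.I * (g * R.ρ h) * R.I := by
          rw [mul_assoc, ← hIρ]; simp only [mul_assoc]
      _ = R.ρ h * (R.I * g * R.I) := by rw [hg h hh, ← mul_assoc, ← hIρ]; simp only [mul_assoc]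
  -- The part of `g` commuting with `I`, and the part anticommuting with it.
  have hsplit : g = (1 / 2 : ℝ) • (g - R.I * g * R.I) + (1 / 2 : ℝ) • (g + R.I * g * R.I) := by
    module
  have hI1 : R.I * g * R.I * R.I = -(R.I * g) := by rw [mul_assoc, R.I_mul_I, mul_neg, mul_one]
  have hI2 : R.I * (R.I * g * R.I) = -(g * R.I) := by rw [mul_assoc R.I g, I_mul_I_mul]
  have h1 : f * (g - R.I * g * R.I) = (g - R.I * g * R.I) * f := by
    refine commute_of_commute_evenEnd hg₀ hf hfI (fun h hh => ?_) ?_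
    · rw [sub_mul, mul_sub, hg h hh, hIgI h hh]
    · rw [sub_mul, mul_sub, hI1, hI2]
      abel
  have h2 : f * (g + R.I * g * R.I) = (g + R.I * g * R.I) * f := by
    obtain ⟨p, q, hpq, ⟨hpI, hp⟩, hqI, hq⟩ := exists_add_of_odd (R := R)
      (f := g + R.I * g * R.I) (ε := -1) g₀ hg₀
      (fun h hh => by rw [add_mul, mul_add, hg h hh, hIgI h hh]) (by
        rw [add_mul, mul_add, hI1, hI2, neg_one_smul]
        abel)
    rw [neg_one_smul] at hpI hqI
    have hIp : R.I * p ∈ R.oddEnd := by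
      refine ⟨by rw [mul_assoc, hpI, mul_neg], fun h => ?_⟩
      rw [mul_assoc, hp, ← mul_assoc, I_mul_rho, smul_mul_assoc, mul_assoc]
    rw [hpq, mul_add, add_mul, hf' q ⟨hqI, hq⟩, commute_of_commute_I_mul hfI (hf' _ hIp)]
  rw [hsplit, mul_add, add_mul, mul_smul_comm, mul_smul_comm, smul_mul_assoc, smul_mul_assoc, h1,
    h2]

theorem I_conj_rho {g : G} (hg : φ g = 1) : R.I * R.ρ g * -R.I = R.ρ g := by
  rw [← R.rho_mul_I_of_eq_one hg, mul_assoc, I_mul_neg_I, mul_one]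

/-- `B` is the centralizer of `W⁰` and `I`. -/
theorem IsIrreducible.algB_eq [FiniteDimensional ℝ V] (hR : R.IsIrreducible) {g₀ : G}
    (hg₀ : φ g₀ = -1) : R.algB =
      Subalgebra.centralizer ℝ ((R.evenEnd : Set (Module.End ℝ V)) ∪ {R.I}) := by
  apply le_antisymm
  · refine Algebra.adjoin_le ?_
    rintro _ (⟨g, hg, rfl⟩ | rfl) w (hw | rfl)
    · exact (mem_evenEnd_iff.mp hw).2 g
    · exact (R.rho_mul_I_of_eq_one hg).symm
    · exact (mem_evenEnd_iff.mp hw).1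
    · rfl
  · intro f hf
    rw [Subalgebra.mem_centralizer_iff] at hf
    refine hR.mem_adjoin ?_ ?_ fun g hg => ?_
    · rintro _ (⟨g, hg, rfl⟩ | rfl)
      · rw [I_conj_rho hg]
        exact Algebra.subset_adjoin (Or.inl ⟨g, hg, rfl⟩)
      · rw [mul_assoc, I_mul_neg_I, mul_one]
        exact Algebra.subset_adjoin (Or.inr rfl)
    · rintro h _ (⟨g, hg, rfl⟩ | rfl)
      · rw [rho_conj]
        have hg : φ g = 1 := hg
        exact Algebra.subset_adjoin (Or.inl ⟨_, by simp [hg], rfl⟩)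
      · rw [R.map_mul_I, smul_mul_assoc, mul_assoc, rho_mul_rho_inv, mul_one]
        refine Subalgebra.smul_mem _ ?_ _
        exact Algebra.subset_adjoin (Or.inr rfl)
    · exact commute_of_commute_evenEnd (R := R) hg₀ (fun w hw => (hf w (Or.inl hw)).symm)
        (hf _ (Or.inr rfl)).symm (fun h hh => (hg _ (Or.inl ⟨h, hh, rfl⟩)).symm)
        (hg _ (Or.inr rfl)).symm

/-- `A` is the centralizer of `W` and `I`. -/
theorem IsIrreducible.algA_eq [FiniteDimensional ℝ V] (hR : R.IsIrreducible) {g₀ : G}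
    (hg₀ : φ g₀ = -1) : R.algA =
      Subalgebra.centralizer ℝ ((R.evenEnd : Set (Module.End ℝ V)) ∪
        (R.oddEnd : Set (Module.End ℝ V)) ∪ {R.I}) := by
  apply le_antisymm
  · refine Algebra.adjoin_le ?_
    rintro _ ⟨g, hg, rfl⟩ w ((hw | hw) | rfl)
    · exact (mem_evenEnd_iff.mp hw).2 g
    · have hg : φ g = 1 := hg
      simpa [hg] using (mem_oddEnd_iff.mp hw).2 g
    · exact (R.rho_mul_I_of_eq_one hg).symm
  · intro f hf
    rw [Subalgebra.mem_centralizer_iff] at hf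
    refine hR.mem_adjoin ?_ ?_ fun g hg => ?_
    · rintro _ ⟨g, hg, rfl⟩
      rw [I_conj_rho hg]
      exact Algebra.subset_adjoin ⟨g, hg, rfl⟩
    · rintro h _ ⟨g, hg, rfl⟩
      rw [rho_conj]
      have hg : φ g = 1 := hg
      exact Algebra.subset_adjoin ⟨_, by simp [hg], rfl⟩
    · exact commute_of_commute_evenEnd_oddEnd (R := R) hg₀
        (fun w hw => (hf w (Or.inl (Or.inl hw))).symm)
        (fun w hw => (hf w (Or.inl (Or.inr hw))).symm) (hf _ (Or.inr rfl)).symm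
        (fun h hh => (hg _ ⟨h, hh, rfl⟩).symm)

end PhiRep

/-! ### Centralizers of division algebras -/

section CentralizerDivision

open Module

variable {V : Type v} [AddCommGroup V] [Module ℝ V]

/-- The centralizer of the action of a division algebra `K ≅ Kᵐᵒᵖ` is a matrix algebra over `K`,
as the space is a free `K`-module. -/
theorem exists_centralizer_range_algEquiv [FiniteDimensional ℝ V] {K : Type*} [DivisionRing K]
    [Algebra ℝ K] [FiniteDimensional ℝ K] (κ : K ≃ₐ[ℝ] Kᵐᵒᵖ) (θ : K →ₐ[ℝ] Module.End ℝ V) :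
    ∃ n, finrank ℝ V = n * finrank ℝ K ∧
      Nonempty (Subalgebra.centralizer ℝ (Set.range θ) ≃ₐ[ℝ] Matrix (Fin n) (Fin n) K) := by
  let _ : Module K V := Module.compHom V θ.toRingHom
  have hsmul : ∀ (k : K) (v : V), k • v = θ k v := fun _ _ => rfl
  have : IsScalarTower ℝ K V := ⟨fun r k v => by
    rw [hsmul, hsmul, map_smul, LinearMap.smul_apply]⟩
  have : Module.Finite K V := Module.Finite.of_restrictScalars_finite ℝ K V
  have : SMulCommClass K ℝ V := ⟨fun k r v => by rw [hsmul, hsmul, map_smul]⟩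
  have : SMulCommClass ℝ K V := SMulCommClass.symm _ _ _
  let e : V ≃ₗ[K] (Fin (finrank K V) → K) := (finBasis K V).equivFun
  let c : Subalgebra.centralizer ℝ (Set.range θ) ≃ₐ[ℝ] Module.End K V :=
    { toFun := fun f =>
        { toFun := f.1
          map_add' := map_add f.1
          map_smul' := fun k v =>
            (congrArg (fun x : Module.End ℝ V => x v) (f.2 (θ k) ⟨k, rfl⟩)).symm }
      invFun := fun f => ⟨f.restrictScalars ℝ, by
        rintro _ ⟨k, rfl⟩
        exact LinearMap.ext fun v => (f.map_smul k v).symm⟩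
      left_inv := fun _ => rfl
      right_inv := fun _ => rfl
      map_mul' := fun _ _ => rfl
      map_add' := fun _ _ => rfl
      commutes' := fun _ => rfl }
  refine ⟨finrank K V, by rw [mul_comm, finrank_mul_finrank], ⟨c.trans <|
    (e.conjAlgEquiv ℝ).trans <| (endVecAlgEquivMatrixEnd (Fin (finrank K V)) ℝ K K).trans <|
    ((AlgEquiv.moduleEndSelf ℝ (A := K)).symm.trans κ.symm).mapMatrix⟩⟩

theorem centralizer_range_complexHom {i : Module.End ℝ V} (hi : i * i = -1) :
    Subalgebra.centralizer ℝ (Set.range (complexHom hi)) = Subalgebra.centralizer ℝ {i} := by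
  apply le_antisymm
  · refine Subalgebra.centralizer_le ℝ _ _ ?_
    rintro _ rfl
    exact ⟨Complex.I, by simp [complexHom_apply]⟩
  · rintro x hx _ ⟨z, rfl⟩
    have h : i * x = x * i := hx i rfl
    simp only [complexHom_apply, add_mul, mul_add, smul_mul_assoc, mul_smul_comm, one_mul, mul_one,
      h]

theorem centralizer_range_quaternionHom {i j : Module.End ℝ V} (hi : i * i = -1)
    (hj : j * j = -1) (hji : j * i = -(i * j)) :
    Subalgebra.centralizer ℝ (Set.range (quaternionHom hi hj hji)) =
      Subalgebra.centralizer ℝ {i, j} := by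
  apply le_antisymm
  · refine Subalgebra.centralizer_le ℝ _ _ ?_
    rintro _ (rfl | rfl)
    · exact ⟨(⟨0, 1, 0, 0⟩ : ℍ[ℝ]), (quaternionHom_apply hi hj hji _).trans (by simp)⟩
    · exact ⟨(⟨0, 0, 1, 0⟩ : ℍ[ℝ]), (quaternionHom_apply hi hj hji _).trans (by simp)⟩
  · rintro x hx _ ⟨q, rfl⟩
    have h : i * x = x * i := hx i (Or.inl rfl)
    have h' : j * x = x * j := hx j (Or.inr rfl)
    have h'' : i * j * x = x * (i * j) := by rw [mul_assoc, h', ← mul_assoc, h, mul_assoc]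
    simp only [quaternionHom_apply, add_mul, mul_add, smul_mul_assoc, mul_smul_comm, one_mul,
      mul_one, h, h', h'']

theorem centralizer_empty_algEquiv [FiniteDimensional ℝ V] {n : ℕ} (hn : finrank ℝ V = n) :
    Nonempty (Subalgebra.centralizer ℝ (∅ : Set (Module.End ℝ V)) ≃ₐ[ℝ]
      Matrix (Fin n) (Fin n) ℝ) := by
  have : Subalgebra.centralizer ℝ (∅ : Set (Module.End ℝ V)) = ⊤ := by
    rw [eq_top_iff]
    exact fun x _ => fun _ h => h.elim
  exact ⟨(Subalgebra.equivOfEq _ _ this).trans <| Subalgebra.topEquiv.trans <|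
    algEquivMatrix (finBasisOfFinrankEq ℝ V hn)⟩

theorem exists_centralizer_complex [FiniteDimensional ℝ V] {i : Module.End ℝ V} (hi : i * i = -1) :
    ∃ n, finrank ℝ V = n * 2 ∧
      Nonempty (Subalgebra.centralizer ℝ {i} ≃ₐ[ℝ] Matrix (Fin n) (Fin n) ℂ) := by
  obtain ⟨n, hn, ⟨e⟩⟩ :=
    exists_centralizer_range_algEquiv (AlgEquiv.toOpposite ℝ ℂ) (complexHom hi)
  rw [Complex.finrank_real_complex] at hn
  exact ⟨n, hn, ⟨(Subalgebra.equivOfEq _ _ (centralizer_range_complexHom hi)).symm.trans e⟩⟩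

theorem exists_centralizer_quaternion [FiniteDimensional ℝ V] {i j : Module.End ℝ V}
    (hi : i * i = -1) (hj : j * j = -1) (hji : j * i = -(i * j)) :
    ∃ n, finrank ℝ V = n * 4 ∧
      Nonempty (Subalgebra.centralizer ℝ {i, j} ≃ₐ[ℝ] Matrix (Fin n) (Fin n) ℍ[ℝ]) := by
  obtain ⟨n, hn, ⟨e⟩⟩ :=
    exists_centralizer_range_algEquiv Quaternion.starAe (quaternionHom hi hj hji)
  rw [Quaternion.finrank_eq_four] at hn
  exact ⟨n, hn, ⟨(Subalgebra.equivOfEq _ _ (centralizer_range_quaternionHom hi hj hji)).symm.trans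
    e⟩⟩

theorem centralizer_complex_algEquiv [FiniteDimensional ℝ V] {i : Module.End ℝ V}
    (hi : i * i = -1) {n : ℕ} (hn : finrank ℝ V = n * 2) :
    Nonempty (Subalgebra.centralizer ℝ {i} ≃ₐ[ℝ] Matrix (Fin n) (Fin n) ℂ) := by
  obtain ⟨m, hm, e⟩ := exists_centralizer_complex hi
  obtain rfl : m = n := by omega
  exact e

theorem centralizer_quaternion_algEquiv [FiniteDimensional ℝ V] {i j : Module.End ℝ V}
    (hi : i * i = -1) (hj : j * j = -1) (hji : j * i = -(i * j)) {n : ℕ}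
    (hn : finrank ℝ V = n * 4) :
    Nonempty (Subalgebra.centralizer ℝ {i, j} ≃ₐ[ℝ] Matrix (Fin n) (Fin n) ℍ[ℝ]) := by
  obtain ⟨m, hm, e⟩ := exists_centralizer_quaternion hi hj hji
  obtain rfl : m = n := by omega
  exact e

end CentralizerDivision

/-! ### Splitting off an involution -/

section Involution

variable {V : Type v} [AddCommGroup V] [Module ℝ V]

/-- The space of vectors fixed by an operator. -/
def fixedSpace (e : Module.End ℝ V) : Submodule ℝ V := LinearMap.eqLocus e LinearMap.id

theorem mem_fixedSpace {e : Module.End ℝ V} {v : V} : v ∈ fixedSpace e ↔ e v = v := Iff.rfl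

variable {e : Module.End ℝ V} (he : e * e = 1)

theorem apply_apply_of_mul_eq {x y z w : Module.End ℝ V} (h : x * y = z * w) (v : V) :
    x (y v) = z (w v) := congrArg (fun k : Module.End ℝ V => k v) h

/-- The projection onto the fixed space of an involution along its `-1` eigenspace. -/
noncomputable def fixedProj (he : e * e = 1) : V →ₗ[ℝ] fixedSpace e :=
  LinearMap.codRestrict (fixedSpace e) ((1 / 2 : ℝ) • (1 + e)) fun v => by
    have h : e (e v) = v := congrArg (fun k : Module.End ℝ V => k v) he
    rw [mem_fixedSpace, LinearMap.smul_apply, map_smul, LinearMap.add_apply, map_add, h,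
      Module.End.one_apply, add_comm]

theorem coe_fixedProj (v : V) : (fixedProj he v : V) = (1 / 2 : ℝ) • (v + e v) := rfl

theorem fixedProj_coe (u : fixedSpace e) : fixedProj he u = u := by
  apply Subtype.ext
  rw [coe_fixedProj, mem_fixedSpace.mp u.2]
  module

theorem fixedProj_of_neg {v : V} (hv : e v = -v) : fixedProj he v = 0 := by
  apply Subtype.ext
  rw [coe_fixedProj, hv]
  simp

theorem sub_fixedProj (v : V) : e (v - fixedProj he v) = -(v - fixedProj he v) := by
  have h : e (e v) = v := congrArg (fun k : Module.End ℝ V => k v) he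
  rw [coe_fixedProj, map_sub, map_smul, map_add, h]
  module

/-- The corner of an operator on the fixed space of an involution. For operators commuting with
the involution, this is the restriction. -/
noncomputable def corner (he : e * e = 1) (x : Module.End ℝ V) : Module.End ℝ (fixedSpace e) :=
  fixedProj he ∘ₗ x ∘ₗ (fixedSpace e).subtype

theorem coe_corner {x : Module.End ℝ V} (hx : e * x = x * e) (u : fixedSpace e) :
    (corner he x u : V) = x u := by
  have h : x u ∈ fixedSpace e := by
    rw [mem_fixedSpace, apply_apply_of_mul_eq hx, mem_fixedSpace.mp u.2]
  exact congrArg Subtype.val (fixedProj_coe he ⟨x u, h⟩)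

theorem corner_fixedProj {x : Module.End ℝ V} (hx : e * x = x * e) (v : V) :
    corner he x (fixedProj he v) = fixedProj he (x v) := by
  apply Subtype.ext
  rw [coe_corner he hx, coe_fixedProj, coe_fixedProj, map_smul, map_add, apply_apply_of_mul_eq hx]

theorem corner_mul {x : Module.End ℝ V} (hx : e * x = x * e) (y : Module.End ℝ V)
    (hy : e * y = y * e) : corner he (x * y) = corner he x * corner he y := by
  refine LinearMap.ext fun u => Subtype.ext ?_
  rw [Module.End.mul_apply, coe_corner he hx, coe_corner he hy, coe_corner he,
    Module.End.mul_apply]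
  rw [← mul_assoc, hx, mul_assoc, hy, mul_assoc]

theorem corner_one : corner he 1 = 1 :=
  LinearMap.ext fun u => fixedProj_coe he u

theorem corner_neg (x : Module.End ℝ V) : corner he (-x) = -corner he x := by
  refine LinearMap.ext fun u => ?_
  simp [corner]

/-- Restriction to the fixed space, as a homomorphism between centralizers. -/
noncomputable def cornerHom (he : e * e = 1) {S T : Set (Module.End ℝ V)} (heT : e ∈ T)
    (hST : S ⊆ T) (hS : ∀ s ∈ S, e * s = s * e) :
    Subalgebra.centralizer ℝ T →ₐ[ℝ] Subalgebra.centralizer ℝ (corner he '' S) where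
  toFun x := ⟨corner he x.1, by
    rintro _ ⟨s, hs, rfl⟩
    rw [← corner_mul he (hS s hs) _ (x.2 e heT), ← corner_mul he (x.2 e heT) _ (hS s hs),
      x.2 s (hST hs)]⟩
  map_one' := Subtype.ext (corner_one he)
  map_mul' x y := Subtype.ext (corner_mul he (x.2 e heT) _ (y.2 e heT))
  map_zero' := Subtype.ext (LinearMap.ext fun u => map_zero (fixedProj he))
  map_add' x y := Subtype.ext (LinearMap.ext fun u => map_add (fixedProj he) _ _)
  commutes' r := Subtype.ext (LinearMap.ext fun u => by
    change fixedProj he (r • (u : V)) = r • u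
    rw [map_smul, fixedProj_coe])

/-- The extension by zero of an operator on the fixed space of an involution. -/
noncomputable def cornerExtend (he : e * e = 1) (y : Module.End ℝ (fixedSpace e)) :
    Module.End ℝ V :=
  (fixedSpace e).subtype ∘ₗ y ∘ₗ fixedProj he

theorem cornerExtend_apply (y : Module.End ℝ (fixedSpace e)) (v : V) :
    cornerExtend he y v = y (fixedProj he v) := rfl

theorem mul_cornerExtend (y : Module.End ℝ (fixedSpace e)) :
    e * cornerExtend he y = cornerExtend he y :=
  LinearMap.ext fun v => mem_fixedSpace.mp (y (fixedProj he v)).2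

theorem cornerExtend_mul (y : Module.End ℝ (fixedSpace e)) :
    cornerExtend he y * e = cornerExtend he y := by
  have h : ∀ v, e (e v) = v := fun v => congrArg (fun k : Module.End ℝ V => k v) he
  refine LinearMap.ext fun v => ?_
  have : fixedProj he (e v) = fixedProj he v := by
    apply Subtype.ext
    rw [coe_fixedProj, coe_fixedProj, h, add_comm]
  rw [Module.End.mul_apply, cornerExtend_apply, cornerExtend_apply, this]

theorem commute_cornerExtend {s : Module.End ℝ V} (hs : e * s = s * e)
    {y : Module.End ℝ (fixedSpace e)} (hy : corner he s * y = y * corner he s) :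
    s * cornerExtend he y = cornerExtend he y * s := by
  refine LinearMap.ext fun v => ?_
  rw [Module.End.mul_apply, Module.End.mul_apply, cornerExtend_apply, cornerExtend_apply,
    ← corner_fixedProj he hs, ← coe_corner he hs, apply_apply_of_mul_eq hy]

section Exchange

variable {f : Module.End ℝ V} {c : ℝ} (hc : c ≠ 0) (hf : f * f = c • (1 : Module.End ℝ V))
  (hfe : f * e = -(e * f))
include hc hf hfe

/-- If `f` anticommutes with the involution `e`, the centralizer of `e`, `f` and `S` is that of `S`
on the fixed space of `e`. -/
theorem centralizer_corner_algEquiv {S : Set (Module.End ℝ V)} (hS : ∀ s ∈ S, e * s = s * e)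
    (hS' : ∀ s ∈ S, f * s = s * f) :
    Nonempty (Subalgebra.centralizer ℝ (insert e (insert f S)) ≃ₐ[ℝ]
      Subalgebra.centralizer ℝ (corner he '' S)) := by
  have hff : ∀ v, f (f v) = c • v := fun v => congrArg (fun k : Module.End ℝ V => k v) hf
  have hef : ∀ v, e (f v) = -f (e v) := fun v => by
    have h : -(e (f v)) = f (e v) :=
      (congrArg (fun k : Module.End ℝ V => k v) hfe).symm
    rw [← h, neg_neg]
  let F := cornerHom he (T := insert e (insert f S)) (Set.mem_insert _ _)
    ((Set.subset_insert _ _).trans (Set.subset_insert _ _)) hS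
  refine ⟨AlgEquiv.ofBijective F ⟨?_, ?_⟩⟩
  · rw [injective_iff_map_eq_zero]
    rintro ⟨x, hx⟩ h0
    have hxe : e * x = x * e := hx e (Set.mem_insert _ _)
    have hxf : f * x = x * f := hx f (Set.mem_insert_of_mem _ (Set.mem_insert _ _))
    have hU : ∀ u : fixedSpace e, x u = 0 := fun u => by
      have h1 : corner he x = 0 := congrArg Subtype.val h0
      rw [← coe_corner he hxe, h1, LinearMap.zero_apply, Submodule.coe_zero]
    refine Subtype.ext (LinearMap.ext fun v => ?_)
    change x v = 0
    have h2 : e (f (v - fixedProj he v)) = f (v - fixedProj he v) := by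
      rw [hef, sub_fixedProj, map_neg, neg_neg]
    have h3 : c • x (v - fixedProj he v) = 0 := by
      rw [← hff, apply_apply_of_mul_eq hxf, hU ⟨_, h2⟩, map_zero]
    have h4 := (smul_eq_zero.mp h3).resolve_left hc
    rwa [map_sub, hU, sub_zero] at h4
  · rintro ⟨y, hy⟩
    let E := cornerExtend he y
    have hE1 : e * E = E := mul_cornerExtend he y
    have hE2 : E * e = E := cornerExtend_mul he y
    have h1 : e * (f * E * f) = -(f * E * f) := by
      rw [← mul_assoc, ← mul_assoc, ← neg_eq_iff_eq_neg.mpr hfe, neg_mul, neg_mul, mul_assoc f, hE1]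
    have h2 : f * E * f * e = -(f * E * f) := by
      rw [mul_assoc, hfe, mul_neg, ← mul_assoc, mul_assoc f E e, hE2]
    have h3 : f * (f * E * f) = c • (E * f) := by
      rw [← mul_assoc, ← mul_assoc, hf, smul_mul_assoc, one_mul, smul_mul_assoc]
    have h4 : f * E * f * f = c • (f * E) := by rw [mul_assoc, hf, mul_smul_comm, mul_one]
    refine ⟨⟨E + c⁻¹ • (f * E * f), ?_⟩, Subtype.ext (LinearMap.ext fun u => ?_)⟩
    · rintro s (rfl | rfl | hs)
      · rw [mul_add, add_mul, mul_smul_comm, smul_mul_assoc, hE1, hE2, h1, h2]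
      · rw [mul_add, add_mul, mul_smul_comm, smul_mul_assoc, h3, h4, smul_smul, smul_smul,
          inv_mul_cancel₀ hc, one_smul, one_smul, add_comm]
      · have hsE : Commute s E := commute_cornerExtend he (hS s hs) (hy _ ⟨s, hs, rfl⟩)
        have hsf : Commute s f := (hS' s hs).symm
        exact hsE.add_right (((hsf.mul_right hsE).mul_right hsf).smul_right _)
    · change fixedProj he (E u + c⁻¹ • f (E (f u))) = y u
      have h5 : e (f u) = -f u := by rw [hef, mem_fixedSpace.mp u.2]
      have h6 : E u = y u := by rw [cornerExtend_apply, fixedProj_coe]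
      have h7 : E (f u) = 0 := by
        rw [cornerExtend_apply, fixedProj_of_neg he h5, map_zero, Submodule.coe_zero]
      rw [h6, h7, map_zero, smul_zero, add_zero, fixedProj_coe]

end Exchange

include he in
/-- An invertible operator anticommuting with an involution exchanges its eigenspaces. -/
theorem finrank_eq_finrank_fixedSpace_mul_two [FiniteDimensional ℝ V] {f f' : Module.End ℝ V}
    (hff' : f * f' = 1) (hf'f : f' * f = 1) (hfe : f * e = -(e * f)) :
    Module.finrank ℝ V = Module.finrank ℝ (fixedSpace e) * 2 := by
  have h1 : ∀ v, f (f' v) = v := fun v => congrArg (fun k : Module.End ℝ V => k v) hff'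
  have h2 : ∀ v, f' (f v) = v := fun v => congrArg (fun k : Module.End ℝ V => k v) hf'f
  have hef : ∀ v, f (e v) = -e (f v) := fun v => congrArg (fun k : Module.End ℝ V => k v) hfe
  have hef' : ∀ v, f' (e v) = -e (f' v) := fun v => by
    rw [← neg_inj, neg_neg, ← map_neg, ← h2 (e (f' v)), hef, h1]
  let E : V ≃ₗ[ℝ] fixedSpace e × fixedSpace e :=
    LinearEquiv.ofLinearMap ((fixedProj he).prod (fixedProj he ∘ₗ f'))
      ((fixedSpace e).subtype.coprod (f ∘ₗ (fixedSpace e).subtype))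
      (by
        refine LinearMap.ext fun ⟨u, u'⟩ => ?_
        have h3 : fixedProj he (f u') = 0 := fixedProj_of_neg he (by
          rw [← neg_inj, neg_neg, ← hef, mem_fixedSpace.mp u'.2])
        have h4 : fixedProj he (f' u) = 0 := fixedProj_of_neg he (by
          rw [← neg_inj, neg_neg, ← hef', mem_fixedSpace.mp u.2])
        simp [h2, h3, h4, fixedProj_coe])
      (by
        refine LinearMap.ext fun v => ?_
        simp [coe_fixedProj, hef, h1]
        module)
  rw [E.finrank_eq, Module.finrank_prod, mul_two]

/-- The centralizer of an involution `e` commuting with `S` splits as a product over the two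
eigenspaces of `e`. -/
theorem centralizer_corner_prod_algEquiv {S : Set (Module.End ℝ V)}
    (hS : ∀ s ∈ S, e * s = s * e) (he' : -e * -e = 1) :
    Nonempty (Subalgebra.centralizer ℝ (insert e S) ≃ₐ[ℝ]
      Subalgebra.centralizer ℝ (corner he '' S) × Subalgebra.centralizer ℝ (corner he' '' S)) := by
  have hS' : ∀ s ∈ S, -e * s = s * -e := fun s hs => by rw [neg_mul, mul_neg, hS s hs]
  have hcent : Subalgebra.centralizer ℝ (insert e S) ≤
      Subalgebra.centralizer ℝ (insert (-e) (insert e S)) := by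
    rintro x hx s (rfl | hs)
    · rw [neg_mul, mul_neg, hx e (Set.mem_insert _ _)]
    · exact hx s hs
  have hsub : S ⊆ insert e S := Set.subset_insert _ _
  let F₁ := cornerHom he (Set.mem_insert _ _) hsub hS
  let F₂ := (cornerHom he' (Set.mem_insert _ _) (hsub.trans (Set.subset_insert _ _)) hS').comp
    (Subalgebra.inclusion hcent)
  -- The `-1` eigenspace of `e` is the fixed space of `-e`.
  have hneg : ∀ v, e v = -v ↔ (-e) v = v := fun v => by
    rw [LinearMap.neg_apply, neg_eq_iff_eq_neg]
  refine ⟨AlgEquiv.ofBijective (F₁.prod F₂) ⟨?_, ?_⟩⟩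
  · rw [injective_iff_map_eq_zero]
    rintro ⟨x, hx⟩ h0
    have hxe : e * x = x * e := hx e (Set.mem_insert _ _)
    have hxe' : -e * x = x * -e := by rw [neg_mul, mul_neg, hxe]
    have hU : ∀ u : fixedSpace e, x u = 0 := fun u => by
      have h1 : corner he x = 0 := congrArg Subtype.val (congrArg Prod.fst h0)
      rw [← coe_corner he hxe, h1, LinearMap.zero_apply, Submodule.coe_zero]
    have hU' : ∀ u : fixedSpace (-e), x u = 0 := fun u => by
      have h1 : corner he' x = 0 := congrArg Subtype.val (congrArg Prod.snd h0)
      rw [← coe_corner he' hxe', h1, LinearMap.zero_apply, Submodule.coe_zero]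
    refine Subtype.ext (LinearMap.ext fun v => ?_)
    change x v = 0
    have h4 := hU' ⟨v - fixedProj he v, (hneg _).mp (sub_fixedProj he v)⟩
    rwa [map_sub, hU, sub_zero] at h4
  · rintro ⟨⟨y, hy⟩, ⟨y', hy'⟩⟩
    let E := cornerExtend he y
    let E' := cornerExtend he' y'
    have hE'1 : e * E' = -E' := by
      rw [← neg_inj, neg_neg, ← neg_mul, mul_cornerExtend]
    have hE'2 : E' * e = -E' := by
      rw [← neg_inj, neg_neg, ← mul_neg, cornerExtend_mul]
    refine ⟨⟨E + E', ?_⟩, Prod.ext (Subtype.ext (LinearMap.ext fun u => ?_))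
      (Subtype.ext (LinearMap.ext fun u => ?_))⟩
    · rintro s (rfl | hs)
      · rw [mul_add, add_mul, mul_cornerExtend, cornerExtend_mul, hE'1, hE'2]
      · rw [mul_add, add_mul, commute_cornerExtend he (hS s hs) (hy _ ⟨s, hs, rfl⟩),
          commute_cornerExtend he' (hS' s hs) (hy' _ ⟨s, hs, rfl⟩)]
    · change fixedProj he (E u + E' u) = y u
      have h5 : (-e) (u : V) = -u := by rw [LinearMap.neg_apply, mem_fixedSpace.mp u.2]
      have h6 : E' u = 0 := by
        rw [cornerExtend_apply, fixedProj_of_neg he' h5, map_zero, Submodule.coe_zero]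
      rw [h6, add_zero, cornerExtend_apply, fixedProj_coe, fixedProj_coe]
    · change fixedProj he' (E u + E' u) = y' u
      have h5 : e (u : V) = -u := (hneg _).mpr u.2
      have h6 : E u = 0 := by
        rw [cornerExtend_apply, fixedProj_of_neg he h5, map_zero, Submodule.coe_zero]
      rw [h6, zero_add, cornerExtend_apply, fixedProj_coe, fixedProj_coe]

end Involution

/-! ### Centralizers generated by square roots of `±1` -/

section CentralizerGenerators

open Module

variable {V : Type v} [AddCommGroup V] [Module ℝ V]

theorem Subalgebra.centralizer_le_of_subset_adjoin {A : Type*} [Ring A] [Algebra ℝ A]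
    {S T : Set A} (h : ∀ s ∈ S, s ∈ Algebra.adjoin ℝ T) :
    Subalgebra.centralizer ℝ T ≤ Subalgebra.centralizer ℝ S := by
  intro x hx s hs
  have h1 : Algebra.adjoin ℝ T ≤ Subalgebra.centralizer ℝ {x} := by
    refine Algebra.adjoin_le ?_
    rintro t ht _ rfl
    exact (hx t ht).symm
  exact (h1 (h s hs) x rfl).symm

theorem Subalgebra.centralizer_eq_of_subset_adjoin {A : Type*} [Ring A] [Algebra ℝ A]
    {S T : Set A} (h : ∀ s ∈ S, s ∈ Algebra.adjoin ℝ T) (h' : ∀ t ∈ T, t ∈ Algebra.adjoin ℝ S) :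
    Subalgebra.centralizer ℝ S = Subalgebra.centralizer ℝ T :=
  le_antisymm (centralizer_le_of_subset_adjoin h') (centralizer_le_of_subset_adjoin h)

variable {E O : Submodule ℝ (Module.End ℝ V)} {S : Set (Module.End ℝ V)}

theorem IsRealSpan.centralizer_union (h : IsRealSpan E) :
    Subalgebra.centralizer ℝ ((E : Set (Module.End ℝ V)) ∪ S) = Subalgebra.centralizer ℝ S := by
  refine le_antisymm (Subalgebra.centralizer_le ℝ _ _ Set.subset_union_right) ?_
  rintro x hx s (hs | hs)
  · obtain ⟨a, rfl⟩ := h s hs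
    rw [smul_one_mul, mul_smul_one]
  · exact hx s hs

theorem IsComplexSpan.centralizer_union {i : Module.End ℝ V} (h : IsComplexSpan E i) :
    Subalgebra.centralizer ℝ ((E : Set (Module.End ℝ V)) ∪ S) =
      Subalgebra.centralizer ℝ (insert i S) := by
  refine le_antisymm (Subalgebra.centralizer_le ℝ _ _ ?_) ?_
  · rintro s (rfl | hs)
    exacts [Or.inl h.mem, Or.inr hs]
  · rintro x hx s (hs | hs)
    · exact (h.commute (hx i (Or.inl rfl)).symm hs).symm
    · exact hx s (Or.inr hs)

theorem IsQuaternionSpan.centralizer_union {i j : Module.End ℝ V} (h : IsQuaternionSpan E i j) :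
    Subalgebra.centralizer ℝ ((E : Set (Module.End ℝ V)) ∪ S) =
      Subalgebra.centralizer ℝ (insert i (insert j S)) := by
  refine le_antisymm (Subalgebra.centralizer_le ℝ _ _ ?_) ?_
  · rintro s (rfl | rfl | hs)
    exacts [Or.inl h.mem_i, Or.inl h.mem_j, Or.inr hs]
  · rintro x hx s (hs | hs)
    · exact (h.commute (hx i (Or.inl rfl)).symm (hx j (Or.inr (Or.inl rfl))).symm hs).symm
    · exact hx s (Or.inr (Or.inr hs))

theorem IsOddGenerator.centralizer_union {f : Module.End ℝ V} {c : ℝ}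
    (h : IsOddGenerator E O f c) :
    Subalgebra.centralizer ℝ ((E : Set (Module.End ℝ V)) ∪ (O : Set (Module.End ℝ V)) ∪ S) =
      Subalgebra.centralizer ℝ ((E : Set (Module.End ℝ V)) ∪ insert f S) := by
  refine le_antisymm (Subalgebra.centralizer_le ℝ _ _ ?_) ?_
  · rintro s (hs | rfl | hs)
    exacts [Or.inl (Or.inl hs), Or.inl (Or.inr h.mem), Or.inr hs]
  · rintro x hx s ((hs | hs) | hs)
    · exact hx s (Or.inl hs)
    · obtain ⟨y, hy, rfl⟩ := h.span s hs
      have h1 : f * x = x * f := hx f (Or.inr (Or.inl rfl))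
      rw [mul_assoc, hx y (Or.inl hy), ← mul_assoc, h1, mul_assoc]
    · exact hx s (Or.inr (Or.inr hs))

variable [FiniteDimensional ℝ V]

theorem finrank_fixedSpace_mul_two {a b : Module.End ℝ V} (ha : a * a = 1) (hb : b * b = -1)
    (hba : b * a = -(a * b)) : finrank ℝ V = finrank ℝ (fixedSpace a) * 2 :=
  finrank_eq_finrank_fixedSpace_mul_two ha (f := b) (f' := -b) (by rw [mul_neg, hb, neg_neg])
    (by rw [neg_mul, hb, neg_neg]) hba

/-- The centralizer of a copy of the split quaternion algebra `ℝ(2)`. -/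
theorem centralizer_splitQuaternion_algEquiv {a b : Module.End ℝ V} (ha : a * a = 1)
    (hb : b * b = -1) (hba : b * a = -(a * b)) {n : ℕ} (hn : finrank ℝ V = n * 2) :
    Nonempty (Subalgebra.centralizer ℝ {a, b} ≃ₐ[ℝ] Matrix (Fin n) (Fin n) ℝ) := by
  have hb' : b * b = (-1 : ℝ) • (1 : Module.End ℝ V) := by rw [hb, neg_one_smul]
  obtain ⟨e⟩ := centralizer_corner_algEquiv ha (c := -1) (by norm_num) hb' hba (S := ∅)
    (fun _ h => h.elim) (fun _ h => h.elim)
  rw [Set.image_empty, insert_empty_eq] at e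
  have hd := finrank_fixedSpace_mul_two ha hb hba
  obtain ⟨e'⟩ := centralizer_empty_algEquiv (V := fixedSpace a) (n := n) (by omega)
  exact ⟨e.trans e'⟩

theorem corner_mul_self_eq_one {V : Type*} [AddCommGroup V] [Module ℝ V] {e x : Module.End ℝ V}
    (he : e * e = 1) (hx : e * x = x * e) (h : x * x = 1) : corner he x * corner he x = 1 := by
  rw [← corner_mul he hx x hx, h, corner_one]

theorem corner_mul_self_eq_neg_one {V : Type*} [AddCommGroup V] [Module ℝ V]
    {e x : Module.End ℝ V} (he : e * e = 1) (hx : e * x = x * e) (h : x * x = -1) :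
    corner he x * corner he x = -1 := by
  rw [← corner_mul he hx x hx, h, corner_neg, corner_one]

theorem corner_anti {V : Type*} [AddCommGroup V] [Module ℝ V] {e x y : Module.End ℝ V}
    (he : e * e = 1) (hx : e * x = x * e) (hy : e * y = y * e) (h : y * x = -(x * y)) :
    corner he y * corner he x = -(corner he x * corner he y) := by
  rw [← corner_mul he hx y hy, ← corner_mul he hy x hx, h, corner_neg]

end CentralizerGenerators

/-! ### The Dyson type of an irreducible representation -/

section MatrixConversions

/-- Block decomposition of square matrices. -/
def Matrix.blockAlgEquiv (n c : ℕ) (K : Type*) [Ring K] [Algebra ℝ K] :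
    Matrix (Fin (n * c)) (Fin (n * c)) K ≃ₐ[ℝ] Matrix (Fin n) (Fin n) (Matrix (Fin c) (Fin c) K) :=
  (Matrix.reindexAlgEquiv ℝ K finProdFinEquiv).symm.trans
    (Matrix.compAlgEquiv (Fin n) (Fin c) K ℝ).symm

/-- Matrices over a product of two algebras. -/
noncomputable def Matrix.prodAlgEquiv (n : ℕ) (K L : Type*) [Ring K] [Algebra ℝ K] [Ring L]
    [Algebra ℝ L] :
    Matrix (Fin n) (Fin n) (K × L) ≃ₐ[ℝ] Matrix (Fin n) (Fin n) K × Matrix (Fin n) (Fin n) L :=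
  AlgEquiv.ofBijective ((AlgHom.fst ℝ K L).mapMatrix.prod (AlgHom.snd ℝ K L).mapMatrix)
    ⟨fun x y h => by
      ext a b
      · exact congrFun (congrFun (congrArg Prod.fst h) a) b
      · exact congrFun (congrFun (congrArg Prod.snd h) a) b,
      fun x => ⟨Matrix.of fun a b => (x.1 a b, x.2 a b), rfl⟩⟩

end MatrixConversions

namespace PhiRep

open Module

variable {G : Type u} [Group G] {φ : G →* ℤˣ} {V : Type v} [AddCommGroup V] [Module ℝ V]
  [FiniteDimensional ℝ V] {R : PhiRep φ V}

/-- A representation has type `t` as soon as its three algebras are centralizers with the right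
structure. The dimension formula ensures that the size `n` is positive. -/
theorem hasDysonType_of_centralizer [Nontrivial V] {t : DysonType} {SD SB SA : Set (Module.End ℝ V)}
    (hD : R.algD = Subalgebra.centralizer ℝ SD) (hB : R.algB = Subalgebra.centralizer ℝ SB)
    (hA : R.algA = Subalgebra.centralizer ℝ SA) {n c : ℕ} (hn : finrank ℝ V = n * c)
    (eD : Nonempty (Subalgebra.centralizer ℝ SD ≃ₐ[ℝ] (t.minimalTriple.matrix n).D))
    (eB : Nonempty (Subalgebra.centralizer ℝ SB ≃ₐ[ℝ] (t.minimalTriple.matrix n).B))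
    (eA : Nonempty (Subalgebra.centralizer ℝ SA ≃ₐ[ℝ] (t.minimalTriple.matrix n).A)) :
    R.HasDysonType t := by
  obtain ⟨eD⟩ := eD
  obtain ⟨eB⟩ := eB
  obtain ⟨eA⟩ := eA
  refine ⟨n, ?_, ⟨(Subalgebra.equivOfEq _ _ hD).trans eD⟩, ⟨(Subalgebra.equivOfEq _ _ hB).trans eB⟩,
    ⟨(Subalgebra.equivOfEq _ _ hA).trans eA⟩⟩
  have h0 : 0 < finrank ℝ V := finrank_pos
  rw [hn] at h0
  exact Nat.pos_of_mul_pos_right h0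

variable (hR : R.IsIrreducible) {g₀ : G} (hg₀ : φ g₀ = -1)
include hR hg₀

/-- Without odd endomorphisms, `A` already contains `I`. -/
theorem IsIrreducible.algA_eq_algB (hO : R.oddEnd = ⊥) : R.algA = R.algB := by
  rw [hR.algA_eq hg₀, hR.algB_eq hg₀, hO]
  refine le_antisymm (Subalgebra.centralizer_le ℝ _ _ ?_)
    (Subalgebra.centralizer_le_of_subset_adjoin ?_)
  · exact Set.union_subset_union_left _ Set.subset_union_left
  · rintro s ((hs | rfl) | hs)
    exacts [Algebra.subset_adjoin (Or.inl hs), zero_mem _, Algebra.subset_adjoin (Or.inr hs)]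

/-- In the real case `D` consists of all operators, and `A` is the centralizer of the algebra of
`I` and the odd generator, if there is one; these generate `ℝ(2)` if the latter has square `1`, and
`ℍ` if it has square `-1`. -/
theorem IsIrreducible.hasDysonType_of_isRealSpan (hE : IsRealSpan R.evenEnd) {t : DysonType}
    (ht : Presents R.evenEnd R.oddEnd t) (hk : t = .RR ∨ t = .RC ∨ t = .RH) :
    R.HasDysonType t := by
  have := hR.1
  have hD : R.algD = Subalgebra.centralizer ℝ ∅ := by
    rw [hR.algD_eq, ← hE.centralizer_union (S := ∅), Set.union_empty]
  have hB : R.algB = Subalgebra.centralizer ℝ {R.I} := by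
    rw [hR.algB_eq hg₀, hE.centralizer_union]
  have hA : ∀ {f c}, IsOddGenerator R.evenEnd R.oddEnd f c →
      R.algA = Subalgebra.centralizer ℝ {f, R.I} := fun hf => by
    rw [hR.algA_eq hg₀, hf.centralizer_union, hE.centralizer_union]
  rcases hk with rfl | rfl | rfl
  · obtain ⟨-, f, hf⟩ := ht
    have hff : f * f = 1 := by rw [hf.sq, one_smul]
    have hIf : R.I * f = -(f * R.I) := by rw [(mem_oddEnd_iff.mp hf.mem).1, neg_neg]
    have hn := finrank_fixedSpace_mul_two hff R.I_mul_I hIf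
    obtain ⟨eD⟩ := centralizer_empty_algEquiv hn
    exact hasDysonType_of_centralizer hD hB (hA hf) hn ⟨eD.trans (Matrix.blockAlgEquiv _ 2 ℝ)⟩
      (centralizer_complex_algEquiv R.I_mul_I hn)
      (centralizer_splitQuaternion_algEquiv hff R.I_mul_I hIf hn)
  · obtain ⟨-, hO⟩ := ht
    obtain ⟨n, hn, eB⟩ := exists_centralizer_complex R.I_mul_I
    obtain ⟨eD⟩ := centralizer_empty_algEquiv hn
    exact hasDysonType_of_centralizer hD hB ((hR.algA_eq_algB hg₀ hO).trans hB) hn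
      ⟨eD.trans (Matrix.blockAlgEquiv _ 2 ℝ)⟩ eB eB
  · obtain ⟨-, f, hf⟩ := ht
    have hff : f * f = -1 := by rw [hf.sq, neg_one_smul]
    have hIf : R.I * f = -(f * R.I) := by rw [(mem_oddEnd_iff.mp hf.mem).1, neg_neg]
    obtain ⟨n, hn, eA⟩ := exists_centralizer_quaternion hff R.I_mul_I hIf
    obtain ⟨eD⟩ := centralizer_empty_algEquiv hn
    obtain ⟨eB⟩ := centralizer_complex_algEquiv R.I_mul_I (n := n * 2) (by omega)
    exact hasDysonType_of_centralizer hD hB (hA hf) hn ⟨eD.trans (Matrix.blockAlgEquiv _ 4 ℝ)⟩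
      ⟨eB.trans (Matrix.blockAlgEquiv _ 2 ℂ)⟩ eA

/-- In the complex case `e = i I` is an involution commuting with `i` and anticommuting with the odd
elements of `G`, so `B` is a product of two algebras of the same size. -/
theorem IsIrreducible.hasDysonType_of_isComplexSpan {i : Module.End ℝ V}
    (hE : IsComplexSpan R.evenEnd i) {t : DysonType}
    (ht : (t = .CC₁ ∧ R.oddEnd = ⊥) ∨
      (t = .CR ∧ ∃ f, IsOddGenerator R.evenEnd R.oddEnd f 1 ∧ f * i = -(i * f)) ∨
      (t = .CC₂ ∧ ∃ f, IsOddGenerator R.evenEnd R.oddEnd f 1 ∧ f * i = i * f) ∨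
      (t = .CH ∧ ∃ f, IsOddGenerator R.evenEnd R.oddEnd f (-1) ∧ f * i = -(i * f))) :
    R.HasDysonType t := by
  have := hR.1
  have hiI : i * R.I = R.I * i := (mem_evenEnd_iff.mp hE.mem).1
  have hi := hE.sq
  have hI := R.I_mul_I
  set e := i * R.I with he_def
  have hei : e * i = i * e := by rw [he_def, mul_assoc, ← hiI]
  have he : e * e = 1 := by
    rw [he_def, mul_assoc, ← mul_assoc R.I, ← hiI, mul_assoc i, hI, mul_neg, mul_neg, mul_one, hi,
      neg_neg]
  have he' : -e * -e = 1 := by rw [neg_mul_neg, he]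
  have hρe : R.ρ g₀ * e = -(e * R.ρ g₀) := by
    rw [he_def, ← mul_assoc, ← (mem_evenEnd_iff.mp hE.mem).2, mul_assoc, R.map_mul_I, hg₀,
      mul_assoc]
    simp
  have hρe' : R.ρ g₀ * -e = -(-e * R.ρ g₀) := by rw [mul_neg, hρe, neg_mul]
  have hdim : finrank ℝ V = finrank ℝ (fixedSpace e) * 2 :=
    finrank_eq_finrank_fixedSpace_mul_two he (R.rho_mul_rho_inv g₀) (R.rho_inv_mul_rho g₀) hρe
  have hdim' : finrank ℝ V = finrank ℝ (fixedSpace (-e)) * 2 :=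
    finrank_eq_finrank_fixedSpace_mul_two he' (R.rho_mul_rho_inv g₀) (R.rho_inv_mul_rho g₀) hρe'
  have hei' : -e * i = i * -e := by rw [neg_mul, hei, mul_neg]
  have hci : corner he i * corner he i = -1 := corner_mul_self_eq_neg_one he hei hi
  have hci' : corner he' i * corner he' i = -1 := corner_mul_self_eq_neg_one he' hei' hi
  have hD : R.algD = Subalgebra.centralizer ℝ {i} := by
    rw [hR.algD_eq, ← Set.union_empty (R.evenEnd : Set (Module.End ℝ V)), hE.centralizer_union,
      insert_empty_eq]
  -- The complex structure is `I = -i e`.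
  have hIe : R.I = -(i * e) := by rw [he_def, ← mul_assoc, hi, neg_one_mul, neg_neg]
  have hgen : ∀ S : Set (Module.End ℝ V), Subalgebra.centralizer ℝ (insert i (S ∪ {R.I})) =
      Subalgebra.centralizer ℝ (insert e (S ∪ {i})) := by
    intro S
    apply Subalgebra.centralizer_eq_of_subset_adjoin
    · have hmi : i ∈ Algebra.adjoin ℝ (insert e (S ∪ {i})) :=
        Algebra.subset_adjoin (Or.inr (Or.inr rfl))
      rintro s (rfl | hs | rfl)
      · exact hmi
      · exact Algebra.subset_adjoin (Or.inr (Or.inl hs))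
      · rw [hIe]
        exact neg_mem (mul_mem hmi (Algebra.subset_adjoin (Or.inl rfl)))
    · have hmi : i ∈ Algebra.adjoin ℝ (insert i (S ∪ {R.I})) := Algebra.subset_adjoin (Or.inl rfl)
      rintro s (rfl | hs | rfl)
      · exact mul_mem hmi (Algebra.subset_adjoin (Or.inr (Or.inr rfl)))
      · exact Algebra.subset_adjoin (Or.inr (Or.inl hs))
      · exact hmi
  have hB : R.algB = Subalgebra.centralizer ℝ {e, i} := by
    rw [hR.algB_eq hg₀, hE.centralizer_union]
    have := hgen ∅
    rwa [Set.empty_union, Set.empty_union] at this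
  have hA : ∀ {f c}, IsOddGenerator R.evenEnd R.oddEnd f c →
      R.algA = Subalgebra.centralizer ℝ {e, f, i} := fun hf => by
    rw [hR.algA_eq hg₀, hf.centralizer_union, hE.centralizer_union]
    exact hgen {_}
  have eB : ∀ {n}, finrank ℝ V = n * 4 → Nonempty (Subalgebra.centralizer ℝ {e, i} ≃ₐ[ℝ]
      Matrix (Fin n) (Fin n) ℂ × Matrix (Fin n) (Fin n) ℂ) := fun {n} hn => by
    obtain ⟨F⟩ := centralizer_corner_prod_algEquiv he (S := {i}) (by rintro _ rfl; exact hei) he'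
    rw [Set.image_singleton, Set.image_singleton] at F
    obtain ⟨F₁⟩ := centralizer_complex_algEquiv hci (n := n) (by omega)
    obtain ⟨F₂⟩ := centralizer_complex_algEquiv hci' (n := n) (by omega)
    exact ⟨F.trans (AlgEquiv.prodCongr F₁ F₂)⟩
  have eD : ∀ {n}, finrank ℝ V = n * 4 → Nonempty (Subalgebra.centralizer ℝ {i} ≃ₐ[ℝ]
      Matrix (Fin n) (Fin n) (Matrix (Fin 2) (Fin 2) ℂ)) := fun {n} hn => by
    obtain ⟨F⟩ := centralizer_complex_algEquiv hi (n := n * 2) (by omega)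
    exact ⟨F.trans (Matrix.blockAlgEquiv _ 2 ℂ)⟩
  obtain ⟨n, hn, -⟩ := exists_centralizer_complex hci
  have hn4 : finrank ℝ V = n * 4 := by omega
  rcases ht with ⟨rfl, hO⟩ | ⟨rfl, f, hf, hfi⟩ | ⟨rfl, f, hf, hfi⟩ | ⟨rfl, f, hf, hfi⟩
  · obtain ⟨F⟩ := eB hn4
    have F' := F.trans (Matrix.prodAlgEquiv n ℂ ℂ).symm
    exact hasDysonType_of_centralizer hD hB ((hR.algA_eq_algB hg₀ hO).trans hB) hn4 (eD hn4) ⟨F'⟩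
      ⟨F'⟩
  all_goals
    have hfI := (mem_oddEnd_iff.mp hf.mem).1
  · have hef : e * f = f * e := by
      rw [he_def, ← mul_assoc, hfi, neg_mul, mul_assoc i f, hfI, mul_neg, neg_neg, mul_assoc]
    have hef' : -e * f = f * -e := by rw [neg_mul, hef, mul_neg]
    have hif : i * f = -(f * i) := by rw [hfi, neg_neg]
    obtain ⟨F⟩ := centralizer_corner_prod_algEquiv he (S := {f, i})
      (by rintro _ (rfl | rfl); exacts [hef, hei]) he'
    rw [Set.image_pair, Set.image_pair] at F
    have hff : f * f = 1 := by rw [hf.sq, one_smul]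
    have hcf := corner_mul_self_eq_one he hef hff
    have hcf' := corner_mul_self_eq_one he' hef' hff
    obtain ⟨F₁⟩ := centralizer_splitQuaternion_algEquiv hcf hci (corner_anti he hef hei hif)
      (n := n) (by omega)
    obtain ⟨F₂⟩ := centralizer_splitQuaternion_algEquiv hcf' hci' (corner_anti he' hef' hei' hif)
      (n := n) (by omega)
    obtain ⟨FB⟩ := eB hn4
    exact hasDysonType_of_centralizer hD hB (hA hf) hn4 (eD hn4)
      ⟨FB.trans (Matrix.prodAlgEquiv n ℂ ℂ).symm⟩
      ⟨(F.trans (AlgEquiv.prodCongr F₁ F₂)).trans (Matrix.prodAlgEquiv n ℝ ℝ).symm⟩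
  · have hfe : f * e = -(e * f) := by
      rw [he_def, ← mul_assoc, hfi, mul_assoc, hfI, mul_neg, mul_assoc]
    obtain ⟨F⟩ := centralizer_corner_algEquiv he one_ne_zero hf.sq hfe (S := {i})
      (by rintro _ rfl; exact hei) (by rintro _ rfl; exact hfi)
    rw [Set.image_singleton] at F
    obtain ⟨F₁⟩ := centralizer_complex_algEquiv hci hn
    obtain ⟨FB⟩ := eB hn4
    exact hasDysonType_of_centralizer hD hB (hA hf) hn4 (eD hn4)
      ⟨FB.trans (Matrix.prodAlgEquiv n ℂ ℂ).symm⟩ ⟨F.trans F₁⟩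
  · have hef : e * f = f * e := by
      rw [he_def, ← mul_assoc, hfi, neg_mul, mul_assoc i f, hfI, mul_neg, neg_neg, mul_assoc]
    have hef' : -e * f = f * -e := by rw [neg_mul, hef, mul_neg]
    have hif : i * f = -(f * i) := by rw [hfi, neg_neg]
    obtain ⟨F⟩ := centralizer_corner_prod_algEquiv he (S := {f, i})
      (by rintro _ (rfl | rfl); exacts [hef, hei]) he'
    rw [Set.image_pair, Set.image_pair] at F
    have hff : f * f = -1 := by rw [hf.sq, neg_one_smul]
    have hcf := corner_mul_self_eq_neg_one he hef hff
    have hcf' := corner_mul_self_eq_neg_one he' hef' hff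
    obtain ⟨m, hm, ⟨F₁⟩⟩ := exists_centralizer_quaternion hcf hci (corner_anti he hef hei hif)
    obtain ⟨F₂⟩ := centralizer_quaternion_algEquiv hcf' hci' (corner_anti he' hef' hei' hif)
      (n := m) (by omega)
    obtain ⟨FB⟩ := eB (n := m * 2) (by omega)
    obtain ⟨FD⟩ := centralizer_complex_algEquiv hi (n := m * 4) (by omega)
    exact hasDysonType_of_centralizer hD hB (hA hf) (n := m) (c := 8) (by omega)
      ⟨FD.trans (Matrix.blockAlgEquiv _ 4 ℂ)⟩
      ⟨(FB.trans (AlgEquiv.prodCongr (Matrix.blockAlgEquiv _ 2 ℂ)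
        (Matrix.blockAlgEquiv _ 2 ℂ))).trans (Matrix.prodAlgEquiv m _ _).symm⟩
      ⟨(F.trans (AlgEquiv.prodCongr F₁ F₂)).trans (Matrix.prodAlgEquiv m _ _).symm⟩

/-- In the quaternionic case `e = i I` is an involution anticommuting with `j`. Splitting it off
leaves the complex structure `I` and, if there is an odd generator `f`, the operator `f j`. -/
theorem IsIrreducible.hasDysonType_of_isQuaternionSpan {i j : Module.End ℝ V}
    (hE : IsQuaternionSpan R.evenEnd i j) {t : DysonType}
    (ht : (t = .HC ∧ R.oddEnd = ⊥) ∨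
      (t = .HR ∧ ∃ f, IsOddGenerator R.evenEnd R.oddEnd f (-1) ∧ f * i = i * f ∧ f * j = j * f) ∨
      (t = .HH ∧ ∃ f, IsOddGenerator R.evenEnd R.oddEnd f 1 ∧ f * i = i * f ∧ f * j = j * f)) :
    R.HasDysonType t := by
  have := hR.1
  have hiI : i * R.I = R.I * i := (mem_evenEnd_iff.mp hE.mem_i).1
  have hjI : j * R.I = R.I * j := (mem_evenEnd_iff.mp hE.mem_j).1
  have hi := hE.sq_i
  have hj := hE.sq_j
  have hI := R.I_mul_I
  have heI : i * R.I * R.I = R.I * (i * R.I) := by rw [← mul_assoc, ← hiI]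
  set e := i * R.I with he_def
  have he : e * e = 1 := by
    rw [he_def, mul_assoc, ← mul_assoc R.I, ← hiI, mul_assoc i, hI, mul_neg, mul_neg, mul_one, hi,
      neg_neg]
  have hje : j * e = -(e * j) := by
    rw [he_def, ← mul_assoc, hE.anti, neg_mul, mul_assoc, hjI, mul_assoc]
  have hdim := finrank_fixedSpace_mul_two he hj hje
  have hj' : j * j = (-1 : ℝ) • (1 : Module.End ℝ V) := by rw [hj, neg_one_smul]
  have hcI : corner he R.I * corner he R.I = -1 := corner_mul_self_eq_neg_one he heI hI
  have hD : R.algD = Subalgebra.centralizer ℝ {i, j} := by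
    rw [hR.algD_eq, ← Set.union_empty (R.evenEnd : Set (Module.End ℝ V)), hE.centralizer_union,
      insert_empty_eq]
  -- The unit `i = -e I` can be recovered from `e` and `I`.
  have hie : i = -(e * R.I) := by rw [he_def, mul_assoc, hI, mul_neg, mul_one, neg_neg]
  have hB : R.algB = Subalgebra.centralizer ℝ {e, j, R.I} := by
    rw [hR.algB_eq hg₀, hE.centralizer_union]
    apply Subalgebra.centralizer_eq_of_subset_adjoin
    · have hm : ∀ s ∈ ({e, j, R.I} : Set (Module.End ℝ V)),
        s ∈ Algebra.adjoin ℝ ({e, j, R.I} : Set (Module.End ℝ V)) :=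
        fun s hs => Algebra.subset_adjoin hs
      rintro s (rfl | rfl | rfl)
      · rw [hie]
        exact neg_mem (mul_mem (hm _ (by simp)) (hm _ (by simp)))
      · exact hm _ (by simp)
      · exact hm _ (by simp)
    · have hm : ∀ s ∈ ({i, j, R.I} : Set (Module.End ℝ V)),
        s ∈ Algebra.adjoin ℝ ({i, j, R.I} : Set (Module.End ℝ V)) :=
        fun s hs => Algebra.subset_adjoin hs
      rintro s (rfl | rfl | rfl)
      · exact mul_mem (hm _ (by simp)) (hm _ (by simp))
      · exact hm _ (by simp)
      · exact hm _ (by simp)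
  have hA : ∀ {f c}, IsOddGenerator R.evenEnd R.oddEnd f c →
      R.algA = Subalgebra.centralizer ℝ {e, j, f * j, R.I} := fun {f c} hf => by
    rw [hR.algA_eq hg₀, hf.centralizer_union, hE.centralizer_union]
    apply Subalgebra.centralizer_eq_of_subset_adjoin
    · have hm : ∀ s ∈ ({e, j, f * j, R.I} : Set (Module.End ℝ V)),
        s ∈ Algebra.adjoin ℝ ({e, j, f * j, R.I} : Set (Module.End ℝ V)) :=
        fun s hs => Algebra.subset_adjoin hs
      rintro s (rfl | rfl | rfl | rfl)
      · rw [hie]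
        exact neg_mem (mul_mem (hm _ (by simp)) (hm _ (by simp)))
      · exact hm _ (by simp)
      · have hfj : s = -(s * j * j) := by rw [mul_assoc, hj, mul_neg, mul_one, neg_neg]
        have h := neg_mem (mul_mem (hm (s * j) (by simp)) (hm j (by simp)))
        rwa [← hfj] at h
      · exact hm _ (by simp)
    · have hm : ∀ s ∈ ({i, j, f, R.I} : Set (Module.End ℝ V)),
        s ∈ Algebra.adjoin ℝ ({i, j, f, R.I} : Set (Module.End ℝ V)) :=
        fun s hs => Algebra.subset_adjoin hs
      rintro s (rfl | rfl | rfl | rfl)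
      · exact mul_mem (hm _ (by simp)) (hm _ (by simp))
      · exact hm _ (by simp)
      · exact mul_mem (hm _ (by simp)) (hm _ (by simp))
      · exact hm _ (by simp)
  obtain ⟨F⟩ := centralizer_corner_algEquiv he (by norm_num) hj' hje (S := {R.I})
    (by rintro _ rfl; exact heI) (by rintro _ rfl; exact hjI)
  rw [Set.image_singleton] at F
  obtain ⟨n, hn, ⟨F₁⟩⟩ := exists_centralizer_complex hcI
  have hn4 : finrank ℝ V = n * 4 := by omega
  rcases ht with ⟨rfl, hO⟩ | ⟨rfl, f, hf, hfi, hfj⟩ | ⟨rfl, f, hf, hfi, hfj⟩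
  · exact hasDysonType_of_centralizer hD hB ((hR.algA_eq_algB hg₀ hO).trans hB) hn4
      (centralizer_quaternion_algEquiv hi hj hE.anti hn4) ⟨F.trans F₁⟩ ⟨F.trans F₁⟩
  all_goals
    have hfI := (mem_oddEnd_iff.mp hf.mem).1
    have hfe : f * e = -(e * f) := by
      rw [he_def, ← mul_assoc, hfi, mul_assoc, hfI, mul_neg, mul_assoc]
    have hef : e * f = -(f * e) := by rw [hfe, neg_neg]
    have hefj : e * (f * j) = f * j * e := by
      rw [← mul_assoc, hef, neg_mul, mul_assoc f e j, mul_assoc f j e, hje, mul_neg]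
    have hjfj : j * (f * j) = f * j * j := by rw [← mul_assoc, ← hfj]
    have hIfj : R.I * (f * j) = -(f * j * R.I) := by
      rw [mul_assoc, hjI, ← mul_assoc f, hfI, neg_mul, neg_neg, mul_assoc]
    have hsq : f * j * (f * j) = -(f * f) := by
      rw [mul_assoc, hjfj, mul_assoc, hj, mul_neg, mul_one, mul_neg]
    obtain ⟨F'⟩ := centralizer_corner_algEquiv he (by norm_num) hj' hje (S := {f * j, R.I})
      (by rintro _ (rfl | rfl); exacts [hefj, heI]) (by rintro _ (rfl | rfl); exacts [hjfj, hjI])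
    rw [Set.image_pair] at F'
  · have hc : corner he (f * j) * corner he (f * j) = 1 :=
      corner_mul_self_eq_one he hefj (by rw [hsq, hf.sq, neg_one_smul, neg_neg])
    obtain ⟨F₂⟩ := centralizer_splitQuaternion_algEquiv hc hcI (corner_anti he hefj heI hIfj) hn
    exact hasDysonType_of_centralizer hD hB (hA hf) hn4
      (centralizer_quaternion_algEquiv hi hj hE.anti hn4) ⟨F.trans F₁⟩ ⟨F'.trans F₂⟩
  · have hc : corner he (f * j) * corner he (f * j) = -1 :=
      corner_mul_self_eq_neg_one he hefj (by rw [hsq, hf.sq, one_smul])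
    obtain ⟨m, hm, ⟨F₂⟩⟩ := exists_centralizer_quaternion hc hcI (corner_anti he hefj heI hIfj)
    obtain ⟨FB⟩ := centralizer_complex_algEquiv hcI (n := m * 2) (by omega)
    obtain ⟨FD⟩ := centralizer_quaternion_algEquiv hi hj hE.anti (n := m * 2) (by omega)
    exact hasDysonType_of_centralizer hD hB (hA hf) (n := m) (c := 8) (by omega)
      ⟨FD.trans (Matrix.blockAlgEquiv _ 2 _)⟩ ⟨(F.trans FB).trans (Matrix.blockAlgEquiv _ 2 ℂ)⟩
      ⟨F'.trans F₂⟩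

theorem IsIrreducible.hasDysonType_of_presents {t : DysonType}
    (ht : Presents R.evenEnd R.oddEnd t) : R.HasDysonType t := by
  cases t with
  | RR => exact hR.hasDysonType_of_isRealSpan hg₀ ht.1 ht (by simp)
  | RC => exact hR.hasDysonType_of_isRealSpan hg₀ ht.1 ht (by simp)
  | RH => exact hR.hasDysonType_of_isRealSpan hg₀ ht.1 ht (by simp)
  | CR | CC₁ | CC₂ | CH =>
    obtain ⟨i, hE, hO⟩ := ht
    exact hR.hasDysonType_of_isComplexSpan hg₀ hE (by simpa using hO)
  | HR | HC | HH =>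
    obtain ⟨i, j, hE, hO⟩ := ht
    exact hR.hasDysonType_of_isQuaternionSpan hg₀ hE (by simpa using hO)

end PhiRep

/-! ### The least dimension of a right ideal -/

section MinIdealDim

open Module

/-- The algebra `K` has dimension `N`, and the least dimension of a nonzero principal right ideal
`x K` is `d`. For `K = M_n(F)` with `F` a division algebra, `N = n² dim F` and `d = n dim F`. -/
structure HasIdealDim (K : Type*) [Ring K] [Algebra ℝ K] (N d : ℕ) : Prop where
  finite : FiniteDimensional ℝ K
  finrank_eq : finrank ℝ K = N
  le : ∀ x : K, x ≠ 0 → d ≤ finrank ℝ (LinearMap.range (LinearMap.mulLeft ℝ x))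
  exists_le : ∃ x : K, x ≠ 0 ∧ finrank ℝ (LinearMap.range (LinearMap.mulLeft ℝ x)) ≤ d

variable {K L : Type*} [Ring K] [Algebra ℝ K] [Ring L] [Algebra ℝ L]

theorem AlgEquiv.finrank_range_mulLeft (e : K ≃ₐ[ℝ] L) (x : K) :
    finrank ℝ (LinearMap.range (LinearMap.mulLeft ℝ (e x))) =
      finrank ℝ (LinearMap.range (LinearMap.mulLeft ℝ x)) := by
  have : LinearMap.range (LinearMap.mulLeft ℝ (e x)) =
      (LinearMap.range (LinearMap.mulLeft ℝ x)).map (e.toLinearEquiv : K →ₗ[ℝ] L) := by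
    ext y
    constructor
    · rintro ⟨z, rfl⟩
      exact ⟨x * e.symm z, ⟨_, rfl⟩, by simp⟩
    · rintro ⟨_, ⟨z, rfl⟩, rfl⟩
      exact ⟨e z, by simp⟩
  rw [this]
  exact LinearEquiv.finrank_map_eq _ _

theorem HasIdealDim.eq {N N' d d' : ℕ} (h : HasIdealDim K N d) (h' : HasIdealDim L N' d')
    (e : K ≃ₐ[ℝ] L) : N = N' ∧ d = d' := by
  obtain ⟨x, hx, hxd⟩ := h.exists_le
  obtain ⟨y, hy, hyd⟩ := h'.exists_le
  have h1 := h'.le (e x) ((map_ne_zero_iff e e.injective).mpr hx)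
  have h2 := h.le (e.symm y) ((map_ne_zero_iff e.symm e.symm.injective).mpr hy)
  rw [AlgEquiv.finrank_range_mulLeft] at h1 h2
  exact ⟨h.finrank_eq.symm.trans (e.toLinearEquiv.finrank_eq.trans h'.finrank_eq), by omega⟩

theorem HasIdealDim.of_divisionRing {K : Type*} [DivisionRing K] [Algebra ℝ K]
    [FiniteDimensional ℝ K] {d : ℕ} (hd : finrank ℝ K = d) : HasIdealDim K d d := by
  have h : ∀ x : K, x ≠ 0 → finrank ℝ (LinearMap.range (LinearMap.mulLeft ℝ x)) = d := by
    intro x hx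
    have : LinearMap.range (LinearMap.mulLeft ℝ x) = ⊤ :=
      LinearMap.range_eq_top.mpr fun y => ⟨x⁻¹ * y, by simp [hx]⟩
    rw [this, finrank_top, hd]
  exact ⟨inferInstance, hd, fun x hx => (h x hx).ge, 1, one_ne_zero, (h 1 one_ne_zero).le⟩

theorem HasIdealDim.prod {N N' d : ℕ} (hK : HasIdealDim K N d) (hL : HasIdealDim L N' d) :
    HasIdealDim (K × L) (N + N') d := by
  have := hK.finite
  have := hL.finite
  refine ⟨inferInstance, by rw [finrank_prod, hK.finrank_eq, hL.finrank_eq], fun x hx => ?_, ?_⟩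
  · by_cases h1 : x.1 = 0
    · have h2 : x.2 ≠ 0 := fun h2 => hx (Prod.ext h1 h2)
      refine (hL.le _ h2).trans (le_trans (Submodule.finrank_mono ?_)
        (Submodule.finrank_map_le (LinearMap.snd ℝ K L) _))
      rintro _ ⟨y, rfl⟩
      exact ⟨_, ⟨(0, y), rfl⟩, rfl⟩
    · refine (hK.le _ h1).trans (le_trans (Submodule.finrank_mono ?_)
        (Submodule.finrank_map_le (LinearMap.fst ℝ K L) _))
      rintro _ ⟨y, rfl⟩
      exact ⟨_, ⟨(y, 0), rfl⟩, rfl⟩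
  · obtain ⟨x, hx, hxd⟩ := hK.exists_le
    refine ⟨(x, 0), fun h => hx (congrArg Prod.fst h), le_trans ?_ hxd⟩
    refine le_trans (Submodule.finrank_mono (t := (LinearMap.range (LinearMap.mulLeft ℝ x)).map
      (LinearMap.inl ℝ K L)) ?_) (Submodule.finrank_map_le _ _)
    rintro _ ⟨y, rfl⟩
    exact ⟨_, ⟨y.1, rfl⟩, by simp [Prod.ext_iff]⟩

theorem HasIdealDim.matrix {N d : ℕ} (h : HasIdealDim K N d) {n : ℕ} (hn : 0 < n) :
    HasIdealDim (Matrix (Fin n) (Fin n) K) (n * n * N) (n * d) := by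
  have := h.finite
  have hpi : ∀ k : K, finrank ℝ (Fin n → LinearMap.range (LinearMap.mulLeft ℝ k)) =
      n * finrank ℝ (LinearMap.range (LinearMap.mulLeft ℝ k)) := fun k => by
    rw [Module.finrank_pi_fintype]
    simp
  refine ⟨inferInstance, by rw [finrank_matrix, Fintype.card_fin, h.finrank_eq],
    fun x hx => ?_, ?_⟩
  · obtain ⟨a, b, hab⟩ : ∃ a b, x a b ≠ 0 := by
      by_contra! h0
      exact hx (Matrix.ext h0)
    -- The `a`-th rows of the elements of the ideal fill up `(x a b) Kⁿ`.
    let ι : (Fin n → LinearMap.range (LinearMap.mulLeft ℝ (x a b))) →ₗ[ℝ] Fin n → K :=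
      (LinearMap.range (LinearMap.mulLeft ℝ (x a b))).subtype.compLeft (Fin n)
    have hι : Function.Injective ι := fun u v huv =>
      funext fun c => Subtype.ext (congrFun huv c)
    let row : Matrix (Fin n) (Fin n) K →ₗ[ℝ] Fin n → K :=
      { toFun := fun M => M a
        map_add' := fun _ _ => rfl
        map_smul' := fun _ _ => rfl }
    have hsub : LinearMap.range ι ≤ (LinearMap.range (LinearMap.mulLeft ℝ x)).map row := by
      rintro _ ⟨u, rfl⟩
      choose v hv using fun c => (u c).2
      refine ⟨_, ⟨Matrix.of (Pi.single b v), rfl⟩, funext fun c => ?_⟩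
      have : (x * Matrix.of (Pi.single b v)) a c = x a b * v c := by
        rw [Matrix.mul_apply, Finset.sum_eq_single b]
        · simp
        · intro b' _ hb'
          simp [Pi.single_eq_of_ne hb']
        · simp
      exact this.trans (hv c)
    calc n * d ≤ n * finrank ℝ (LinearMap.range (LinearMap.mulLeft ℝ (x a b))) :=
          Nat.mul_le_mul_left n (h.le _ hab)
      _ = finrank ℝ (LinearMap.range ι) := by rw [← hpi, LinearMap.finrank_range_of_inj hι]
      _ ≤ _ := Submodule.finrank_mono hsub
      _ ≤ _ := Submodule.finrank_map_le _ _
  · obtain ⟨k, hk, hkd⟩ := h.exists_le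
    let a : Fin n := ⟨0, hn⟩
    refine ⟨Matrix.single a a k, fun h0 => hk ?_, ?_⟩
    · have := congrFun (congrFun h0 a) a
      simpa using this
    · let T : (Fin n → LinearMap.range (LinearMap.mulLeft ℝ k)) →ₗ[ℝ] Matrix (Fin n) (Fin n) K :=
        { toFun := fun u => Matrix.of fun p q => if p = a then (u q : K) else 0
          map_add' := fun u v => by
            ext p q
            by_cases hp : p = a <;> simp [hp]
          map_smul' := fun c u => by
            ext p q
            by_cases hp : p = a <;> simp [hp] }
      have hsub : LinearMap.range (LinearMap.mulLeft ℝ (Matrix.single a a k)) ≤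
          LinearMap.range T := by
        rintro _ ⟨y, rfl⟩
        refine ⟨fun c => ⟨k * y a c, ⟨_, rfl⟩⟩, ?_⟩
        ext p q
        by_cases hp : p = a
        · subst hp
          simp [T]
        · have h1 : (Matrix.single a a k * y) p q = 0 :=
            Matrix.single_mul_apply_of_ne _ _ _ _ _ hp _
          rw [LinearMap.mulLeft_apply, h1]
          exact if_neg hp
      calc _ ≤ finrank ℝ (LinearMap.range T) := Submodule.finrank_mono hsub
        _ ≤ finrank ℝ (Fin n → LinearMap.range (LinearMap.mulLeft ℝ k)) :=
          LinearMap.finrank_range_le T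
        _ ≤ n * d := by
          rw [hpi]
          exact Nat.mul_le_mul_left n hkd

/-- Matrix algebras over division rings are prime rings. -/
theorem Matrix.eq_zero_or_eq_zero_of_mul_mul_eq_zero {K : Type*} [DivisionRing K] {n : ℕ}
    {x y : Matrix (Fin n) (Fin n) K} (h : ∀ r, x * r * y = 0) : x = 0 ∨ y = 0 := by
  by_contra! hxy
  obtain ⟨a, b, hab⟩ : ∃ a b, x a b ≠ 0 := by
    by_contra! h0
    exact hxy.1 (Matrix.ext h0)
  obtain ⟨c, d, hcd⟩ : ∃ c d, y c d ≠ 0 := by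
    by_contra! h0
    exact hxy.2 (Matrix.ext h0)
  have h1 : (x * Matrix.single b c (1 : K) * y) a d = x a b * y c d := by
    rw [Matrix.mul_apply, Finset.sum_eq_single c]
    · simp
    · intro c' _ hc'
      rw [Matrix.mul_single_apply_of_ne _ _ _ _ _ hc', zero_mul]
    · simp
  rw [h, Matrix.zero_apply] at h1
  exact mul_ne_zero hab hcd h1.symm

/-- Matrix algebras over a product are not prime. -/
theorem Matrix.exists_mul_mul_eq_zero_of_prod (K L : Type*) [Ring K] [Nontrivial K] [Ring L]
    [Nontrivial L] {n : ℕ} (hn : 0 < n) :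
    ∃ x y : Matrix (Fin n) (Fin n) (K × L), x ≠ 0 ∧ y ≠ 0 ∧ ∀ r, x * r * y = 0 := by
  let a : Fin n := ⟨0, hn⟩
  refine ⟨Matrix.single a a (1, 0), Matrix.single a a (0, 1), fun h => ?_, fun h => ?_, fun r => ?_⟩
  · have := congrArg Prod.fst (congrFun (congrFun h a) a)
    simp at this
  · have := congrArg Prod.snd (congrFun (congrFun h a) a)
    simp at this
  · rw [Matrix.single_mul_mul_single]
    have h0 : ((1, 0) * r a a * (0, 1) : K × L) = 0 := by ext <;> simp
    rw [h0, Matrix.single_zero]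

end MinIdealDim

/-! ### The ten Dyson types are distinct -/

namespace DysonType

open Module

/-- `dim D` and the least dimension of a right ideal of `D`. -/
def invariantsD : DysonType → ℕ × ℕ
  | RR | RC => (4, 2)
  | RH => (16, 4)
  | CR | CC₁ | CC₂ => (8, 4)
  | CH => (32, 8)
  | HR | HC => (4, 4)
  | HH => (16, 8)

/-- `dim A` and the least dimension of a right ideal of `A`. -/
def invariantsA : DysonType → ℕ × ℕ
  | RR | HR => (1, 1)
  | CR => (2, 1)
  | CC₁ => (4, 2)
  | RC | CC₂ | HC => (2, 2)
  | RH | HH => (4, 4)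
  | CH => (8, 4)

theorem hasIdealDim_real : HasIdealDim ℝ 1 1 := .of_divisionRing (finrank_self ℝ)

theorem hasIdealDim_complex : HasIdealDim ℂ 2 2 := .of_divisionRing Complex.finrank_real_complex

theorem hasIdealDim_quaternion : HasIdealDim ℍ[ℝ] 4 4 := .of_divisionRing Quaternion.finrank_eq_four

theorem hasIdealDim_D (t : DysonType) :
    HasIdealDim t.minimalTriple.D t.invariantsD.1 t.invariantsD.2 := by
  cases t with
  | RR | RC => exact hasIdealDim_real.matrix (n := 2) (by norm_num)
  | RH => exact hasIdealDim_real.matrix (n := 4) (by norm_num)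
  | CR | CC₁ | CC₂ => exact hasIdealDim_complex.matrix (n := 2) (by norm_num)
  | CH => exact hasIdealDim_complex.matrix (n := 4) (by norm_num)
  | HR | HC => exact hasIdealDim_quaternion
  | HH => exact hasIdealDim_quaternion.matrix (n := 2) (by norm_num)

theorem hasIdealDim_A (t : DysonType) :
    HasIdealDim t.minimalTriple.A t.invariantsA.1 t.invariantsA.2 := by
  cases t with
  | RR | HR => exact hasIdealDim_real
  | RC | CC₂ | HC => exact hasIdealDim_complex
  | RH | HH => exact hasIdealDim_quaternion
  | CR => exact hasIdealDim_real.prod hasIdealDim_real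
  | CC₁ => exact hasIdealDim_complex.prod hasIdealDim_complex
  | CH => exact hasIdealDim_quaternion.prod hasIdealDim_quaternion

/-- If `M_m(K)` and `M_n(L)` are isomorphic, the ratio between the square of the least dimension of
a right ideal and the dimension is the same for `K` and `L`. -/
theorem sq_mul_eq_of_matrix_algEquiv {K L : Type*} [Ring K] [Algebra ℝ K] [Ring L] [Algebra ℝ L]
    {m n N N' d d' : ℕ} (hm : 0 < m) (hn : 0 < n) (hK : HasIdealDim K N d)
    (hL : HasIdealDim L N' d') (e : Matrix (Fin m) (Fin m) K ≃ₐ[ℝ] Matrix (Fin n) (Fin n) L) :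
    d ^ 2 * N' = d' ^ 2 * N := by
  obtain ⟨h1, h2⟩ := (hK.matrix hm).eq (hL.matrix hn) e
  have h3 : (m * n) ^ 2 * (d ^ 2 * N') = (m * n) ^ 2 * (d' ^ 2 * N) := by
    calc (m * n) ^ 2 * (d ^ 2 * N') = (m * d) ^ 2 * (n * n * N') := by ring
      _ = (m * n) ^ 2 * (d' ^ 2 * N) := by rw [h2, ← h1]; ring
  exact Nat.eq_of_mul_eq_mul_left (by positivity) h3

theorem not_CC₂_iso_CH {m n : ℕ} (hn : 0 < n) :
    ¬ ((minimalTriple CC₂).matrix m).Iso ((minimalTriple CH).matrix n) := by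
  rintro ⟨-, -, ⟨e'⟩⟩
  have e : Matrix (Fin m) (Fin m) ℂ ≃ₐ[ℝ] Matrix (Fin n) (Fin n) (ℍ[ℝ] × ℍ[ℝ]) := e'
  obtain ⟨x, y, hx, hy, hxy⟩ := Matrix.exists_mul_mul_eq_zero_of_prod ℍ[ℝ] ℍ[ℝ] hn
  have h : ∀ r, e.symm x * r * e.symm y = 0 := fun r => e.injective <| by
    rw [map_mul, map_mul, AlgEquiv.apply_symm_apply, AlgEquiv.apply_symm_apply, hxy, map_zero]
  rcases Matrix.eq_zero_or_eq_zero_of_mul_mul_eq_zero h with h | h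
  · exact hx ((map_eq_zero_iff e.symm e.symm.injective).mp h)
  · exact hy ((map_eq_zero_iff e.symm e.symm.injective).mp h)

end DysonType

theorem AlgTriple.Iso.symm {T : AlgTriple.{u}} {T' : AlgTriple.{v}} (h : T.Iso T') : T'.Iso T :=
  ⟨h.1.map AlgEquiv.symm, h.2.1.map AlgEquiv.symm, h.2.2.map AlgEquiv.symm⟩

theorem AlgTriple.Iso.trans {T : AlgTriple.{u}} {T' : AlgTriple.{v}} {T'' : AlgTriple.{w}}
    (h : T.Iso T') (h' : T'.Iso T'') : T.Iso T'' :=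
  ⟨h.1.map2 AlgEquiv.trans h'.1, h.2.1.map2 AlgEquiv.trans h'.2.1,
    h.2.2.map2 AlgEquiv.trans h'.2.2⟩

theorem DysonType.eq_of_matrix_iso {s t : DysonType} {m n : ℕ} (hm : 0 < m) (hn : 0 < n)
    (h : (s.minimalTriple.matrix m).Iso (t.minimalTriple.matrix n)) : s = t := by
  have h' := h
  obtain ⟨⟨eD⟩, -, ⟨eA⟩⟩ := h
  have hD := sq_mul_eq_of_matrix_algEquiv hm hn s.hasIdealDim_D t.hasIdealDim_D eD
  have hA := sq_mul_eq_of_matrix_algEquiv hm hn s.hasIdealDim_A t.hasIdealDim_A eA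
  by_cases h1 : s = CC₂ ∧ t = CH
  · obtain ⟨rfl, rfl⟩ := h1
    exact (not_CC₂_iso_CH hn h').elim
  by_cases h2 : s = CH ∧ t = CC₂
  · obtain ⟨rfl, rfl⟩ := h2
    exact (not_CC₂_iso_CH hm h'.symm).elim
  cases s <;> cases t <;> simp [invariantsD, invariantsA] at hD hA h1 h2 ⊢

theorem PhiRep.HasDysonType.eq {G : Type u} [Group G] {φ : G →* ℤˣ} {V : Type v} [AddCommGroup V]
    [Module ℝ V] {R : PhiRep φ V} {s t : DysonType} (hs : R.HasDysonType s)
    (ht : R.HasDysonType t) : s = t := by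
  obtain ⟨m, hm, hs⟩ := hs
  obtain ⟨n, hn, ht⟩ := ht
  exact DysonType.eq_of_matrix_iso hm hn (hs.symm.trans ht)

/-- The assignment `t ↦ t.superalgebra` is a one-to-one correspondence between the ten Dyson
types (ten distinct similarity classes of triples) and the isomorphism classes of real division
superalgebras, and the endomorphism superalgebra of every finite-dimensional `φ`-irrep is the
division superalgebra corresponding to its Dyson type. -/
theorem mainTheorem1 :
    (∀ s t : DysonType, ∀ m n : ℕ, 0 < m → 0 < n →
      (s.minimalTriple.matrix m).Iso (t.minimalTriple.matrix n) → s = t) ∧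
    (∀ t : DysonType, t.superalgebra.IsDivision) ∧
    (∀ X : RealSuperalgebra.{w}, X.IsDivision → ∃! t : DysonType, X.Iso t.superalgebra) ∧
    (∀ (G : Type u) [Group G] (φ : G →* ℤˣ), Function.Surjective φ →
      ∀ (V : Type v) [AddCommGroup V] [Module ℝ V] [FiniteDimensional ℝ V] (R : PhiRep φ V),
        R.IsIrreducible →
          (∃! t : DysonType, R.HasDysonType t) ∧
          R.endSuperalgebra.IsDivision ∧
          ∀ t : DysonType, R.HasDysonType t → R.endSuperalgebra.Iso t.superalgebra) := by
  refine ⟨fun s t m n hm hn h => DysonType.eq_of_matrix_iso hm hn h,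
    RealSuperalgebra.isDivision_superalgebra, fun X hX => hX.existsUnique_iso, ?_⟩
  intro G _ φ hφ V _ _ _ R hR
  obtain ⟨g₀, hg₀⟩ := hφ (-1)
  have hW := hR.isDivision
  have := hW.nontrivial
  obtain ⟨t, ht⟩ := hW.exists_presents
  have hRt := hR.hasDysonType_of_presents hg₀ (PhiRep.presents_evenEnd_oddEnd ht)
  refine ⟨⟨t, hRt, fun s hs => hs.eq hRt⟩, hW, fun s hs => ?_⟩
  rw [hs.eq hRt]
  exact RealSuperalgebra.iso_of_presents ht
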